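/- Let $\mathbb F$ be a field of characteristic zero, $\mu=(\mu_1,\dots,\mu_q)$ parameters, $R=y^2+z^2$, $E=x\partial_x+\tfrac12y\partial_y+\tfrac12z\partial_z$, $\Theta=z\partial_y-y\partial_z$, $Z^l_k=x^lR^{k-l}$ and $E^l_k=x^lR^{k-l}E$ ($0\le l\le k$). Let $w(\mu)=\Theta+f(x,R,\mu)E$ with $f\in\mathbb F[[x,R,\mu]]$, $f(0)=0$, $\partial_xf(0)\neq0$. *Permissible transformations.* The rotating change of variables $[x,y,z]=\exp(t\Theta)[X,Y,Z]$ turns $\Theta+fE$ into $fE$. On such reduced systems act the elements of the group generated by: time rescalings by invertible $u(x,R,\mu)\in\mathbb F[[x,R,\mu]]$; near-identity state changes $(x,y,z)\mapsto(x\tau^2,y\tau,z\tau)$ with $\tau\in\mathbb F[[x,R,\mu]]$, $\tau(0)=1$ (the time-one maps of the vector fields $hE$, $h\in\mathbb F[[x,R,\mu]]$, $h(0)=0$); formal invertible changes of parameters $\mu\mapsto\varphi(\mu)$. Afterwards $\Theta$ is put back by the inverse rotation. *Non-degeneracy.* The reduced system $fE$ can be transformed by this group into a system of the form $E^1_1+\sum_{k\ge0,\mathbf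 m}\beta^0_{k,\mathbf m}E^0_k\mu^{\mathbf m}$, $\beta^0_{0,\mathbf 0}=0$, for which $r:=\min\{k>1:\beta^0_{k,\mathbf 0}\ne0\}$ exists and the $(r+1)\times q$ matrix $(\beta^0_{i-1,e_j})_{i,j}$ has rank $r+1$ ($e_j$ is the $j$-th standard basis vector). *Levels.* For $\alpha\in\mathbb Z_{\ge0}^q$ give $E^l_k\mu^{\mathbf m}$ and $Z^l_k\mu^{\mathbf m}$ the grade $2k-l+\alpha\cdot\mathbf m$ and $\mu^{\mathbf m}\partial_{\mu_j}$ the grade $\alpha\cdot\mathbf m-\alpha_j$. Let $\mathscr S_n$ be the space of vector fields $hE$, $h\in\mathbb F[[x,R,\mu]]$, $h(0)=0$, of grade $n$, and $A_n$ the space of triples $(S,P,T)$ of grade $n$ with $S\in\mathscr S_n$, $P\in\mathbb F[[\mu]]^q$ and $T\in\mathbb F[[x,R,\mu]]$, the series $P_j$ and $T$ having no constant term; put $(S,P,T)*v=D_\mu(v)P+Tv+[S,v]$. For $v=\sum_{i\ge1}v_i$ and $k\le n$ let $d^{n,k}(Y_{n-1},\dots,Y_{n-k+1})=\sum_{i=1}^{k-1}Y_{n-i}*v_i$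 on tuples with $Y_j\in A_j$ and $(Y_{n-2},\dots,Y_{n-k+1})\in\ker d^{n-1,k-1}$, and $d^{n,k}=d^{n,n}$ for $k>n$. A normal form style chooses, for every $n$, a complement to each subspace of $\mathscr S_n$, so as to eliminate terms $E^l_k\mu^{\mathbf m}$, $l\ge1$, in preference to the terms $E^0_k\mu^{\mathbf m}$: the complement lies in the span of the latter whenever some complement does. With $\mathcal C^{n,k}$ the chosen complement of $\operatorname{im}d^{n,k}$ in $\mathscr S_n$, $v$ is in the $k$-th level extended partial (respectively infinite level) parametric normal form if $v_n\in\mathcal C^{n,k}$ (respectively $v_n\in\mathcal C^{n,n}$) for all $n\ge1$. **Theorem.** If $w(\mu)$ is non-degenerate with index $r$, then $2\le r$, $r+1\le q$, and there are $\beta_1,\beta_r\in\mathbb F$, $\beta_r\ne0$, such that, for $g=x+\beta_1R+\sum_{k=0}^rR^k\mu_{k+1}+\beta_rR^r$: 1. $w(\mu)$ can be transformed by permissible transformations (as above) into $\Theta+gE$, which in polar coordinates $y=\rho\sin\theta$, $z=\rho\cos\theta$ (so $R=\rho^2$) is the system $$\dot x=xg,\qquad\dot\rho=\tfrac12\rho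 g,\qquad\dot\theta=1,\qquad g=x+\beta_1\rho^2+\sum_{k=0}^r\rho^{2k}\mu_{k+1}+\beta_r\rho^{2r}.$$ 2. For every weight vector $\alpha$ with $\alpha_i=2(r-i+1)$, $1\le i\le r+1$, and every normal form style, the reduced system $gE$ is in the $(2r+1)$-th level extended partial parametric normal form, and it is already in the infinite level parametric normal form ($w^{(\infty)}=w^{(2r+1)}$). 3. The symmetry group of $gE$ (the permissible transformations leaving $gE$ invariant) is not finitely generated; moreover the space of infinitesimal generators $(S,P,T)$, $(S,P,T)*gE=0$, where $S=hE$, $h,T\in\mathbb F[[x,R,\mu]]$, $P\in\mathbb F[[\mu]]^q$, all without constant term, is not finitely generated over $\mathbb F[[\mu]]$. 4. There are no non-trivial symmetries among the permissible changes of state variables: every near-identity state change of the above kind that leaves $gE$ invariant is the time-one map of $c(\mu)\,gE$ for some $c\in\mathbb F[[\mu]]$. -/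

import Mathlib

open MvPowerSeries

namespace HopfZero

noncomputable section

/-- Formal power series in the state variables `x, y, z` (`Sum.inl 0, 1, 2`) and the parameters
`μ_1, …, μ_q` (`Sum.inr`), over the field `F`. In polar coordinates the same ring is used with
the state variables `x, ρ, θ`. -/
abbrev Fn (F : Type*) [Field F] (q : ℕ) := MvPowerSeries (Fin 3 ⊕ Fin q) F

/-- Formal power series in `x` (`Sum.inl 0`), `R` (`Sum.inl 1`) and the parameters. -/
abbrev Coef (F : Type*) [Field F] (q : ℕ) := MvPowerSeries (Fin 2 ⊕ Fin q) F

/-- Formal vector fields (possibly depending on parameters) as derivations. -/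
abbrev VF (F : Type*) [Field F] (q : ℕ) := Derivation F (Fn F q) (Fn F q)

section Basic

variable (F : Type*) [Field F] (q : ℕ)

/-- The state variable with index `i`. -/
def sv (i : Fin 3) : Fn F q := X (Sum.inl i)

/-- The parameter `μ_{j+1}`. -/
def par (j : Fin q) : Fn F q := X (Sum.inr j)

/-- The function `R = y² + z²`. -/
def rad : Fn F q := sv F q 1 ^ 2 + sv F q 2 ^ 2

/-- The arguments `x, y² + z², μ_1, …, μ_q`. -/
def args : Fin 2 ⊕ Fin q → Fn F q := Sum.elim ![sv F q 0, rad F q] (par F q)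

theorem hasSubst_args : HasSubst (args F q) := by
  apply hasSubst_of_constantCoeff_zero
  rintro (i | j)
  · fin_cases i <;> simp [args, rad, sv]
  · simp [args, par]

/-- The substitution `f(x, R, μ) ↦ f(x, y² + z², μ)`. -/
def emb : Coef F q →ₐ[F] Fn F q := substAlgHom (hasSubst_args F q)

/-- The functions of the form `f(x, y² + z², μ)`. -/
def eulerFns : Subalgebra F (Fn F q) := (emb F q).range

/-- The functions of the parameters alone. -/
def paramFns : Subalgebra F (Fn F q) where
  carrier := {k | ∀ i : Fin 3, pderiv F (Sum.inl i : Fin 3 ⊕ Fin q) k = 0}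
  mul_mem' := by
    intro a b ha hb i
    simp [ha i, hb i]
  add_mem' := by
    intro a b ha hb i
    simp [ha i, hb i]
  algebraMap_mem' := by
    intro c i
    exact Derivation.map_algebraMap _ c

/-- `E = x ∂_x + ½ y ∂_y + ½ z ∂_z`. -/
def eulerE : VF F q :=
  sv F q 0 • pderiv F (Sum.inl 0) + (C (1 / 2 : F) * sv F q 1) • pderiv F (Sum.inl 1)
    + (C (1 / 2 : F) * sv F q 2) • pderiv F (Sum.inl 2)

/-- `Θ = z ∂_y - y ∂_z`. -/
def rot : VF F q := sv F q 2 • pderiv F (Sum.inl 1) - sv F q 1 • pderiv F (Sum.inl 2)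

end Basic

variable {F : Type*} [Field F] {q : ℕ}

/-! ### Permissible transformations -/

/-- A permissible change of the state variables: a near-identity change along the Euler
direction, `(x, y, z) ↦ (x τ², y τ, z τ)` with `τ = τ(x, y² + z², μ)`, `τ(0) = 1`. (These are
the time-one maps of the vector fields `h(x, y² + z², μ) E`, `h(0) = 0`.) A formal change of
variables is given by the algebra automorphism of composition with it. -/
def IsStateChange (Φ : Fn F q ≃ₐ[F] Fn F q) : Prop :=
  (∀ j, Φ (par F q j) = par F q j) ∧
  ∃ τ ∈ eulerFns F q, constantCoeff τ = 1 ∧ Φ (sv F q 0) = sv F q 0 * τ ^ 2 ∧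
    Φ (sv F q 1) = sv F q 1 * τ ∧ Φ (sv F q 2) = sv F q 2 * τ

/-- A formal invertible change of the parameters, `μ ↦ φ(μ)`. (Invertibility of an automorphism
makes `φ(0) = 0` and the linear part of `φ` invertible.) -/
def IsParamChange (Φ : Fn F q ≃ₐ[F] Fn F q) : Prop :=
  (∀ i, Φ (sv F q i) = sv F q i) ∧ ∀ j, Φ (par F q j) ∈ paramFns F q

variable (F q) in
/-- Pairs of an invertible time factor `u` and a formal change of variables `Φ`, composed by
`(u, Φ) (u', Φ') = (u · Φ u', Φ ∘ Φ')`. -/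
abbrev Trans := (Fn F q)ˣ ⋊[MulDistribMulAction.toMulAut (Fn F q ≃ₐ[F] Fn F q) (Fn F q)ˣ]
  (Fn F q ≃ₐ[F] Fn F q)

variable (F q) in
/-- The group generated by time rescalings by an invertible `u(x, y² + z², μ)`, permissible
changes of the state variables and changes of the parameters. -/
def permissible : Subgroup (Trans F q) :=
  Subgroup.closure
    ({γ | ∃ u : (Fn F q)ˣ, (u : Fn F q) ∈ eulerFns F q ∧ γ = SemidirectProduct.inl u} ∪
     {γ | ∃ Φ : Fn F q ≃ₐ[F] Fn F q, IsStateChange Φ ∧ γ = SemidirectProduct.inr Φ} ∪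
     {γ | ∃ Φ : Fn F q ≃ₐ[F] Fn F q, IsParamChange Φ ∧ γ = SemidirectProduct.inr Φ})

/-- `γ = (u, Φ)` sends the vector field `V` to `V' = u · (Φ ∘ V ∘ Φ⁻¹)`. -/
def Sends (γ : Trans F q) (V V' : VF F q) : Prop :=
  ∀ k, V' (γ.right k) = (γ.left : Fn F q) * γ.right (V k)

/-- The expansion in powers of `t` of the composition of `k` with the flow `exp (t Θ)`. -/
def rotFlow (k : Fn F q) : PowerSeries (Fn F q) :=
  PowerSeries.mk fun n => ((n.factorial : F)⁻¹) • ((rot F q)^[n] k)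

/-- The time-dependent linear change `[x, y, z] = exp (t Θ) [X, Y, Z]` turns the system with
vector field `W` (in the old variables) into the autonomous system with vector field `V` (in the
new ones): `(∂_t + V) (k ∘ exp (t Θ)) = (W k) ∘ exp (t Θ)` for all `k`. -/
def Corotating (W V : VF F q) : Prop :=
  ∀ k, PowerSeries.derivative (Fn F q) (rotFlow k)
      + PowerSeries.mk (fun n => V (PowerSeries.coeff n (rotFlow k))) = rotFlow (W k)

/-- `W` can be transformed to `W'`: the linear part is removed by the rotating change of state
variables, the resulting system is transformed by a sequence of permissible transformations, and
the linear part is put back by the inverse rotating change. -/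
def Transformable (W W' : VF F q) : Prop :=
  ∃ V V' : VF F q, Corotating W V ∧ (∃ γ ∈ permissible F q, Sends γ V V') ∧ Corotating W' V'

/-- The symmetry group of `V`: the permissible transformations that leave `V` invariant. -/
def symmetryGroup (V : VF F q) : Subgroup (Trans F q) where
  carrier := {γ | γ ∈ permissible F q ∧ Sends γ V V}
  one_mem' := ⟨one_mem _, fun k => by simp⟩
  mul_mem' := by
    rintro a b ⟨ha, hA⟩ ⟨hb, hB⟩
    refine ⟨mul_mem ha hb, fun k => ?_⟩
    have h1 := hA (b.right k)
    rw [hB k] at h1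
    simp only [SemidirectProduct.mul_right, SemidirectProduct.mul_left, AlgEquiv.mul_apply,
      Units.val_mul, h1, map_mul, MulDistribMulAction.toMulAut_apply]
    rw [mul_assoc]
    rfl
  inv_mem' := by
    rintro a ⟨ha, hA⟩
    refine ⟨inv_mem ha, fun k => ?_⟩
    have h1 := hA (a.right⁻¹ k)
    have h2 : a.right (a.right⁻¹ k) = k := a.right.apply_symm_apply k
    rw [h2] at h1
    have h3 : V (a.right⁻¹ k) = a.right⁻¹ (a.right (V (a.right⁻¹ k))) :=
      (a.right.symm_apply_apply _).symm
    have h4 : a.right (V (a.right⁻¹ k)) = ((a.left⁻¹ : (Fn F q)ˣ) : Fn F q) * V k := by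
      rw [h1, ← mul_assoc, Units.inv_mul, one_mul]
    rw [SemidirectProduct.inv_right, h3, h4, map_mul]
    rfl

/-- `Φ` is the time-one map `exp D` of the formal vector field `D`. It is used for `D` whose
coefficients have order at least two, so that the terms with `n > |d|` vanish. -/
def IsTimeOneMap (D : VF F q) (Φ : Fn F q ≃ₐ[F] Fn F q) : Prop :=
  ∀ (k : Fn F q) (d : Fin 3 ⊕ Fin q →₀ ℕ), coeff d (Φ k) =
    ∑ n ∈ Finset.range (d.degree + 1), (n.factorial : F)⁻¹ * coeff d (D^[n] k)

/-! ### Non-degenerate perturbations -/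

/-- `f E` has the form `E^1_1 + ∑ β^0_{k,m} E^0_k μ^m` with `β^0_{0,0} = 0`, that is,
`f = x + ∑ β^0_{k,m} R^k μ^m`. -/
def IsSecondLevel (f : Coef F q) : Prop :=
  constantCoeff f = 0 ∧ coeff (Finsupp.single (Sum.inl 0) 1) f = 1 ∧
    ∀ d, coeff d f ≠ 0 → d (Sum.inl 0) = 0 ∨ d = Finsupp.single (Sum.inl 0) 1

/-- The matrix `a_{ij} = β^0_{i-1, e_j}` of size `(r + 1) × q`. -/
def coeffMatrix (r : ℕ) (f : Coef F q) : Matrix (Fin (r + 1)) (Fin q) F :=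
  Matrix.of fun i j =>
    coeff (Finsupp.single (Sum.inl 1) (i : ℕ) + Finsupp.single (Sum.inr j) 1) f

/-- `Θ + f(x, y² + z², μ) E` is a non-degenerate multi-parameter perturbation, of index `r`:
after the removal of `Θ` it can be transformed into a second level form for which
`r = min {k > 1 : β^0_{k,0} ≠ 0}` (in particular this set is not empty) and the matrix
`a_{ij}` has rank `r + 1`. -/
def IsNondegenerate (f : Coef F q) (r : ℕ) : Prop :=
  ∃ f₂ : Coef F q, IsSecondLevel f₂ ∧
    (∃ γ ∈ permissible F q,
      Sends γ (emb F q f • eulerE F q) (emb F q f₂ • eulerE F q)) ∧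
    IsLeast {k : ℕ | 1 < k ∧ coeff (Finsupp.single (Sum.inl 1) k) f₂ ≠ 0} r ∧
    (coeffMatrix r f₂).rank = r + 1

/-! ### Levels of normal forms -/

variable (F q) in
/-- Triples `(S, P, T)`; `S` stands for the vector field `S E`. -/
abbrev Gen := Fn F q × (Fin q → Fn F q) × Fn F q

/-- The Lie bracket of `h E` and `f E`. -/
theorem bracket_smul (h f : Fn F q) :
    ⁅h • eulerE F q, f • eulerE F q⁆ =
      (h * eulerE F q f - f * eulerE F q h) • eulerE F q := by
  ext k
  simp only [Derivation.commutator_apply, Derivation.smul_apply, Derivation.leibniz, smul_eq_mul]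
  ring_nf

/-- `(S, P, T) * v = D_μ(v) P + T v + [S, v]`, for the vector fields `S E` and `v E`. -/
def act (v : Fn F q) : Gen F q →ₗ[F] Fn F q where
  toFun Y := ∑ j, Y.2.1 j * pderiv F (Sum.inr j : Fin 3 ⊕ Fin q) v + Y.2.2 * v
    + (Y.1 * eulerE F q v - v * eulerE F q Y.1)
  map_add' Y Y' := by
    simp only [Prod.fst_add, Prod.snd_add, Pi.add_apply, add_mul, Finset.sum_add_distrib, map_add,
      mul_add]
    abel
  map_smul' c Y := by
    simp only [Prod.smul_fst, Prod.smul_snd, Pi.smul_apply, Derivation.map_smul, smul_mul_assoc,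
      mul_smul_comm, RingHom.id_apply, smul_add, smul_sub, Finset.smul_sum]

/-- Weights of the variables: `1` for `x, y, z` and `α_j` for `μ_j`; thus `E^l_k μ^m` and
`Z^l_k μ^m` have grade `2k - l + α·m`. -/
def wt (α : Fin q → ℕ) : Fin 3 ⊕ Fin q → ℕ := Sum.elim (fun _ => 1) α

variable (F) in
/-- The functions that are homogeneous of grade `n`. -/
def homog (α : Fin q → ℕ) (n : ℕ) : Submodule F (Fn F q) where
  carrier := {k | k.IsWeightedHomogeneous (wt α) n}
  add_mem' ha hb := ha.add hb
  zero_mem' := fun {d} h => absurd (by simp) h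
  smul_mem' c k hk := by
    intro d hd
    apply hk
    intro h0
    apply hd
    simp [h0]

/-- The part of grade `i`. -/
def comp (α : Fin q → ℕ) (v : Fn F q) (i : ℕ) : Fn F q :=
  weightedHomogeneousComponent (wt α) i v

variable (F) in
/-- The space of coefficients `f` of the vector fields `f E` of grade `n` in
`span {E^l_k μ^m : β^0_{0,0} = 0}`. -/
def stateSpace (α : Fin q → ℕ) (n : ℕ) : Submodule F (Fn F q) :=
  Subalgebra.toSubmodule (eulerFns F q) ⊓ homog F α n ⊓
    LinearMap.ker (coeff (R := F) (0 : Fin 3 ⊕ Fin q →₀ ℕ))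

variable (F) in
/-- The span of the terms `E^0_k μ^m` of grade `n`: the functions that do not contain `x`. -/
def radialSpace (α : Fin q → ℕ) (n : ℕ) : Submodule F (Fn F q) :=
  stateSpace F α n ⊓
    LinearMap.ker (pderiv F (Sum.inl 0 : Fin 3 ⊕ Fin q) : Fn F q →ₗ[F] Fn F q)

variable (F q) in
/-- The generators `(S, P, T)` of permissible transformations: `S E` in the Lie algebra of
perturbations, `P` a vector of parameter functions and `T` a time function, all without constant
term. -/
def generators : Submodule F (Gen F q) where
  carrier := {Y | (Y.1 ∈ eulerFns F q ∧ constantCoeff Y.1 = 0) ∧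
    (∀ j, Y.2.1 j ∈ paramFns F q ∧ constantCoeff (Y.2.1 j) = 0) ∧
    (Y.2.2 ∈ eulerFns F q ∧ constantCoeff Y.2.2 = 0)}
  add_mem' := by
    rintro Y Y' ⟨⟨h1, h2⟩, h3, ⟨h4, h5⟩⟩ ⟨⟨h1', h2'⟩, h3', ⟨h4', h5'⟩⟩
    exact ⟨⟨add_mem h1 h1', by simp [h2, h2']⟩,
      fun j => ⟨add_mem (h3 j).1 (h3' j).1, by simp [(h3 j).2, (h3' j).2]⟩,
      ⟨add_mem h4 h4', by simp [h5, h5']⟩⟩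
  zero_mem' := ⟨⟨zero_mem _, by simp⟩, fun j => ⟨zero_mem _, by simp⟩, ⟨zero_mem _, by simp⟩⟩
  smul_mem' := by
    rintro c Y ⟨⟨h1, h2⟩, h3, ⟨h4, h5⟩⟩
    exact ⟨⟨Subalgebra.smul_mem _ h1 c, by simp [h2]⟩,
      fun j => ⟨Subalgebra.smul_mem _ (h3 j).1 c, by simp [(h3 j).2]⟩,
      ⟨Subalgebra.smul_mem _ h4 c, by simp [h5]⟩⟩

variable (F) in
/-- The generators of grade `i`. The grade of `μ^m ∂_{μ_j}` is `α·m - α_j`, so that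
`A_i * S_n ⊆ S_{i+n}`. -/
def gradedGenerators (α : Fin q → ℕ) (i : ℕ) : Submodule F (Gen F q) :=
  generators F q ⊓
    (homog F α i).prod ((Submodule.pi Set.univ fun j => homog F α (i + α j)).prod (homog F α i))

/-- The domain of the level map at grade `n` with `k ≤ n` levels for `w = w_1 + w_2 + ⋯`: tuples
`(Y_{n-1}, …, Y_{n-k+1})` (with `Y i` in the role of `Y_{n-i}`, entries with other indices being
irrelevant), `Y_m` of grade `m`, for which `(Y_{n-2}, …, Y_{n-k+1})` is in the kernel of the level
map with `(n-1, k-1)`, and hence `(Y_{n-j-1}, …, Y_{n-k+1})` in that of `(n-j, k-j)`. -/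
def levelDomain (α : Fin q → ℕ) (w : Fn F q) (n k : ℕ) : Submodule F (ℕ → Gen F q) where
  carrier := {Y | (∀ i, 1 ≤ i → i < k → Y i ∈ gradedGenerators F α (n - i)) ∧
    ∀ j, 1 ≤ j → ∑ i ∈ Finset.Ico 1 (k - j), act (comp α w i) (Y (j + i)) = 0}
  add_mem' := by
    rintro Y Y' ⟨h1, h2⟩ ⟨h1', h2'⟩
    refine ⟨fun i hi hk => add_mem (h1 i hi hk) (h1' i hi hk), fun j hj => ?_⟩
    simp only [Pi.add_apply, map_add, Finset.sum_add_distrib, h2 j hj, h2' j hj, add_zero]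
  zero_mem' := ⟨fun i _ _ => zero_mem _, fun j _ => by simp⟩
  smul_mem' := by
    rintro c Y ⟨h1, h2⟩
    refine ⟨fun i hi hk => Submodule.smul_mem _ c (h1 i hi hk), fun j hj => ?_⟩
    simp only [Pi.smul_apply, map_smul, ← Finset.smul_sum, h2 j hj, smul_zero]

/-- The image of the level map `d^{n,k} (Y_{n-1}, …, Y_{n-k+1}) = ∑_{i=1}^{k-1} Y_{n-i} * w_i`,
where `d^{n,k} = d^{n,n}` for `k > n`. -/
def levelImage (α : Fin q → ℕ) (w : Fn F q) (n k : ℕ) : Submodule F (Fn F q) :=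
  (levelDomain α w n (min k n)).map
    (∑ i ∈ Finset.Ico 1 (min k n), act (comp α w i) ∘ₗ LinearMap.proj i)

variable (F) in
/-- A normal form style: a rule that assigns to each subspace `R` of each space of vector fields
of grade `n` a complement, eliminating terms `E^l_k μ^m` with `l ≥ 1` in preference to the terms
`E^0_k μ^m`: the complement is taken inside the span of the latter whenever this is possible. -/
structure NormalFormStyle (α : Fin q → ℕ) where
  compl : ℕ → Submodule F (Fn F q) → Submodule F (Fn F q)
  disjoint : ∀ n R, R ≤ stateSpace F α n → Disjoint R (compl n R)
  sup_eq : ∀ n R, R ≤ stateSpace F α n → R ⊔ compl n R = stateSpace F α n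
  preference : ∀ n R, R ≤ stateSpace F α n → R ⊔ radialSpace F α n = stateSpace F α n →
    compl n R ≤ radialSpace F α n

theorem nonempty_normalFormStyle (α : Fin q → ℕ) : Nonempty (NormalFormStyle F α) := by
  have key : ∀ A B : Submodule F (Fn F q), ∃ C ≤ B, Disjoint A C ∧ A ⊔ C = A ⊔ B := by
    intro A B
    obtain ⟨D, hD⟩ := exists_isCompl (A ⊓ B)
    refine ⟨D ⊓ B, inf_le_right, ?_, ?_⟩
    · rw [disjoint_iff, inf_comm D B, ← inf_assoc]
      exact disjoint_iff.mp hD.disjoint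
    · have h : B = (A ⊓ B) ⊔ (D ⊓ B) := by
        rw [← sup_inf_assoc_of_le D (inf_le_right : A ⊓ B ≤ B), hD.sup_eq_top, top_inf_eq]
      conv_rhs => rw [h, ← sup_assoc, sup_inf_self]
  classical
  refine ⟨⟨fun n R => if R ⊔ radialSpace F α n = stateSpace F α n then
    (key R (radialSpace F α n)).choose else (key R (stateSpace F α n)).choose, ?_, ?_, ?_⟩⟩
  · intro n R _
    split_ifs
    · exact (key R (radialSpace F α n)).choose_spec.2.1
    · exact (key R (stateSpace F α n)).choose_spec.2.1
  · intro n R hR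
    split_ifs with h
    · exact (key R (radialSpace F α n)).choose_spec.2.2.trans h
    · exact (key R (stateSpace F α n)).choose_spec.2.2.trans (sup_eq_right.mpr hR)
  · intro n R _ h
    rw [if_pos h]
    exact (key R (radialSpace F α n)).choose_spec.1

/-- `w E` is in the `k`-th level extended partial normal form: `w_n ∈ C^{n,k}` for all `n`. -/
def InLevel {α : Fin q → ℕ} (s : NormalFormStyle F α) (w : Fn F q) (k : ℕ) : Prop :=
  ∀ n, 1 ≤ n → comp α w n ∈ s.compl n (levelImage α w n k)

/-- `w E` is in the infinite level normal form: `w_n ∈ C^{n,n}` for all `n`. -/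
def InInfiniteLevel {α : Fin q → ℕ} (s : NormalFormStyle F α) (w : Fn F q) : Prop :=
  ∀ n, 1 ≤ n → comp α w n ∈ s.compl n (levelImage α w n n)

/-- The co-normal form space of `w E`: the generators `Y` of permissible transformations with
`Y * w = 0`. It generates the symmetry group. -/
def conormalSpace (w : Fn F q) : Submodule F (Gen F q) :=
  generators F q ⊓ LinearMap.ker (act w)

/-! ### The normal form and polar coordinates -/

/-- `x + β₁ R + ∑_{k=0}^r R^k μ_{k+1} + β_r R^r`, as an expression in given functions `x`, `R`. -/
def nf {r : ℕ} (hq : r + 1 ≤ q) (β₁ βr : F) (x R : Fn F q) : Fn F q :=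
  x + C β₁ * R + ∑ k : Fin (r + 1), R ^ (k : ℕ) * par F q (Fin.castLE hq k) + C βr * R ^ r

variable (F q) in
/-- Substitution of polar coordinates: `x = x`, `y = ρ sin θ`, `z = ρ cos θ`. -/
def polarMap [CharZero F] (k : Fn F q) : Fn F q :=
  subst (Sum.elim ![sv F q 0, sv F q 1 * (PowerSeries.sin F).subst (sv F q 2),
    sv F q 1 * (PowerSeries.cos F).subst (sv F q 2)] (par F q)) k

/-- The system `ẋ = a`, `ρ̇ = b`, `θ̇ = c`, as a vector field in the coordinates `x, ρ, θ`. -/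
def polarField (a b c : Fn F q) : VF F q :=
  a • pderiv F (Sum.inl 0) + b • pderiv F (Sum.inl 1) + c • pderiv F (Sum.inl 2)

/-- `P` is the system `W` written in polar coordinates: differentiating `x = x`, `y = ρ sin θ`,
`z = ρ cos θ` along `P` gives the components of `W` in polar coordinates. -/
def IsPolarForm [CharZero F] (W P : VF F q) : Prop :=
  ∀ i : Fin 3, P (polarMap F q (sv F q i)) = polarMap F q (W (sv F q i))

end

end HopfZero

open HopfZero

/-! The field `E` commutes with `Θ`, and `Θ` kills every function of `x`, `R`, `μ`, so the rotating
change simply strips `Θ` off (`corotating_add`). Every permissible transformation preserves the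
direction of `E`: a state change turns `f E` into `f' E` with `f' (τ + 2 Eτ) = Φ(f) τ`
(`sends_state_iff`). All claims thus become claims about the scalar coefficient, taken up to units
by time rescaling.

Normal form. A second level coefficient is `x + φ(R, μ)`. A state change with `τ = 1 + R s(R, μ)`
multiplies both `x` and `R` by `τ²`, so after removal of a unit the `x`-terms cancel and there
remains `φ τ² = β₁ R τ² + β_r (R τ²)^r + ∑ π_k(μ) (R τ²)^k`. This is a versal unfolding problem for
the unknowns `s` and `π_0, …, π_r`. Its linearization is `∑ R^k π_k + 2 (r - 1) β_r R^(r+1) s`,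
which is solvable because `r ≥ 2` and `β_r ≠ 0`; a contraction for the weights `R ↦ 1`, `μ_j ↦ r +
2` solves the full equation (`exists_defect_eq_zero`). The linear part of `φ` in `μ` is a matrix
times that of `π` (`exists_mul_linearPart`), so the rank condition lets `π_0, …, π_r` be completed
to new parameters (`IsSecondLevel.exists_sends`).

Levels. With the given weights `g` has parts `x`, `β₁ R` and one block of grade `2r`. On the first
two the action of `(S, P, T)` is multiplication by `T + S - E S`. The kernel conditions are
therefore triangular with pivot `x`, and for `2 ≤ n ≤ 2r` the image of the level map is exactly the
set of multiples of `x` (`sv_zero_dvd_of_mem_levelImage`). Every style must then choose all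
functions free of `x` as complement (`mem_compl_of_mem_radialSpace`).

Symmetries. For any `h` the triple `(g h, 0, g E h)` annihilates `g` (`nf_mul_mem_conormalSpace`),
and `τ = 1 + g h` changes `g` only by a unit (`exists_symmetry`). The first family has infinitely
many independent leading coefficients over the parameter functions; the second is uncountable,
whereas a finitely generated group is countable.

Rigidity. Without time rescaling, `σ = τ²` satisfies `g(xσ, Rσ) σ = g (σ + Eσ)`. At `x = y = z = 0`
this forces `σ ≡ 1` modulo `μ₁`, hence `σ = exp(c μ₁)` there for some `c(μ)` (`exists_exp_eq`). The
flow of `c g E` has the same restriction, and a solution is determined by its restriction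
(`IsSymmetryFactor.ext`), because `E` is invertible on terms of positive weight; this gives
`exists_isTimeOneMap`. -/

namespace HopfZero
noncomputable section

/-! ### Weight filtrations on power series: limits, contractions and near-identity endomorphisms -/

section General

variable {F : Type*} [Field F] {σ τ : Type*}

/-- The ideal of the power series all of whose terms have weight at least `n`. -/
def ordIdeal (w : σ → ℕ) (n : ℕ) : Ideal (MvPowerSeries σ F) where
  carrier := {a | ∀ d, Finsupp.weight w d < n → coeff d a = 0}
  add_mem' ha hb d hd := by rw [map_add, ha d hd, hb d hd, add_zero]
  zero_mem' d _ := map_zero _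
  smul_mem' c a ha d hd := by
    classical
    rw [smul_eq_mul, coeff_mul]
    refine Finset.sum_eq_zero fun p hp => ?_
    rw [ha p.2, mul_zero]
    refine lt_of_le_of_lt ?_ hd
    rw [← Finset.HasAntidiagonal.mem_antidiagonal.mp hp, map_add]
    exact Nat.le_add_left _ _

theorem mem_ordIdeal {w : σ → ℕ} {n : ℕ} {a : MvPowerSeries σ F} :
    a ∈ ordIdeal w n ↔ ∀ d, Finsupp.weight w d < n → coeff d a = 0 := Iff.rfl

theorem mem_ordIdeal_zero (w : σ → ℕ) (a : MvPowerSeries σ F) : a ∈ ordIdeal w 0 :=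
  fun _ hd => absurd hd (Nat.not_lt_zero _)

theorem ordIdeal_anti {w : σ → ℕ} {m n : ℕ} (h : m ≤ n) {a : MvPowerSeries σ F}
    (ha : a ∈ ordIdeal w n) : a ∈ ordIdeal w m :=
  fun d hd => ha d (hd.trans_le h)

theorem mul_mem_ordIdeal {w : σ → ℕ} {m n : ℕ} {a b : MvPowerSeries σ F}
    (ha : a ∈ ordIdeal w m) (hb : b ∈ ordIdeal w n) : a * b ∈ ordIdeal w (m + n) := by
  classical
  intro d hd
  rw [coeff_mul]
  refine Finset.sum_eq_zero fun p hp => ?_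
  have h : Finsupp.weight w p.1 + Finsupp.weight w p.2 = Finsupp.weight w d := by
    rw [← map_add, Finset.HasAntidiagonal.mem_antidiagonal.mp hp]
  rcases lt_or_ge (Finsupp.weight w p.1) m with h1 | h1
  · rw [ha p.1 h1, zero_mul]
  · rw [hb p.2 (by omega), mul_zero]

theorem pow_mem_ordIdeal {w : σ → ℕ} {m : ℕ} {a : MvPowerSeries σ F}
    (ha : a ∈ ordIdeal w m) (n : ℕ) : a ^ n ∈ ordIdeal w (n * m) := by
  induction n with
  | zero => simpa using mem_ordIdeal_zero w _
  | succ n ih => rw [pow_succ, Nat.succ_mul]; exact mul_mem_ordIdeal ih ha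

theorem X_mem_ordIdeal (w : σ → ℕ) (i : σ) : (X i : MvPowerSeries σ F) ∈ ordIdeal w (w i) := by
  classical
  intro d hd
  rw [coeff_X, if_neg]
  rintro rfl
  simp [Finsupp.weight_apply] at hd

theorem eq_zero_of_mem_ordIdeal {w : σ → ℕ} {a : MvPowerSeries σ F}
    (h : ∀ n, a ∈ ordIdeal w n) : a = 0 := by
  ext d
  exact h (Finsupp.weight w d + 1) d (Nat.lt_succ_self _)

theorem mem_ordIdeal_one_iff {a : MvPowerSeries σ F} :
    a ∈ ordIdeal (fun _ => 1) 1 ↔ constantCoeff a = 0 := by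
  rw [mem_ordIdeal]
  constructor
  · intro h
    exact h 0 (by simp)
  · intro h d hd
    have : d = 0 := by
      have : Finsupp.degree d = 0 := by
        rw [Finsupp.degree_eq_weight_one]; exact Nat.lt_one_iff.mp hd
      exact (Finsupp.degree_eq_zero_iff d).mp this
    rw [this]; exact h

/-- A Cauchy sequence for the filtration by weight has a limit. -/
theorem exists_limit {w : σ → ℕ} (b : ℕ → MvPowerSeries σ F)
    (hb : ∀ n, b (n + 1) - b n ∈ ordIdeal w n) : ∃ a, ∀ n, a - b n ∈ ordIdeal w n := by
  have key : ∀ n m, b (n + m) - b n ∈ ordIdeal w n := by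
    intro n m
    induction m with
    | zero => simp
    | succ m ih =>
      have := add_mem (ordIdeal_anti (Nat.le_add_right n m) (hb (n + m))) ih
      simpa [add_assoc] using this
  let a : MvPowerSeries σ F := fun d => coeff d (b (Finsupp.weight w d + 1))
  have ha : ∀ d, coeff d a = coeff d (b (Finsupp.weight w d + 1)) := fun d => rfl
  refine ⟨a, fun n d hd => ?_⟩
  obtain ⟨m, rfl⟩ := Nat.exists_eq_add_of_le (Nat.succ_le_of_lt hd)
  have := key (Finsupp.weight w d + 1) m d (Nat.lt_succ_self _)
  rw [map_sub, sub_eq_zero] at this ⊢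
  rw [Nat.succ_eq_add_one, this, ha]

/-- The contraction principle for the filtration by weight. -/
theorem exists_fixedPoint {w : σ → ℕ} (T : MvPowerSeries σ F → MvPowerSeries σ F)
    (hT : ∀ n a b, a - b ∈ ordIdeal w n → T a - T b ∈ ordIdeal w (n + 1)) :
    ∃ a, T a = a ∧ ∀ n, a - T^[n] 0 ∈ ordIdeal w n := by
  have hb : ∀ n, T^[n + 1] 0 - T^[n] 0 ∈ ordIdeal w n := by
    intro n
    induction n with
    | zero => exact mem_ordIdeal_zero _ _
    | succ n ih =>
      rw [Function.iterate_succ_apply' T (n + 1), Function.iterate_succ_apply' T n]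
      refine hT _ _ _ ?_
      rw [← Function.iterate_succ_apply' T n]
      exact ih
  obtain ⟨a, ha⟩ := exists_limit (fun n => T^[n] 0) hb
  refine ⟨a, ?_, ha⟩
  rw [← sub_eq_zero]
  refine eq_zero_of_mem_ordIdeal (w := w) fun n => ?_
  have h1 := hT _ _ _ (ha n)
  rw [← Function.iterate_succ_apply' T n] at h1
  have := sub_mem h1 (ha (n + 1))
  rw [sub_sub_sub_cancel_right] at this
  exact ordIdeal_anti (Nat.le_succ n) this

/-- A power series is its constant term plus a combination of the variables. -/
theorem exists_eq_sum_X_mul [Fintype σ] (k : MvPowerSeries σ F) :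
    ∃ a : σ → MvPowerSeries σ F, k = C (constantCoeff k) + ∑ i, X i * a i ∧
      ∀ n, k ∈ ordIdeal (fun _ => 1) (n + 1) → ∀ i, a i ∈ ordIdeal (fun _ => 1) n := by
  classical
  -- Each nonconstant monomial is assigned one variable dividing it, so that it is counted in
  -- exactly one summand.
  have hch : ∀ d : σ →₀ ℕ, ∃ i : Option σ, (d = 0 ∧ i = none) ∨ ∃ j, i = some j ∧ d j ≠ 0 := by
    intro d
    by_cases h : d = 0
    · exact ⟨none, Or.inl ⟨h, rfl⟩⟩
    · obtain ⟨i, hi⟩ := Finsupp.ne_iff.mp h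
      exact ⟨some i, Or.inr ⟨i, rfl, hi⟩⟩
  choose ch hch using hch
  let a : σ → MvPowerSeries σ F := fun i e =>
    if ch (e + Finsupp.single i 1) = some i then coeff (e + Finsupp.single i 1) k else 0
  have ha : ∀ i e, coeff e (a i) =
    if ch (e + Finsupp.single i 1) = some i then coeff (e + Finsupp.single i 1) k else 0 :=
    fun i e => rfl
  refine ⟨a, ?_, ?_⟩
  · ext d
    have hX : ∀ i, coeff d (X i * a i) = if ch d = some i then coeff d k else 0 := by
      intro i
      rw [X, coeff_monomial_mul, one_mul]
      by_cases hi : Finsupp.single i 1 ≤ d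
      · rw [if_pos hi, ha, tsub_add_cancel_of_le hi]
      · rw [if_neg hi, if_neg]
        intro hc
        rcases hch d with ⟨_, h2⟩ | ⟨j, hj, hdj⟩
        · rw [h2] at hc; cases hc
        · rw [hc] at hj
          cases hj
          exact hi (Finsupp.single_le_iff.mpr (Nat.one_le_iff_ne_zero.mpr hdj))
    rw [map_add, map_sum, Finset.sum_congr rfl fun i _ => hX i, coeff_C]
    rcases hch d with ⟨h1, h2⟩ | ⟨j, hj, hdj⟩
    · simp [h1, h1 ▸ h2]
    · have hd : d ≠ 0 := by rintro rfl; exact hdj rfl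
      simp [hj, hd]
  · intro n hk i d hd
    rw [ha]
    split_ifs
    · apply hk
      rw [map_add, Finsupp.weight_single]
      simpa using hd
    · rfl

/-- A linear map that kills `1` and is compatible with multiplication by the variables is zero. -/
theorem linearMap_eq_zero [Finite σ] (D : MvPowerSeries σ F →ₗ[F] MvPowerSeries τ F)
    (p : σ → MvPowerSeries τ F) (hp : ∀ i, constantCoeff (p i) = 0) (h1 : D 1 = 0)
    (hX : ∀ i a, D (X i * a) = p i * D a) (k : MvPowerSeries σ F) : D k = 0 := by
  cases nonempty_fintype σ
  refine eq_zero_of_mem_ordIdeal (w := fun _ => 1) fun n => ?_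
  induction n generalizing k with
  | zero => exact mem_ordIdeal_zero _ _
  | succ n ih =>
    obtain ⟨a, ha, -⟩ := exists_eq_sum_X_mul k
    have hC : (C (constantCoeff k) : MvPowerSeries σ F) = constantCoeff k • 1 := by
      rw [smul_eq_C_mul, mul_one]
    rw [ha, map_add, hC, map_smul, h1, smul_zero, zero_add, map_sum]
    refine Ideal.sum_mem _ fun i _ => ?_
    rw [hX, add_comm]
    exact mul_mem_ordIdeal (mem_ordIdeal_one_iff.mpr (hp i)) (ih _)

/-- No continuity is assumed: images of the variables without constant term already make a
homomorphism respect the order filtration, which is separated. -/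
theorem algHom_ext_X [Finite σ] {Φ Ψ : MvPowerSeries σ F →ₐ[F] MvPowerSeries τ F}
    (h0 : ∀ i, constantCoeff (Φ (X i)) = 0) (h : ∀ i, Φ (X i) = Ψ (X i)) : Φ = Ψ := by
  ext1 k
  rw [← sub_eq_zero]
  refine linearMap_eq_zero (Φ.toLinearMap - Ψ.toLinearMap) (fun i => Φ (X i)) h0 (by simp)
    (fun i a => ?_) k
  simp [h, mul_sub]

/-- Two derivations along `Φ` that agree on the variables agree. -/
theorem derivation_along_ext [Finite σ] (Φ : MvPowerSeries σ F →ₐ[F] MvPowerSeries τ F)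
    (h0 : ∀ i, constantCoeff (Φ (X i)) = 0)
    (D₁ D₂ : MvPowerSeries σ F →ₗ[F] MvPowerSeries τ F)
    (h₁ : ∀ a b, D₁ (a * b) = Φ a * D₁ b + Φ b * D₁ a)
    (h₂ : ∀ a b, D₂ (a * b) = Φ a * D₂ b + Φ b * D₂ a)
    (h : ∀ i, D₁ (X i) = D₂ (X i)) (k : MvPowerSeries σ F) : D₁ k = D₂ k := by
  have one : ∀ D : MvPowerSeries σ F →ₗ[F] MvPowerSeries τ F,
      (∀ a b, D (a * b) = Φ a * D b + Φ b * D a) → D 1 = 0 := by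
    intro D hD
    have := hD 1 1
    simpa using this
  rw [← sub_eq_zero]
  refine linearMap_eq_zero (D₁ - D₂) (fun i => Φ (X i)) h0 (by simp [one D₁ h₁, one D₂ h₂])
    (fun i a => ?_) k
  simp only [LinearMap.sub_apply, h₁, h₂, h]
  ring

theorem constantCoeff_algHom [Finite σ] (Φ : MvPowerSeries σ F →ₐ[F] MvPowerSeries τ F)
    (h0 : ∀ i, constantCoeff (Φ (X i)) = 0) (k : MvPowerSeries σ F) :
    constantCoeff (Φ k) = constantCoeff k := by
  cases nonempty_fintype σ
  obtain ⟨a, ha, -⟩ := exists_eq_sum_X_mul k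
  have hC : (C (constantCoeff k) : MvPowerSeries σ F) = algebraMap F _ (constantCoeff k) := rfl
  rw [ha, hC]
  simp only [map_add, map_sum, map_mul, h0, AlgHom.commutes]
  simp [MvPowerSeries.algebraMap_apply]

/-- An isomorphism maps the variables to series without constant term. -/
theorem constantCoeff_algEquiv_X (Φ : MvPowerSeries σ F ≃ₐ[F] MvPowerSeries τ F) (i : σ) :
    constantCoeff (Φ (X i)) = 0 := by
  by_contra h
  have h1 : IsUnit (Φ (X i)) := isUnit_iff_constantCoeff.mpr (isUnit_iff_ne_zero.mpr h)
  have h2 := h1.map Φ.symm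
  rw [AlgEquiv.symm_apply_apply, isUnit_iff_constantCoeff] at h2
  simp at h2

/-- Induction on the order: in `Φ(X b) - X b = (Φ X - X) Φ b + X (Φ b - b)` the first summand gains
from the hypothesis, the second from the induction. -/
theorem algHom_sub_mem_ordIdeal [Finite σ] (Φ : MvPowerSeries σ F →ₐ[F] MvPowerSeries σ F)
    (h : ∀ i, Φ (X i) - X i ∈ ordIdeal (fun _ => 1) 2) (n : ℕ) (a : MvPowerSeries σ F)
    (ha : a ∈ ordIdeal (fun _ => 1) n) : Φ a - a ∈ ordIdeal (fun _ => 1) (n + 1) := by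
  cases nonempty_fintype σ
  have hX : ∀ i, (X i : MvPowerSeries σ F) ∈ ordIdeal (fun _ => 1) 1 := fun i =>
    X_mem_ordIdeal _ i
  have hΦ : ∀ i, Φ (X i) ∈ ordIdeal (fun _ => 1) 1 := fun i => by
    simpa using add_mem (ordIdeal_anti one_le_two (h i)) (hX i)
  induction n generalizing a with
  | zero =>
    rw [zero_add, mem_ordIdeal_one_iff, map_sub,
      constantCoeff_algHom Φ fun i => mem_ordIdeal_one_iff.mp (hΦ i), sub_self]
  | succ n ih =>
    obtain ⟨b, hb, hb'⟩ := exists_eq_sum_X_mul a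
    have h0 : constantCoeff a = 0 :=
      mem_ordIdeal_one_iff.mp (ordIdeal_anti (Nat.le_add_left 1 n) ha)
    rw [h0, map_zero, zero_add] at hb
    have hb := hb' n ha
    have hs : Φ a - a = ∑ i, ((Φ (X i) - X i) * Φ (b i) + X i * (Φ (b i) - b i)) := by
      conv_lhs => rw [‹a = _›]
      rw [map_sum, ← Finset.sum_sub_distrib]
      refine Finset.sum_congr rfl fun i _ => ?_
      rw [map_mul]; ring
    rw [hs]
    refine Ideal.sum_mem _ fun i _ => add_mem ?_ ?_
    · have h1 : Φ (b i) ∈ ordIdeal (fun _ => 1) n := by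
        simpa using add_mem (ordIdeal_anti n.le_succ (ih _ (hb i))) (hb i)
      have := mul_mem_ordIdeal (h i) h1
      rwa [show 2 + n = n + 1 + 1 by ring] at this
    · have := mul_mem_ordIdeal (hX i) (ih _ (hb i))
      rwa [show 1 + (n + 1) = n + 1 + 1 by ring] at this

/-- An endomorphism tangent to the identity is bijective. -/
theorem bijective_of_near_identity [Finite σ] (Φ : MvPowerSeries σ F →ₐ[F] MvPowerSeries σ F)
    (h : ∀ i, Φ (X i) - X i ∈ ordIdeal (fun _ => 1) 2) : Function.Bijective Φ := by
  constructor
  · rw [injective_iff_map_eq_zero]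
    intro a ha
    refine eq_zero_of_mem_ordIdeal (w := fun _ => 1) fun n => ?_
    induction n with
    | zero => exact mem_ordIdeal_zero _ _
    | succ n ih =>
      have := algHom_sub_mem_ordIdeal Φ h n a ih
      rw [ha, zero_sub] at this
      exact neg_mem_iff.mp this
  · intro b
    -- Solving `Φ a = b` amounts to finding a fixed point of `a ↦ b - (Φ a - a)`, a contraction
    -- because `Φ - id` raises the order.
    obtain ⟨a, ha, -⟩ := exists_fixedPoint (w := fun _ => 1) (fun a => b - (Φ a - a)) (by
      intro n a a' haa
      have := neg_mem (algHom_sub_mem_ordIdeal Φ h n _ haa)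
      rw [map_sub] at this
      convert this using 1
      ring)
    exact ⟨a, by linear_combination -ha⟩

end General

/-! ### The fields `E` and `Θ` and the functions of `x`, `R`, `μ` -/

section Basics

variable {F : Type*} [Field F] {q : ℕ}

theorem constantCoeff_sv (i : Fin 3) : constantCoeff (sv F q i) = 0 := by simp [sv]

theorem constantCoeff_par (j : Fin q) : constantCoeff (par F q j) = 0 := by simp [par]

theorem constantCoeff_rad : constantCoeff (rad F q) = 0 := by simp [rad, sv]

theorem sv_ne_zero (i : Fin 3) : sv F q i ≠ 0 := fun h => by
  have := congrArg (coeff (Finsupp.single (Sum.inl i) 1)) h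
  simp [sv] at this

theorem pderiv_sv (i j : Fin 3) :
    pderiv F (Sum.inl i : Fin 3 ⊕ Fin q) (sv F q j) = if j = i then 1 else 0 := by
  split_ifs with h
  · rw [h]; exact pderiv_X_self
  · exact pderiv_X_of_ne (by simpa using h)

theorem pderiv_par (i : Fin 3) (j : Fin q) :
    pderiv F (Sum.inl i : Fin 3 ⊕ Fin q) (par F q j) = 0 :=
  pderiv_X_of_ne (by simp)

theorem pderiv_inr_sv (j : Fin q) (i : Fin 3) :
    pderiv F (Sum.inr j : Fin 3 ⊕ Fin q) (sv F q i) = 0 :=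
  pderiv_X_of_ne (by simp)

theorem eulerE_apply (k : Fn F q) : eulerE F q k = sv F q 0 * pderiv F (Sum.inl 0) k
    + C (1 / 2 : F) * sv F q 1 * pderiv F (Sum.inl 1) k
    + C (1 / 2 : F) * sv F q 2 * pderiv F (Sum.inl 2) k := rfl

theorem rot_apply (k : Fn F q) : rot F q k = sv F q 2 * pderiv F (Sum.inl 1) k
    - sv F q 1 * pderiv F (Sum.inl 2) k := by
  simp [rot, Derivation.sub_apply]

@[simp] theorem eulerE_sv_zero : eulerE F q (sv F q 0) = sv F q 0 := by
  simp [eulerE_apply, pderiv_sv]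

@[simp] theorem eulerE_sv_one : eulerE F q (sv F q 1) = C (1 / 2 : F) * sv F q 1 := by
  simp [eulerE_apply, pderiv_sv]

@[simp] theorem eulerE_sv_two : eulerE F q (sv F q 2) = C (1 / 2 : F) * sv F q 2 := by
  simp [eulerE_apply, pderiv_sv]

theorem eulerE_of_mem_paramFns {k : Fn F q} (hk : k ∈ paramFns F q) : eulerE F q k = 0 := by
  have h : ∀ i : Fin 3, pderiv F (Sum.inl i : Fin 3 ⊕ Fin q) k = 0 := hk
  simp [eulerE_apply, h]

theorem par_mem_paramFns (j : Fin q) : par F q j ∈ paramFns F q := fun i => pderiv_par i j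

@[simp] theorem eulerE_par (j : Fin q) : eulerE F q (par F q j) = 0 :=
  eulerE_of_mem_paramFns (par_mem_paramFns j)

theorem two_mul_C_half [CharZero F] : (2 : Fn F q) * C (1 / 2 : F) = 1 := by
  have : (2 : Fn F q) = C (2 : F) := (map_ofNat C 2).symm
  rw [this, ← map_mul]
  norm_num

@[simp] theorem eulerE_rad [CharZero F] : eulerE F q (rad F q) = rad F q := by
  simp only [rad, map_add, Derivation.leibniz_pow, eulerE_sv_one, eulerE_sv_two]
  simp only [Nat.add_one_sub_one, pow_one, smul_eq_mul, nsmul_eq_mul, Nat.cast_ofNat]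
  linear_combination (sv F q 1 ^ 2 + sv F q 2 ^ 2) * two_mul_C_half (F := F) (q := q)

theorem rot_sv_zero : rot F q (sv F q 0) = 0 := by simp [rot_apply, pderiv_sv]

theorem rot_sv_one : rot F q (sv F q 1) = sv F q 2 := by simp [rot_apply, pderiv_sv]

theorem rot_sv_two : rot F q (sv F q 2) = - sv F q 1 := by simp [rot_apply, pderiv_sv]

theorem rot_par (j : Fin q) : rot F q (par F q j) = 0 := by simp [rot_apply, pderiv_par]

theorem rot_rad : rot F q (rad F q) = 0 := by
  simp only [rad, map_add, Derivation.leibniz_pow, rot_sv_one, rot_sv_two]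
  simp only [Nat.add_one_sub_one, pow_one, smul_eq_mul, nsmul_eq_mul, Nat.cast_ofNat]
  ring

theorem eq_on_X {P : Fin 3 ⊕ Fin q → Prop} (h0 : P (Sum.inl 0)) (h1 : P (Sum.inl 1))
    (h2 : P (Sum.inl 2)) (h : ∀ j, P (Sum.inr j)) : ∀ i, P i := by
  rintro (i | j)
  · fin_cases i <;> assumption
  · exact h j

theorem VF_ext {D₁ D₂ : VF F q} (hs : ∀ i, D₁ (sv F q i) = D₂ (sv F q i))
    (hp : ∀ j, D₁ (par F q j) = D₂ (par F q j)) : D₁ = D₂ := by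
  ext1 k
  refine derivation_along_ext (AlgHom.id F _) (fun i => by simp) D₁.toLinearMap D₂.toLinearMap
    (fun a b => ?_) (fun a b => ?_) ?_ k
  · exact D₁.leibniz a b
  · exact D₂.leibniz a b
  · rintro (i | j)
    · exact hs i
    · exact hp j

/-- `E` acts on `y` and `z` by the same scalar, so it commutes with rotations of that plane; the
commutator is a derivation and is tested on the variables. -/
theorem eulerE_rot (k : Fn F q) : eulerE F q (rot F q k) = rot F q (eulerE F q k) := by
  have h : ⁅eulerE F q, rot F q⁆ = 0 := by
    apply VF_ext
    · intro i
      fin_cases i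
      · simp [Derivation.commutator_apply, rot_sv_zero]
      · simp [Derivation.commutator_apply, Derivation.leibniz, rot_apply, pderiv_sv]
      · simp [Derivation.commutator_apply, Derivation.leibniz, rot_apply, pderiv_sv]
    · intro j
      simp [Derivation.commutator_apply, rot_par]
  have h2 := congrArg (fun D : VF F q => D k) h
  simpa [Derivation.commutator_apply, sub_eq_zero] using h2

/-! ### Functions of `x`, `R` and the parameters -/

@[simp] theorem emb_X_x : emb F q (X (Sum.inl 0)) = sv F q 0 := substAlgHom_X _ _

@[simp] theorem emb_X_R : emb F q (X (Sum.inl 1)) = rad F q := substAlgHom_X _ _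

@[simp] theorem emb_X_par (j : Fin q) : emb F q (X (Sum.inr j)) = par F q j := substAlgHom_X _ _

theorem constantCoeff_emb_X (i : Fin 2 ⊕ Fin q) : constantCoeff (emb F q (X i)) = 0 := by
  rcases i with i | j
  · fin_cases i
    · simpa using constantCoeff_sv 0
    · simpa using constantCoeff_rad
  · simpa using constantCoeff_par j

theorem constantCoeff_emb (a : Coef F q) : constantCoeff (emb F q a) = constantCoeff a :=
  constantCoeff_algHom _ constantCoeff_emb_X a

theorem emb_mem (a : Coef F q) : emb F q a ∈ eulerFns F q := ⟨a, rfl⟩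

theorem sv_zero_mem : sv F q 0 ∈ eulerFns F q := emb_X_x (F := F) (q := q) ▸ emb_mem _

theorem rad_mem : rad F q ∈ eulerFns F q := emb_X_R (F := F) (q := q) ▸ emb_mem _

theorem par_mem (j : Fin q) : par F q j ∈ eulerFns F q := emb_X_par (F := F) j ▸ emb_mem _

theorem C_mem (c : F) : (C c : Fn F q) ∈ eulerFns F q := (eulerFns F q).algebraMap_mem c

/-- The chain rule for functions of `x`, `R` and the parameters. -/
theorem derivation_emb (D : VF F q) (a : Coef F q) :
    D (emb F q a) = ∑ i, D (emb F q (X i)) * emb F q (pderiv F i a) := by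
  classical
  refine derivation_along_ext (emb F q) constantCoeff_emb_X (D.toLinearMap ∘ₗ (emb F q).toLinearMap)
    (∑ i, (LinearMap.mulLeft F (D (emb F q (X i)))) ∘ₗ (emb F q).toLinearMap ∘ₗ
      (pderiv F i).toLinearMap) (fun a b => ?_) (fun a b => ?_) (fun i => ?_) a |>.trans ?_
  · simp
  · simp only [LinearMap.sum_apply, LinearMap.comp_apply, Derivation.coeFn_coe,
      AlgHom.toLinearMap_apply, LinearMap.mulLeft_apply, Derivation.leibniz, map_add, smul_eq_mul,
      map_mul, Finset.mul_sum, ← Finset.sum_add_distrib]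
    refine Finset.sum_congr rfl fun i _ => by ring
  · simp only [LinearMap.sum_apply, LinearMap.comp_apply, Derivation.coeFn_coe,
      AlgHom.toLinearMap_apply, LinearMap.mulLeft_apply]
    rw [Finset.sum_eq_single i]
    · simp
    · intro j _ hj
      rw [pderiv_X_of_ne hj.symm]; simp
    · simp
  · simp

theorem rot_emb (a : Coef F q) : rot F q (emb F q a) = 0 := by
  rw [derivation_emb]
  refine Finset.sum_eq_zero fun i _ => ?_
  suffices h : rot F q (emb F q (X i)) = 0 by rw [h, zero_mul]
  rcases i with i | j
  · fin_cases i
    · simpa using rot_sv_zero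
    · simpa using rot_rad
  · simpa using rot_par j

theorem eulerE_mem [CharZero F] {k : Fn F q} (hk : k ∈ eulerFns F q) :
    eulerE F q k ∈ eulerFns F q := by
  obtain ⟨a, rfl⟩ := hk
  change eulerE F q (emb F q a) ∈ _
  rw [derivation_emb]
  refine sum_mem fun i _ => mul_mem ?_ (emb_mem _)
  rcases i with i | j
  · fin_cases i
    · simpa using sv_zero_mem
    · simpa using rad_mem
  · simp

theorem exists_inv_of_mem_eulerFns {k : Fn F q} (hk : k ∈ eulerFns F q)
    (h : constantCoeff k ≠ 0) : ∃ u ∈ eulerFns F q, k * u = 1 := by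
  obtain ⟨a, rfl⟩ := hk
  change constantCoeff (emb F q a) ≠ 0 at h
  rw [constantCoeff_emb] at h
  refine ⟨emb F q a⁻¹, emb_mem _, ?_⟩
  change emb F q a * _ = 1
  rw [← map_mul, MvPowerSeries.mul_inv_cancel _ h, map_one]

theorem coeff_sv_mul_pderiv (i : Fin 3) (k : Fn F q) (d : Fin 3 ⊕ Fin q →₀ ℕ) :
    coeff d (sv F q i * pderiv F (Sum.inl i) k) = d (Sum.inl i) * coeff d k := by
  rw [sv, X, coeff_monomial_mul, one_mul]
  split_ifs with h
  · rw [coeff_pderiv, tsub_add_cancel_of_le h]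
    have h1 : 1 ≤ d (Sum.inl i) := Finsupp.single_le_iff.mp h
    have h2 : (d - Finsupp.single (Sum.inl i) 1 : _ →₀ ℕ) (Sum.inl i) + 1 = d (Sum.inl i) := by
      simp [h1]
    rw [← h2]; push_cast; ring
  · have : d (Sum.inl i) = 0 := by
      by_contra h0
      exact h (Finsupp.single_le_iff.mpr (Nat.one_le_iff_ne_zero.mpr h0))
    simp [this]

theorem coeff_eulerE (k : Fn F q) (d : Fin 3 ⊕ Fin q →₀ ℕ) :
    coeff d (eulerE F q k) =
      (d (Sum.inl 0) + 1 / 2 * d (Sum.inl 1) + 1 / 2 * d (Sum.inl 2)) * coeff d k := by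
  rw [eulerE_apply, mul_assoc, mul_assoc]
  simp only [map_add, coeff_C_mul, coeff_sv_mul_pderiv]
  ring

theorem eulerE_mem_ordIdeal {w : Fin 3 ⊕ Fin q → ℕ} {n : ℕ} {k : Fn F q}
    (hk : k ∈ ordIdeal w n) : eulerE F q k ∈ ordIdeal w n := fun d hd => by
  rw [coeff_eulerE, hk d hd, mul_zero]

end Basics

/-! ### How permissible transformations and the rotating change act on multiples of `E` -/

section Transformations

variable {F : Type*} [Field F] {q : ℕ}

theorem exists_state_change (τ : Fn F q) (hτ : constantCoeff τ = 1) :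
    ∃ Φ : Fn F q ≃ₐ[F] Fn F q, (∀ j, Φ (par F q j) = par F q j) ∧ Φ (sv F q 0) = sv F q 0 * τ ^ 2 ∧
      Φ (sv F q 1) = sv F q 1 * τ ∧ Φ (sv F q 2) = sv F q 2 * τ := by
  let b : Fin 3 ⊕ Fin q → Fn F q :=
    Sum.elim ![sv F q 0 * τ ^ 2, sv F q 1 * τ, sv F q 2 * τ] (par F q)
  have hb : HasSubst b := by
    apply hasSubst_of_constantCoeff_zero
    refine eq_on_X ?_ ?_ ?_ ?_ <;> simp [b, constantCoeff_sv, constantCoeff_par]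
  have hX : ∀ i, substAlgHom hb (X i : Fn F q) = b i := fun i => substAlgHom_X hb i
  have hτ1 : τ - 1 ∈ ordIdeal (fun _ => 1) 1 := by
    rw [mem_ordIdeal_one_iff]; simp [hτ]
  have hs : ∀ i, sv F q i ∈ ordIdeal (fun _ => 1) 1 := fun i => X_mem_ordIdeal _ _
  have key : ∀ i, substAlgHom hb (X i : Fn F q) - X i ∈ ordIdeal (fun _ => 1) 2 := by
    intro i
    rw [hX]
    revert i
    refine eq_on_X ?_ ?_ ?_ ?_
    · have h := Ideal.mul_mem_right (τ + 1) _ (mul_mem_ordIdeal (hs 0) hτ1)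
      have e : b (Sum.inl 0) - X (Sum.inl 0) = sv F q 0 * (τ - 1) * (τ + 1) := by
        simp [b]; rw [sv]; ring
      rw [e]; exact h
    · have e : b (Sum.inl 1) - X (Sum.inl 1) = sv F q 1 * (τ - 1) := by
        simp [b]; rw [sv]; ring
      rw [e]; exact mul_mem_ordIdeal (hs 1) hτ1
    · have e : b (Sum.inl 2) - X (Sum.inl 2) = sv F q 2 * (τ - 1) := by
        simp [b]; rw [sv]; ring
      rw [e]; exact mul_mem_ordIdeal (hs 2) hτ1
    · intro j
      simp [b, par]
  exact ⟨AlgEquiv.ofBijective _ (bijective_of_near_identity _ key), fun j => hX (Sum.inr j),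
    hX (Sum.inl 0), hX (Sum.inl 1), hX (Sum.inl 2)⟩

/-- How a state change transforms the Euler field. -/
theorem eulerE_state_change [CharZero F] {Φ : Fn F q →ₐ[F] Fn F q} {τ : Fn F q}
    (hp : ∀ j, Φ (par F q j) = par F q j) (h0 : Φ (sv F q 0) = sv F q 0 * τ ^ 2)
    (h1 : Φ (sv F q 1) = sv F q 1 * τ) (h2 : Φ (sv F q 2) = sv F q 2 * τ) (k : Fn F q) :
    τ * eulerE F q (Φ k) = (τ + 2 * eulerE F q τ) * Φ (eulerE F q k) := by
  have hC : ∀ c : F, Φ (C c) = C c := fun c => Φ.commutes c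
  have hh := two_mul_C_half (F := F) (q := q)
  refine derivation_along_ext Φ ?_
    (LinearMap.mulLeft F τ ∘ₗ (eulerE F q).toLinearMap ∘ₗ Φ.toLinearMap)
    (LinearMap.mulLeft F (τ + 2 * eulerE F q τ) ∘ₗ Φ.toLinearMap ∘ₗ (eulerE F q).toLinearMap)
    (fun a b => ?_) (fun a b => ?_) ?_ k
  · refine eq_on_X ?_ ?_ ?_ fun j => ?_
    · exact (congrArg constantCoeff h0).trans (by simp [constantCoeff_sv])
    · exact (congrArg constantCoeff h1).trans (by simp [constantCoeff_sv])
    · exact (congrArg constantCoeff h2).trans (by simp [constantCoeff_sv])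
    · exact (congrArg constantCoeff (hp j)).trans (constantCoeff_par j)
  · simp; ring
  · simp; ring
  · refine eq_on_X ?_ ?_ ?_ fun j => ?_
    · change τ * eulerE F q (Φ (sv F q 0)) = (τ + 2 * eulerE F q τ) * Φ (eulerE F q (sv F q 0))
      rw [eulerE_sv_zero, h0]
      simp [Derivation.leibniz_pow]; ring
    · change τ * eulerE F q (Φ (sv F q 1)) = (τ + 2 * eulerE F q τ) * Φ (eulerE F q (sv F q 1))
      rw [eulerE_sv_one, map_mul, h1, hC]
      simp only [Derivation.leibniz, eulerE_sv_one, smul_eq_mul]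
      linear_combination -τ * sv F q 1 * eulerE F q τ * hh
    · change τ * eulerE F q (Φ (sv F q 2)) = (τ + 2 * eulerE F q τ) * Φ (eulerE F q (sv F q 2))
      rw [eulerE_sv_two, map_mul, h2, hC]
      simp only [Derivation.leibniz, eulerE_sv_two, smul_eq_mul]
      linear_combination -τ * sv F q 2 * eulerE F q τ * hh
    · change τ * eulerE F q (Φ (par F q j)) = (τ + 2 * eulerE F q τ) * Φ (eulerE F q (par F q j))
      rw [hp]; simp

/-- Both sides are derivations along the parameter change; on the state variables nothing moves, and
`E` kills all functions of the parameters. -/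
theorem eulerE_param_change {Ψ : Fn F q ≃ₐ[F] Fn F q} (h : IsParamChange Ψ) (k : Fn F q) :
    eulerE F q (Ψ k) = Ψ (eulerE F q k) := by
  have hC : ∀ c : F, Ψ (C c) = C c := fun c => Ψ.commutes c
  refine derivation_along_ext Ψ.toAlgHom (fun i => constantCoeff_algEquiv_X Ψ i)
    ((eulerE F q).toLinearMap ∘ₗ Ψ.toAlgHom.toLinearMap)
    (Ψ.toAlgHom.toLinearMap ∘ₗ (eulerE F q).toLinearMap) (fun a b => ?_) (fun a b => ?_) ?_ k
  · simp
  · simp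
  · refine eq_on_X ?_ ?_ ?_ fun j => ?_
    · change eulerE F q (Ψ (sv F q 0)) = Ψ (eulerE F q (sv F q 0))
      simp [h.1]
    · change eulerE F q (Ψ (sv F q 1)) = Ψ (eulerE F q (sv F q 1))
      rw [eulerE_sv_one, map_mul, h.1, hC]; simp
    · change eulerE F q (Ψ (sv F q 2)) = Ψ (eulerE F q (sv F q 2))
      rw [eulerE_sv_two, map_mul, h.1, hC]; simp
    · change eulerE F q (Ψ (par F q j)) = Ψ (eulerE F q (par F q j))
      rw [eulerE_par, map_zero, eulerE_of_mem_paramFns (h.2 j)]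

theorem Sends.mul {a b : Trans F q} {U V W : VF F q} (hb : Sends b U V) (ha : Sends a V W) :
    Sends (a * b) U W := fun k => by
  have h1 := ha (b.right k)
  rw [hb k] at h1
  simp only [SemidirectProduct.mul_right, SemidirectProduct.mul_left, AlgEquiv.mul_apply,
    Units.val_mul, h1, map_mul, MulDistribMulAction.toMulAut_apply]
  rw [mul_assoc]
  rfl

theorem Sends.inv {a : Trans F q} {U V : VF F q} (ha : Sends a U V) : Sends a⁻¹ V U := fun k => by
  have h1 := ha (a.right⁻¹ k)
  have h2 : a.right (a.right⁻¹ k) = k := a.right.apply_symm_apply k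
  rw [h2] at h1
  have h3 : U (a.right⁻¹ k) = a.right⁻¹ (a.right (U (a.right⁻¹ k))) :=
    (a.right.symm_apply_apply _).symm
  have h4 : a.right (U (a.right⁻¹ k)) = ((a.left⁻¹ : (Fn F q)ˣ) : Fn F q) * V k := by
    rw [h1, ← mul_assoc, Units.inv_mul, one_mul]
  rw [SemidirectProduct.inv_right, h3, h4, map_mul]
  rfl

theorem sends_inl (u : (Fn F q)ˣ) (f : Fn F q) :
    Sends (SemidirectProduct.inl u) (f • eulerE F q) (((u : Fn F q) * f) • eulerE F q) := fun k => by
  simp [mul_assoc]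

theorem sends_param {Ψ : Fn F q ≃ₐ[F] Fn F q} (h : IsParamChange Ψ) (f : Fn F q) :
    Sends (SemidirectProduct.inr Ψ) (f • eulerE F q) (Ψ f • eulerE F q) := fun k => by
  simp [eulerE_param_change h]

/-- Evaluation at the single function `x` is already decisive, since `E ∘ Φ` and `Φ ∘ E` are
proportional by `eulerE_state_change`. This replaces an identity of vector fields by one scalar
equation. -/
theorem sends_state_iff [CharZero F] {Φ : Fn F q ≃ₐ[F] Fn F q} {τ : Fn F q}
    (hτ : constantCoeff τ = 1)
    (hp : ∀ j, Φ (par F q j) = par F q j) (h0 : Φ (sv F q 0) = sv F q 0 * τ ^ 2)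
    (h1 : Φ (sv F q 1) = sv F q 1 * τ) (h2 : Φ (sv F q 2) = sv F q 2 * τ) (f f' : Fn F q) :
    Sends (SemidirectProduct.inr Φ) (f • eulerE F q) (f' • eulerE F q) ↔
      f' * (τ + 2 * eulerE F q τ) = Φ f * τ := by
  have hτ0 : τ ≠ 0 := by rintro rfl; simp at hτ
  have key := eulerE_state_change (Φ := Φ.toAlgHom) hp h0 h1 h2
  have key : ∀ k, τ * eulerE F q (Φ k) = (τ + 2 * eulerE F q τ) * Φ (eulerE F q k) := key
  constructor
  · intro h
    have h3 := h (sv F q 0)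
    simp only [SemidirectProduct.right_inr, SemidirectProduct.left_inr, Units.val_one, one_mul,
      Derivation.smul_apply, smul_eq_mul, map_mul, eulerE_sv_zero, h0] at h3
    have h4 := key (sv F q 0)
    rw [eulerE_sv_zero, h0] at h4
    refine mul_left_cancel₀ (mul_ne_zero (sv_ne_zero 0) (pow_ne_zero 2 hτ0)) ?_
    linear_combination τ * h3 - f' * h4
  · intro h k
    simp only [SemidirectProduct.right_inr, SemidirectProduct.left_inr, Units.val_one, one_mul,
      Derivation.smul_apply, smul_eq_mul, map_mul]
    refine mul_left_cancel₀ hτ0 ?_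
    linear_combination f' * key k + Φ (eulerE F q k) * h

theorem rot_iterate_eulerE (f : Coef F q) (n : ℕ) (k : Fn F q) :
    (rot F q)^[n] (emb F q f * eulerE F q k) = emb F q f * eulerE F q ((rot F q)^[n] k) := by
  induction n generalizing k with
  | zero => rfl
  | succ n ih =>
    rw [Function.iterate_succ_apply, Function.iterate_succ_apply, ← ih, Derivation.leibniz,
      rot_emb, smul_zero, add_zero, eulerE_rot, smul_eq_mul]

theorem rot_iterate_add (n : ℕ) (k l : Fn F q) :
    (rot F q)^[n] (k + l) = (rot F q)^[n] k + (rot F q)^[n] l := by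
  induction n generalizing k l with
  | zero => rfl
  | succ n ih => simp only [Function.iterate_succ_apply, map_add, ih]

/-- The rotating change of variables removes `Θ` from `Θ + f E`. -/
theorem corotating_add [CharZero F] (f : Coef F q) :
    Corotating (rot F q + emb F q f • eulerE F q) (emb F q f • eulerE F q) := fun k => by
  refine PowerSeries.ext fun n => ?_
  -- The factor `n + 1` from differentiation in `t` turns `Θ^(n+1)/(n+1)!` into `Θ^(n+1)/n!`, the
  -- contribution of `Θ` on the right-hand side.
  have h : (n.factorial : F)⁻¹ = ((n + 1).factorial : F)⁻¹ * (n + 1) := by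
    rw [Nat.factorial_succ]
    have h1 : (n.factorial : F) ≠ 0 := Nat.cast_ne_zero.mpr n.factorial_ne_zero
    have h2 : (n + 1 : F) ≠ 0 := by exact_mod_cast n.succ_ne_zero
    push_cast
    field_simp
  rw [map_add, PowerSeries.coeff_derivative]
  simp only [rotFlow, PowerSeries.coeff_mk, Derivation.add_apply, Derivation.smul_apply,
    smul_eq_mul, rot_iterate_add, rot_iterate_eulerE, Derivation.map_smul, smul_add,
    ← Function.iterate_succ_apply]
  congr 1
  have e : ((n : Fn F q) + 1) = C ((n : F) + 1) := by simp
  rw [e, mul_comm, ← smul_eq_C_mul, smul_smul, h, mul_comm]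

end Transformations

/-! ### Polar coordinates -/

section Polar

variable {F : Type*} [Field F] {q : ℕ}

/-- The chain rule for a univariate series at a series without constant term. -/
theorem derivation_subst {a : Fn F q} (ha : PowerSeries.HasSubst a) (ha0 : constantCoeff a = 0)
    (D : VF F q) (p : PowerSeries F) :
    D (PowerSeries.substAlgHom ha p) =
      D a * PowerSeries.substAlgHom ha (PowerSeries.derivative F p) := by
  let S : MvPowerSeries Unit F →ₐ[F] Fn F q := PowerSeries.substAlgHom ha
  have hS : S (X ()) = a := PowerSeries.substAlgHom_X ha
  refine derivation_along_ext S (fun i => ?_) (D.toLinearMap ∘ₗ S.toLinearMap)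
    (LinearMap.mulLeft F (D a) ∘ₗ S.toLinearMap ∘ₗ (PowerSeries.derivative F).toLinearMap)
    (fun b c => ?_) (fun b c => ?_) (fun i => ?_) p
  · cases i
    rw [hS, ha0]
  · simp
  · have : PowerSeries.derivative F (b * c) = b * PowerSeries.derivative F c
      + c * PowerSeries.derivative F b := Derivation.leibniz _ b c
    simp only [LinearMap.comp_apply, Derivation.coeFn_coe, LinearMap.mulLeft_apply,
      AlgHom.toLinearMap_apply, this, map_add, map_mul]
    ring
  · have hX : PowerSeries.derivative F (X () : MvPowerSeries Unit F) = 1 := pderiv_X_self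
    simp only [LinearMap.comp_apply, Derivation.coeFn_coe, LinearMap.mulLeft_apply,
      AlgHom.toLinearMap_apply, hX, map_one, mul_one]
    cases i
    rw [hS]

theorem algebraMap_div_factorial_mul [CharZero F] (a : ℚ) (n : ℕ) :
    algebraMap ℚ F (a / (n + 1).factorial) * (n + 1) = algebraMap ℚ F (a / n.factorial) := by
  have h : (n + 1 : F) = algebraMap ℚ F (n + 1) := by simp
  rw [h, ← map_mul]
  congr 1
  rw [Nat.factorial_succ]
  push_cast
  field_simp

variable (F) in
theorem derivative_sin [CharZero F] :
    PowerSeries.derivative F (PowerSeries.sin F) = PowerSeries.cos F := by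
  ext n
  rw [PowerSeries.coeff_derivative, PowerSeries.sin, PowerSeries.cos, PowerSeries.coeff_mk,
    PowerSeries.coeff_mk]
  by_cases hn : Even n
  · have : (n + 1) / 2 = n / 2 := by
      obtain ⟨m, rfl⟩ := hn
      omega
    rw [if_neg (by simpa [Nat.even_add_one] using hn), if_pos hn, this,
      algebraMap_div_factorial_mul]
  · rw [if_pos (Nat.even_add_one.mpr hn), if_neg hn, zero_mul]

variable (F) in
theorem derivative_cos [CharZero F] :
    PowerSeries.derivative F (PowerSeries.cos F) = - PowerSeries.sin F := by
  ext n
  rw [PowerSeries.coeff_derivative, map_neg, PowerSeries.sin, PowerSeries.cos, PowerSeries.coeff_mk,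
    PowerSeries.coeff_mk]
  by_cases hn : Even n
  · rw [if_neg (by simpa [Nat.even_add_one] using hn), if_pos hn]; simp
  · have : (n + 1) / 2 = n / 2 + 1 := by
      rw [Nat.not_even_iff_odd] at hn
      obtain ⟨m, rfl⟩ := hn
      omega
    rw [if_pos (Nat.even_add_one.mpr hn), if_neg hn, this, algebraMap_div_factorial_mul, pow_succ,
      mul_neg_one, neg_div, map_neg]

variable (F) in
theorem sin_sq_add_cos_sq [CharZero F] : PowerSeries.sin F ^ 2 + PowerSeries.cos F ^ 2 = 1 := by
  apply PowerSeries.derivative.ext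
  · simp only [map_add, Derivation.leibniz_pow, derivative_sin, derivative_cos]
    simp
    ring
  · rw [map_add, map_pow, map_pow, ← PowerSeries.coeff_zero_eq_constantCoeff_apply,
      ← PowerSeries.coeff_zero_eq_constantCoeff_apply]
    simp [PowerSeries.sin, PowerSeries.cos]

theorem nf_map {r : ℕ} (hq : r + 1 ≤ q) (β₁ βr : F) (Φ : Fn F q →ₐ[F] Fn F q)
    (hp : ∀ j, Φ (par F q j) = par F q j) (x R : Fn F q) :
    Φ (nf hq β₁ βr x R) = nf hq β₁ βr (Φ x) (Φ R) := by
  have hC : ∀ c : F, Φ (C c) = C c := fun c => Φ.commutes c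
  simp [nf, hp, hC]

theorem isPolarForm_nf [CharZero F] {r : ℕ} (hq : r + 1 ≤ q) (β₁ βr : F) :
    IsPolarForm (rot F q + nf hq β₁ βr (sv F q 0) (rad F q) • eulerE F q)
      (polarField (sv F q 0 * nf hq β₁ βr (sv F q 0) (sv F q 1 ^ 2))
        (C (1 / 2 : F) * sv F q 1 * nf hq β₁ βr (sv F q 0) (sv F q 1 ^ 2)) 1) := by
  have h0 : constantCoeff (sv F q 2) = 0 := constantCoeff_sv 2
  have hs : PowerSeries.HasSubst (sv F q 2) := PowerSeries.HasSubst.of_constantCoeff_zero h0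
  set s := PowerSeries.substAlgHom hs (PowerSeries.sin F) with hsdef
  set c := PowerSeries.substAlgHom hs (PowerSeries.cos F) with hcdef
  have hsc : s ^ 2 + c ^ 2 = 1 := by
    rw [hsdef, hcdef, ← map_pow, ← map_pow, ← map_add, sin_sq_add_cos_sq, map_one]
  have hds : ∀ D : VF F q, D s = D (sv F q 2) * c := fun D => by
    rw [hsdef, derivation_subst hs h0, derivative_sin]
  have hdc : ∀ D : VF F q, D c = -(D (sv F q 2) * s) := fun D => by
    rw [hcdef, derivation_subst hs h0, derivative_cos, map_neg, mul_neg]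
  have hb : HasSubst (Sum.elim ![sv F q 0, sv F q 1 * s, sv F q 1 * c] (par F q)) := by
    apply hasSubst_of_constantCoeff_zero
    refine eq_on_X ?_ ?_ ?_ ?_ <;> simp [constantCoeff_sv, constantCoeff_par]
  have hP : ∀ k, polarMap F q k = substAlgHom hb k := fun k => by
    rw [coe_substAlgHom hb, polarMap, ← PowerSeries.coe_substAlgHom hs]
  set P : Fn F q →ₐ[F] Fn F q := substAlgHom hb with hPdef
  have p0 : P (sv F q 0) = sv F q 0 := substAlgHom_X hb _
  have p1 : P (sv F q 1) = sv F q 1 * s := substAlgHom_X hb _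
  have p2 : P (sv F q 2) = sv F q 1 * c := substAlgHom_X hb _
  have pp : ∀ j, P (par F q j) = par F q j := fun j => substAlgHom_X hb _
  have hC : ∀ c : F, P (C c) = C c := fun c => P.commutes c
  -- Since `R` becomes `ρ²`, the angle disappears from the coefficient `g`.
  have pR : P (rad F q) = sv F q 1 ^ 2 := by
    rw [rad, map_add, map_pow, map_pow, p1, p2]
    linear_combination sv F q 1 ^ 2 * hsc
  have pg : P (nf hq β₁ βr (sv F q 0) (rad F q)) = nf hq β₁ βr (sv F q 0) (sv F q 1 ^ 2) := by
    rw [nf_map hq β₁ βr P pp, p0, pR]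
  intro i
  rw [hP, hP]
  fin_cases i
  · change polarField _ _ _ (P (sv F q 0)) = P (rot F q (sv F q 0) + _ * eulerE F q (sv F q 0))
    rw [rot_sv_zero, zero_add, eulerE_sv_zero, map_mul, pg, p0]
    simp [polarField, pderiv_sv]; ring
  · change polarField _ _ _ (P (sv F q 1)) = P (rot F q (sv F q 1) + _ * eulerE F q (sv F q 1))
    rw [rot_sv_one, eulerE_sv_one, map_add, map_mul, map_mul, hC, pg, p1, p2]
    simp [polarField, pderiv_sv, hds]; ring
  · change polarField _ _ _ (P (sv F q 2)) = P (rot F q (sv F q 2) + _ * eulerE F q (sv F q 2))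
    rw [rot_sv_two, eulerE_sv_two, map_add, map_neg, map_mul, map_mul, hC, pg, p1, p2]
    simp [polarField, pderiv_sv, hdc]; ring

end Polar

/-! ### Graded parts of the normal form and the images of the level maps -/

section Levels

variable {F : Type*} [Field F] {q : ℕ}

theorem mem_homog {α : Fin q → ℕ} {n : ℕ} {k : Fn F q} :
    k ∈ homog F α n ↔ ∀ d, Finsupp.weight (wt α) d ≠ n → coeff d k = 0 := by
  change (∀ {d}, coeff d k ≠ 0 → Finsupp.weight (wt α) d = n) ↔ _
  exact ⟨fun h d hd => by_contra fun h' => hd (h h'), fun h d hd => by_contra fun h' => hd (h d h')⟩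

section Homog

theorem mul_mem_homog {α : Fin q → ℕ} {m n : ℕ} {a b : Fn F q} (ha : a ∈ homog F α m)
    (hb : b ∈ homog F α n) : a * b ∈ homog F α (m + n) :=
  IsWeightedHomogeneous.mul ha hb

attribute [local irreducible] homog

theorem one_mem_homog (α : Fin q → ℕ) : (1 : Fn F q) ∈ homog F α 0 := by
  classical
  rw [mem_homog]
  intro d hd
  rw [coeff_one, if_neg]
  rintro rfl
  exact hd (map_zero _)

theorem pow_mem_homog {α : Fin q → ℕ} {m : ℕ} {a : Fn F q} (ha : a ∈ homog F α m) (n : ℕ) :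
    a ^ n ∈ homog F α (n * m) := by
  induction n with
  | zero => simpa using one_mem_homog α
  | succ n ih => rw [pow_succ, Nat.succ_mul]; exact mul_mem_homog ih ha

theorem C_mul_mem_homog {α : Fin q → ℕ} {m : ℕ} {a : Fn F q} (ha : a ∈ homog F α m) (c : F) :
    C c * a ∈ homog F α m := by
  rw [← smul_eq_C_mul]
  exact Submodule.smul_mem _ c ha

theorem X_mem_homog (α : Fin q → ℕ) (i : Fin 3 ⊕ Fin q) : (X i : Fn F q) ∈ homog F α (wt α i) := by
  classical
  rw [mem_homog]
  intro d hd
  rw [coeff_X, if_neg]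
  rintro rfl
  exact hd (by simp [Finsupp.weight_single])

theorem sv_mem_homog (α : Fin q → ℕ) (i : Fin 3) : sv F q i ∈ homog F α 1 :=
  X_mem_homog α (Sum.inl i)

theorem par_mem_homog (α : Fin q → ℕ) (j : Fin q) : par F q j ∈ homog F α (α j) :=
  X_mem_homog α (Sum.inr j)

theorem rad_mem_homog (α : Fin q → ℕ) : rad F q ∈ homog F α 2 :=
  add_mem (pow_mem_homog (sv_mem_homog α 1) 2) (pow_mem_homog (sv_mem_homog α 2) 2)

theorem eulerE_mem_homog {α : Fin q → ℕ} {n : ℕ} {k : Fn F q} (hk : k ∈ homog F α n) :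
    eulerE F q k ∈ homog F α n := by
  rw [mem_homog] at hk ⊢
  intro d hd
  rw [coeff_eulerE, hk d hd, mul_zero]

theorem comp_of_mem_homog {α : Fin q → ℕ} {m : ℕ} {k : Fn F q} (hk : k ∈ homog F α m) (n : ℕ) :
    comp α k n = if n = m then k else 0 := by
  classical
  rw [mem_homog] at hk
  ext d
  rw [comp, coeff_weightedHomogeneousComponent]
  by_cases h1 : Finsupp.weight (wt α) d = m
  · split_ifs <;> simp_all
  · rw [apply_ite (coeff d), hk d h1]; simp

theorem constantCoeff_of_mem_homog {α : Fin q → ℕ} {n : ℕ} {k : Fn F q} (hk : k ∈ homog F α n)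
    (hn : n ≠ 0) : constantCoeff k = 0 :=
  mem_homog.mp hk 0 (by simpa using hn.symm)

section Nf

variable {r : ℕ} (hq : r + 1 ≤ q) (β₁ βr : F)

variable (F) in
/-- The terms `∑ R^k μ_{k+1} + β_r R^r` of the normal form. -/
def nfTop {r : ℕ} (hq : r + 1 ≤ q) (βr : F) : Fn F q :=
  ∑ k : Fin (r + 1), rad F q ^ (k : ℕ) * par F q (Fin.castLE hq k) + C βr * rad F q ^ r

theorem nf_eq : nf hq β₁ βr (sv F q 0) (rad F q) =
    sv F q 0 + C β₁ * rad F q + nfTop F hq βr := by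
  rw [nf, nfTop]; ring

theorem nf_mem : nf hq β₁ βr (sv F q 0) (rad F q) ∈ eulerFns F q :=
  add_mem (add_mem (add_mem sv_zero_mem (mul_mem (C_mem _) rad_mem))
    (sum_mem fun _ _ => mul_mem (pow_mem rad_mem _) (par_mem _)))
    (mul_mem (C_mem _) (pow_mem rad_mem _))

theorem nfTop_mem : nfTop F hq βr ∈ eulerFns F q :=
  add_mem (sum_mem fun _ _ => mul_mem (pow_mem rad_mem _) (par_mem _))
    (mul_mem (C_mem _) (pow_mem rad_mem _))

/-- The weights `α_(k+1) = 2 (r - k)` are exactly those that give each `R^k μ_(k+1)` the grade of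
`R^r`. -/
theorem nfTop_mem_homog {α : Fin q → ℕ}
    (hα : ∀ k : Fin (r + 1), α (Fin.castLE hq k) = 2 * (r - (k : ℕ))) :
    nfTop F hq βr ∈ homog F α (2 * r) := by
  refine add_mem (sum_mem fun k _ => ?_) (C_mul_mem_homog ?_ _)
  · have := mul_mem_homog (pow_mem_homog (rad_mem_homog (F := F) α) (k : ℕ))
      (par_mem_homog α (Fin.castLE hq k))
    rwa [hα, show (k : ℕ) * 2 + 2 * (r - k) = 2 * r by omega] at this
  · simpa [mul_comm] using pow_mem_homog (rad_mem_homog (F := F) α) r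

theorem pderiv_zero_rad : pderiv F (Sum.inl 0 : Fin 3 ⊕ Fin q) (rad F q) = 0 := by
  simp [rad, Derivation.leibniz_pow, pderiv_sv]

theorem pderiv_zero_nfTop : pderiv F (Sum.inl 0 : Fin 3 ⊕ Fin q) (nfTop F hq βr) = 0 := by
  simp [nfTop, Derivation.leibniz, Derivation.leibniz_pow, pderiv_zero_rad, pderiv_par]

theorem comp_nf (hr : 2 ≤ r) {α : Fin q → ℕ}
    (hα : ∀ k : Fin (r + 1), α (Fin.castLE hq k) = 2 * (r - (k : ℕ))) (n : ℕ) :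
    comp α (nf hq β₁ βr (sv F q 0) (rad F q)) n =
      if n = 1 then sv F q 0 else if n = 2 then C β₁ * rad F q else
        if n = 2 * r then nfTop F hq βr else 0 := by
  have h1 := comp_of_mem_homog (sv_mem_homog (F := F) α 0) n
  have h2 := comp_of_mem_homog (C_mul_mem_homog (rad_mem_homog (F := F) α) β₁) n
  have h3 := comp_of_mem_homog (nfTop_mem_homog hq βr hα) n
  have h : comp α (nf hq β₁ βr (sv F q 0) (rad F q)) n =
      comp α (sv F q 0) n + comp α (C β₁ * rad F q) n + comp α (nfTop F hq βr) n := by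
    rw [nf_eq]; simp only [comp, map_add]
  rw [h, h1, h2, h3]
  split_ifs <;> first | omega | simp

/-- The expression that `act` depends on when the field is linear in `x` and `R` and independent
of the parameters. -/
def actFactor (Y : Gen F q) : Fn F q := Y.2.2 + Y.1 - eulerE F q Y.1

/-- With `E v = v` the bracket is `v (S - E S)`, so it too is a multiple of `v`; the parameter term
drops out. -/
theorem act_eq_mul_actFactor {v : Fn F q} (hE : eulerE F q v = v)
    (hv : ∀ j, pderiv F (Sum.inr j : Fin 3 ⊕ Fin q) v = 0) (Y : Gen F q) :
    act v Y = v * actFactor Y := by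
  simp only [act, LinearMap.coe_mk, AddHom.coe_mk, hv, hE, actFactor]
  simp
  ring

theorem act_comp_nf [CharZero F] (hr : 2 ≤ r) {α : Fin q → ℕ}
    (hα : ∀ k : Fin (r + 1), α (Fin.castLE hq k) = 2 * (r - (k : ℕ))) {n : ℕ} (hn : n < 2 * r)
    (Y : Gen F q) : act (comp α (nf hq β₁ βr (sv F q 0) (rad F q)) n) Y =
      comp α (nf hq β₁ βr (sv F q 0) (rad F q)) n * actFactor Y := by
  rw [comp_nf hq β₁ βr hr hα]
  apply act_eq_mul_actFactor
  · split_ifs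
    · exact eulerE_sv_zero
    · have hC : eulerE F q (C β₁) = 0 := (eulerE F q).map_algebraMap β₁
      rw [Derivation.leibniz, eulerE_rad, hC, smul_zero, add_zero, smul_eq_mul]
    · omega
    · exact map_zero _
  · intro j
    split_ifs
    · exact pderiv_inr_sv j 0
    · simp [rad, Derivation.leibniz, Derivation.leibniz_pow, pderiv_inr_sv]
    · omega
    · exact map_zero _

/-- Below grade `2r` only `x` and `β₁ R` occur, and both act by multiplication with `actFactor`. The
kernel conditions then form a triangular system with pivot `x`, a nonzero divisor, so every factor
except that of `Y_(n-1)` vanishes. -/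
theorem sv_zero_dvd_of_mem_levelImage [CharZero F] (hr : 2 ≤ r) {α : Fin q → ℕ}
    (hα : ∀ k : Fin (r + 1), α (Fin.castLE hq k) = 2 * (r - (k : ℕ))) {n : ℕ} (hn2 : 2 ≤ n)
    (hn : n ≤ 2 * r) {v : Fn F q}
    (hv : v ∈ levelImage α (nf hq β₁ βr (sv F q 0) (rad F q)) n n) :
    ∃ Y ∈ gradedGenerators F α (n - 1), v = sv F q 0 * actFactor Y := by
  obtain ⟨Y, hY, rfl⟩ := hv
  rw [min_self] at hY ⊢
  obtain ⟨hY1, hY2⟩ := hY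
  set w := comp α (nf hq β₁ βr (sv F q 0) (rad F q)) with hw
  have hw1 : w 1 = sv F q 0 := by rw [hw, comp_nf hq β₁ βr hr hα]; simp
  have hact : ∀ m s, ∑ i ∈ Finset.Ico 1 (n - m), act (w i) (Y (s + i)) =
      ∑ i ∈ Finset.Ico 1 (n - m), w i * actFactor (Y (s + i)) := by
    intro m s
    refine Finset.sum_congr rfl fun i hi => act_comp_nf hq β₁ βr hr hα ?_ _
    rw [Finset.mem_Ico] at hi
    omega
  -- Index `i` stands for `Y_(n-i)`; the induction runs from `i = n - 1` down to `i = 2`, and `i =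
  -- 1`, on which no condition is imposed, is left out.
  have hzero : ∀ m, m + 2 ≤ n → actFactor (Y (n - 1 - m)) = 0 ∨ n - 1 - m = 1 := by
    intro m
    induction m using Nat.strong_induction_on with
    | _ m ih =>
      intro hm
      by_cases h1 : n - 1 - m = 1
      · exact Or.inr h1
      left
      have h := hY2 (n - 2 - m) (by omega)
      rw [hact, Finset.sum_eq_single 1, hw1, show n - 2 - m + 1 = n - 1 - m by omega] at h
      · exact (mul_eq_zero.mp h).resolve_left (sv_ne_zero 0)
      · intro i hi hi1
        rw [Finset.mem_Ico] at hi
        have := ih (m + 1 - i) (by omega) (by omega)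
        rw [show n - 1 - (m + 1 - i) = n - 2 - m + i by omega] at this
        rcases this with h | h
        · rw [h, mul_zero]
        · omega
      · intro h
        rw [Finset.mem_Ico] at h
        omega
  refine ⟨Y 1, hY1 1 le_rfl (by omega), ?_⟩
  have h := hact 0 0
  simp only [Nat.sub_zero, zero_add] at h
  simp only [LinearMap.sum_apply, LinearMap.comp_apply, LinearMap.proj_apply]
  rw [h, Finset.sum_eq_single 1, hw1]
  · intro i hi hi1
    rw [Finset.mem_Ico] at hi
    have := hzero (n - 1 - i) (by omega)
    rw [show n - 1 - (n - 1 - i) = i by omega] at this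
    rcases this with h | h
    · rw [h, mul_zero]
    · omega
  · intro h
    rw [Finset.mem_Ico] at h
    omega

end Nf

/-- A function of `x`, `R` and the parameters splits into a multiple of `x` and a part free
of `x`. -/
theorem exists_eq_sv_zero_mul_add {s : Fn F q} (hs : s ∈ eulerFns F q) :
    ∃ h ∈ eulerFns F q, ∃ ρ ∈ eulerFns F q, s = sv F q 0 * h + ρ ∧
      pderiv F (Sum.inl 0 : Fin 3 ⊕ Fin q) ρ = 0 := by
  obtain ⟨a, rfl⟩ := hs
  let b : Coef F q := fun e => coeff (e + Finsupp.single (Sum.inl 0) 1) a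
  have hb : ∀ e, coeff e b = coeff (e + Finsupp.single (Sum.inl 0) 1) a := fun e => rfl
  refine ⟨emb F q b, emb_mem _, emb F q (a - X (Sum.inl 0) * b), emb_mem _, ?_, ?_⟩
  · change emb F q a = _
    rw [map_sub, map_mul, emb_X_x]; ring
  · have h0 : pderiv F (Sum.inl 0) (a - X (Sum.inl 0) * b) = 0 := by
      ext d
      rw [coeff_pderiv, map_sub, X, add_comm, coeff_add_monomial_mul, hb, one_mul, add_comm,
        sub_self, zero_mul, map_zero]
    rw [derivation_emb]
    refine Finset.sum_eq_zero fun i _ => ?_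
    rcases i with i | j
    · fin_cases i
      · change _ * emb F q (pderiv F (Sum.inl 0) _) = 0
        rw [h0, map_zero, mul_zero]
      · change pderiv F _ (emb F q (X (Sum.inl 1))) * _ = 0
        rw [emb_X_R, pderiv_zero_rad, zero_mul]
    · rw [emb_X_par, pderiv_par, zero_mul]

theorem coeff_eq_zero_of_pderiv_eq_zero [CharZero F] {σ : Type*} {i : σ} {ρ : MvPowerSeries σ F}
    (h : pderiv F i ρ = 0) {d : σ →₀ ℕ} (hd : d i ≠ 0) : coeff d ρ = 0 := by
  have h1 : Finsupp.single i 1 ≤ d := Finsupp.single_le_iff.mpr (Nat.one_le_iff_ne_zero.mpr hd)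
  have h2 := congrArg (coeff (d - Finsupp.single i 1)) h
  rw [coeff_pderiv, tsub_add_cancel_of_le h1, map_zero] at h2
  exact (mul_eq_zero.mp h2).resolve_right (Nat.cast_add_one_ne_zero _)

theorem coeff_sv_mul_of_eq_zero (i : Fin 3) (h : Fn F q) {d : Fin 3 ⊕ Fin q →₀ ℕ}
    (hd : d (Sum.inl i) = 0) : coeff d (sv F q i * h) = 0 := by
  rw [sv, X, coeff_monomial_mul, if_neg]
  intro hle
  have := Finsupp.single_le_iff.mp hle
  omega

theorem coeff_add_sv_mul (i : Fin 3) (h : Fn F q) (d : Fin 3 ⊕ Fin q →₀ ℕ) :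
    coeff (Finsupp.single (Sum.inl i) 1 + d) (sv F q i * h) = coeff d h := by
  rw [sv, X, coeff_add_monomial_mul, one_mul]

/-- The summands `x h` and `ρ` share no monomial, so each is homogeneous by itself. -/
theorem homog_of_eq_sv_zero_mul_add [CharZero F] {α : Fin q → ℕ} {n : ℕ} {s h ρ : Fn F q}
    (hs : s ∈ homog F α (n + 1)) (e : s = sv F q 0 * h + ρ)
    (hρ : pderiv F (Sum.inl 0 : Fin 3 ⊕ Fin q) ρ = 0) :
    h ∈ homog F α n ∧ ρ ∈ homog F α (n + 1) := by
  have h2 : ρ ∈ homog F α (n + 1) := by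
    rw [mem_homog] at hs ⊢
    intro d hd
    by_cases h0 : d (Sum.inl 0) = 0
    · have := hs d hd
      rwa [e, map_add, coeff_sv_mul_of_eq_zero 0 h h0, zero_add] at this
    · exact coeff_eq_zero_of_pderiv_eq_zero hρ h0
  refine ⟨?_, h2⟩
  have h3 : sv F q 0 * h ∈ homog F α (n + 1) := by
    rw [show sv F q 0 * h = s - ρ by rw [e]; ring]
    exact sub_mem hs h2
  rw [mem_homog] at h3 ⊢
  intro d hd
  rw [← coeff_add_sv_mul 0]
  apply h3
  rw [map_add, Finsupp.weight_single]
  intro hw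
  simp only [wt, Sum.elim_inl, smul_eq_mul, mul_one] at hw
  exact hd (by rw [wt]; omega)

theorem mem_stateSpace {α : Fin q → ℕ} {n : ℕ} (hn : n ≠ 0) {v : Fn F q}
    (h1 : v ∈ eulerFns F q) (h2 : v ∈ homog F α n) : v ∈ stateSpace F α n :=
  ⟨⟨h1, h2⟩, constantCoeff_of_mem_homog h2 hn⟩

section Nf

variable {r : ℕ} (hq : r + 1 ≤ q) (β₁ βr : F)

/-- Every multiple of `x` is hit by a time rescaling alone, so the image and the radial space are
complementary. The preference rule puts the chosen complement inside the radial space, and a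
complement contained in another complement equals it. -/
theorem mem_compl_of_mem_radialSpace [CharZero F] (hr : 2 ≤ r) {α : Fin q → ℕ}
    (hα : ∀ k : Fin (r + 1), α (Fin.castLE hq k) = 2 * (r - (k : ℕ))) (s : NormalFormStyle F α)
    {n : ℕ} (hn2 : 2 ≤ n) (hn : n ≤ 2 * r) {v : Fn F q} (hv : v ∈ radialSpace F α n) :
    v ∈ s.compl n (levelImage α (nf hq β₁ βr (sv F q 0) (rad F q)) n n) := by
  set I := levelImage α (nf hq β₁ βr (sv F q 0) (rad F q)) n n with hI
  have hle : I ≤ stateSpace F α n := by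
    intro u hu
    obtain ⟨Y, ⟨⟨⟨hS, -⟩, -, ⟨hT, -⟩⟩, ⟨hS', -, hT'⟩⟩, rfl⟩ :=
      sv_zero_dvd_of_mem_levelImage hq β₁ βr hr hα hn2 hn hu
    refine mem_stateSpace (by omega) (mul_mem sv_zero_mem
      (sub_mem (add_mem hT hS) (eulerE_mem hS))) ?_
    have := mul_mem_homog (sv_mem_homog (F := F) α 0)
      (sub_mem (add_mem hT' hS') (eulerE_mem_homog hS'))
    rwa [show 1 + (n - 1) = n by omega] at this
  have hsup : I ⊔ radialSpace F α n = stateSpace F α n := by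
    refine le_antisymm (sup_le hle inf_le_left) fun u hu => ?_
    obtain ⟨⟨hu1, hu2⟩, -⟩ := hu
    obtain ⟨h, hh, ρ, hρ, e, hρ0⟩ := exists_eq_sv_zero_mul_add hu1
    obtain ⟨m, rfl⟩ : ∃ m, n = m + 1 := ⟨n - 1, by omega⟩
    obtain ⟨hh', hρ'⟩ := homog_of_eq_sv_zero_mul_add hu2 e hρ0
    rw [e]
    refine Submodule.add_mem_sup ?_ ⟨mem_stateSpace (by omega) hρ hρ', hρ0⟩
    -- Only `Y_(n-1)` is nonzero, with time part `h`; the kernel conditions involve indices at least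
    -- two and hold trivially.
    let Y : ℕ → Gen F q := Pi.single 1 (0, 0, h)
    have hY : ∀ i, i ≠ 1 → Y i = 0 := fun i hi => Pi.single_eq_of_ne hi _
    have hY1 : Y 1 = (0, 0, h) := Pi.single_eq_same _ _
    refine ⟨Y, ⟨fun i hi _ => ?_, fun j hj => ?_⟩, ?_⟩
    · by_cases h1 : i = 1
      · rw [h1, hY1]
        refine ⟨⟨⟨zero_mem _, map_zero _⟩, fun j => ⟨zero_mem _, map_zero _⟩, ⟨hh,
          constantCoeff_of_mem_homog hh' (by omega)⟩⟩, ⟨zero_mem _, fun j _ => zero_mem _, hh'⟩⟩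
      · rw [hY i h1]; exact zero_mem _
    · refine Finset.sum_eq_zero fun i hi => ?_
      rw [Finset.mem_Ico] at hi
      rw [hY _ (by omega), map_zero]
    · simp only [LinearMap.sum_apply, LinearMap.comp_apply, LinearMap.proj_apply]
      rw [Finset.sum_eq_single 1, act_comp_nf hq β₁ βr hr hα (by omega), hY1,
        comp_nf hq β₁ βr hr hα]
      · simp [actFactor]
      · intro i _ hi
        rw [hY i hi, map_zero]
      · intro h
        rw [Finset.mem_Ico] at h
        omega
  have hpref := s.preference n I hle hsup
  have hv1 : v ∈ I ⊔ s.compl n I := by rw [s.sup_eq n I hle]; exact hv.1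
  obtain ⟨i, hi, c, hc, rfl⟩ := Submodule.mem_sup.mp hv1
  -- The image component `i` is both a multiple of `x` and free of `x`.
  suffices h : i = 0 by rwa [h, zero_add]
  have hi0 : pderiv F (Sum.inl 0 : Fin 3 ⊕ Fin q) i = 0 := by
    have h1 : pderiv F (Sum.inl 0 : Fin 3 ⊕ Fin q) (i + c) = 0 := hv.2
    have h2 : pderiv F (Sum.inl 0 : Fin 3 ⊕ Fin q) c = 0 := (hpref hc).2
    rwa [map_add, h2, add_zero] at h1
  obtain ⟨Y, -, rfl⟩ := sv_zero_dvd_of_mem_levelImage hq β₁ βr hr hα hn2 hn hi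
  ext d
  by_cases h0 : d (Sum.inl 0) = 0
  · exact coeff_sv_mul_of_eq_zero 0 _ h0
  · exact coeff_eq_zero_of_pderiv_eq_zero hi0 h0

/-- The normal form is in the infinite level parametric normal form. -/
theorem inInfiniteLevel_nf [CharZero F] (hr : 2 ≤ r) {α : Fin q → ℕ}
    (hα : ∀ k : Fin (r + 1), α (Fin.castLE hq k) = 2 * (r - (k : ℕ))) (s : NormalFormStyle F α) :
    InInfiniteLevel s (nf hq β₁ βr (sv F q 0) (rad F q)) := by
  intro n hn
  rw [comp_nf hq β₁ βr hr hα]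
  split_ifs with h1 h2 h3
  · subst h1
    -- In grade one the level map is an empty sum, so the only complement is the whole space.
    have hI : levelImage α (nf hq β₁ βr (sv F q 0) (rad F q)) 1 1 = ⊥ := by
      simp [levelImage]
    rw [hI]
    have := s.sup_eq 1 ⊥ bot_le
    rw [bot_sup_eq] at this
    rw [this]
    exact mem_stateSpace one_ne_zero sv_zero_mem (sv_mem_homog α 0)
  · subst h2
    refine mem_compl_of_mem_radialSpace hq β₁ βr hr hα s le_rfl (by omega)
      ⟨mem_stateSpace two_ne_zero (mul_mem (C_mem _) rad_mem)
        (C_mul_mem_homog (rad_mem_homog α) _), ?_⟩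
    change pderiv F (Sum.inl 0 : Fin 3 ⊕ Fin q) _ = 0
    simp [Derivation.leibniz, pderiv_zero_rad]
  · subst h3
    exact mem_compl_of_mem_radialSpace hq β₁ βr hr hα s (by omega) le_rfl
      ⟨mem_stateSpace (by omega) (nfTop_mem hq βr) (nfTop_mem_homog hq βr hα),
        pderiv_zero_nfTop hq βr⟩
  · exact zero_mem _

theorem inLevel_nf [CharZero F] (hr : 2 ≤ r) {α : Fin q → ℕ}
    (hα : ∀ k : Fin (r + 1), α (Fin.castLE hq k) = 2 * (r - (k : ℕ))) (s : NormalFormStyle F α) :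
    InLevel s (nf hq β₁ βr (sv F q 0) (rad F q)) (2 * r + 1) := by
  intro n hn
  -- Up to grade `2r` the level `2r + 1` is capped at `n`; beyond it `g` has no terms.
  rcases le_or_gt n (2 * r) with h | h
  · have := inInfiniteLevel_nf hq β₁ βr hr hα s n hn
    have e : levelImage α (nf hq β₁ βr (sv F q 0) (rad F q)) n (2 * r + 1) =
        levelImage α (nf hq β₁ βr (sv F q 0) (rad F q)) n n := by
      simp only [levelImage, min_self, min_eq_right (show n ≤ 2 * r + 1 by omega)]
    rwa [e]
  · rw [comp_nf hq β₁ βr hr hα, if_neg (by omega), if_neg (by omega), if_neg (by omega)]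
    exact zero_mem _

end Nf

end Homog

end Levels

/-! ### Symmetries with time rescaling: infinitely many generators -/

section Symmetries

variable {F : Type*} [Field F] {q : ℕ}

theorem countable_of_group_fg (G : Type*) [Group G] (h : Group.FG G) : Countable G := by
  obtain ⟨S, hS, φ, hφ⟩ := Group.fg_iff_exists_freeGroup_hom_surjective.mp h
  have := hS.countable.to_subtype
  exact hφ.countable

theorem not_group_fg_of_injective {G : Type*} [Group G] (f : Set ℕ → G)
    (hf : Function.Injective f) : ¬ Group.FG G := fun h => by
  have := countable_of_group_fg G h
  obtain ⟨e, he⟩ := exists_injective_nat G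
  exact Function.cantor_injective _ (he.comp hf)

theorem constantCoeff_eulerE (k : Fn F q) : constantCoeff (eulerE F q k) = 0 := by
  rw [← coeff_zero_eq_constantCoeff_apply, coeff_eulerE]
  simp

theorem map_rad_of_state {Φ : Fn F q →ₐ[F] Fn F q} {τ : Fn F q}
    (h1 : Φ (sv F q 1) = sv F q 1 * τ) (h2 : Φ (sv F q 2) = sv F q 2 * τ) :
    Φ (rad F q) = rad F q * τ ^ 2 := by
  simp only [rad, map_add, map_pow, h1, h2]; ring

section Nf

variable {r : ℕ} (hq : r + 1 ≤ q) (β₁ βr : F)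

theorem constantCoeff_nfTop (hr : 2 ≤ r) : constantCoeff (nfTop F hq βr) = 0 := by
  have : r ≠ 0 := by omega
  simp [nfTop, constantCoeff_par, constantCoeff_rad, this]

theorem constantCoeff_nf (hr : 2 ≤ r) :
    constantCoeff (nf hq β₁ βr (sv F q 0) (rad F q)) = 0 := by
  rw [nf_eq]
  simp [constantCoeff_sv, constantCoeff_rad, constantCoeff_nfTop hq βr hr]

/-- `τ - 1` divides `τ^n - 1` for every `n`, hence the change of each term. That `m` has no constant
term makes `1 + h m` a unit when `τ - 1 = g h`. -/
theorem exists_nf_state_eq {τ : Fn F q} (hr : 2 ≤ r) (hτ : τ ∈ eulerFns F q) :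
    ∃ m ∈ eulerFns F q, constantCoeff m = 0 ∧
      nf hq β₁ βr (sv F q 0 * τ ^ 2) (rad F q * τ ^ 2) =
        nf hq β₁ βr (sv F q 0) (rad F q) + (τ - 1) * m := by
  let s : ℕ → Fn F q := fun n => ∑ i ∈ Finset.range n, τ ^ i
  have hs : ∀ n, τ ^ n = 1 + (τ - 1) * s n := fun n => by
    rw [mul_geom_sum]; ring
  have hsm : ∀ n, s n ∈ eulerFns F q := fun n => sum_mem fun i _ => pow_mem hτ i
  have hr0 : r ≠ 0 := by omega
  refine ⟨sv F q 0 * s 2 + C β₁ * rad F q * s 2 + ∑ k : Fin (r + 1),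
    rad F q ^ (k : ℕ) * s (2 * k) * par F q (Fin.castLE hq k) + C βr * rad F q ^ r * s (2 * r),
    ?_, ?_, ?_⟩
  · exact add_mem (add_mem (add_mem (mul_mem sv_zero_mem (hsm _))
      (mul_mem (mul_mem (C_mem _) rad_mem) (hsm _)))
      (sum_mem fun _ _ => mul_mem (mul_mem (pow_mem rad_mem _) (hsm _)) (par_mem _)))
      (mul_mem (mul_mem (C_mem _) (pow_mem rad_mem _)) (hsm _))
  · simp [constantCoeff_sv, constantCoeff_rad, constantCoeff_par, hr0]
  · have h : ∀ k, (rad F q * τ ^ 2) ^ k = rad F q ^ k * (1 + (τ - 1) * s (2 * k)) := fun k => by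
      rw [mul_pow, ← pow_mul, hs]
    have hsum : ∑ k : Fin (r + 1), (rad F q * τ ^ 2) ^ (k : ℕ) * par F q (Fin.castLE hq k) =
        ∑ k : Fin (r + 1), rad F q ^ (k : ℕ) * par F q (Fin.castLE hq k) + (τ - 1) *
          ∑ k : Fin (r + 1), rad F q ^ (k : ℕ) * s (2 * k) * par F q (Fin.castLE hq k) := by
      rw [Finset.mul_sum, ← Finset.sum_add_distrib]
      exact Finset.sum_congr rfl fun k _ => by rw [h]; ring
    rw [nf, nf, hsum, h r, hs 2]
    ring

/-- Every function `h` of `x`, `R`, `μ` gives a symmetry of `g E` with `τ = 1 + g h`. -/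
theorem exists_symmetry [CharZero F] (hr : 2 ≤ r) {h : Fn F q} (hh : h ∈ eulerFns F q) :
    ∃ γ ∈ symmetryGroup (nf hq β₁ βr (sv F q 0) (rad F q) • eulerE F q),
      γ.right (sv F q 1) = sv F q 1 * (1 + nf hq β₁ βr (sv F q 0) (rad F q) * h) := by
  set g := nf hq β₁ βr (sv F q 0) (rad F q) with hg
  have hg0 : constantCoeff g = 0 := constantCoeff_nf hq β₁ βr hr
  set τ := 1 + g * h with hτ
  have hτm : τ ∈ eulerFns F q := add_mem (one_mem _) (mul_mem (nf_mem hq β₁ βr) hh)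
  have hτ0 : constantCoeff τ = 1 := by simp [hτ, hg0]
  obtain ⟨Φ, hp, h0, h1, h2⟩ := exists_state_change τ hτ0
  obtain ⟨m, hm, hm0, hgm⟩ := exists_nf_state_eq hq β₁ βr hr hτm
  -- Since `g` divides `τ - 1`, the state change multiplies `g` by a unit, which time rescaling can
  -- undo.
  have hΦg : Φ g = g * (1 + h * m) := by
    have := nf_map hq β₁ βr Φ.toAlgHom hp (sv F q 0) (rad F q)
    change Φ g = nf hq β₁ βr (Φ (sv F q 0)) (Φ (rad F q)) at this
    have hR : Φ (rad F q) = rad F q * τ ^ 2 := map_rad_of_state (Φ := Φ.toAlgHom) h1 h2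
    rw [this, h0, hR, hgm, hτ]; ring
  have he : τ + 2 * eulerE F q τ ∈ eulerFns F q :=
    add_mem hτm (mul_mem (ofNat_mem _ 2) (eulerE_mem hτm))
  obtain ⟨e', he', hee'⟩ := exists_inv_of_mem_eulerFns he
    (by simp [constantCoeff_eulerE, hτ0])
  have hc : constantCoeff e' ≠ 0 := by
    intro hc
    have := congrArg constantCoeff hee'
    rw [map_mul, hc] at this
    simp at this
  obtain ⟨v, hv, hv'⟩ := exists_inv_of_mem_eulerFns
    (mul_mem (mul_mem (add_mem (one_mem _) (mul_mem hh hm)) hτm) he')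
    (by simpa [hm0, hτ0] using hc)
  -- The state change yields `g (1 + h m) τ / (τ + 2 Eτ)`; the time factor is the inverse of the
  -- cofactor of `g`.
  let u : (Fn F q)ˣ := ⟨v, (1 + h * m) * τ * e', by rw [mul_comm]; exact hv', hv'⟩
  refine ⟨SemidirectProduct.inl u * SemidirectProduct.inr Φ, ⟨mul_mem ?_ ?_, ?_⟩, ?_⟩
  · exact Subgroup.subset_closure (Or.inl (Or.inl ⟨u, hv, rfl⟩))
  · exact Subgroup.subset_closure
      (Or.inl (Or.inr ⟨Φ, ⟨hp, τ, hτm, hτ0, h0, h1, h2⟩, rfl⟩))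
  · have hs : Sends (SemidirectProduct.inr Φ) (g • eulerE F q)
        ((g * ((1 + h * m) * τ * e')) • eulerE F q) := by
      rw [sends_state_iff hτ0 hp h0 h1 h2, hΦg]
      linear_combination g * (1 + h * m) * τ * hee'
    have := hs.mul (sends_inl u _)
    have e : (u : Fn F q) * (g * ((1 + h * m) * τ * e')) = g := by
      change v * _ = g
      linear_combination g * hv'
    rwa [e] at this
  · simpa using h1

theorem nf_ne_zero [CharZero F] : nf hq β₁ βr (sv F q 0) (rad F q) ≠ 0 := by
  intro h
  have := congrArg (fun k => constantCoeff (pderiv F (Sum.inl 0 : Fin 3 ⊕ Fin q) k)) h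
  rw [nf_eq] at this
  simp [pderiv_sv, pderiv_zero_rad, pderiv_zero_nfTop, Derivation.leibniz] at this

/-- Subsets of `ℕ`, encoded as 0-1 power series in `μ₁`, give distinct choices of `h` and hence
distinct symmetries, so the group is uncountable. -/
theorem not_fg_symmetryGroup [CharZero F] (hr : 2 ≤ r) :
    ¬ (symmetryGroup (nf hq β₁ βr (sv F q 0) (rad F q) • eulerE F q)).FG := by
  classical
  rw [← Group.fg_iff_subgroup_fg]
  set g := nf hq β₁ βr (sv F q 0) (rad F q) with hg
  let j₀ : Fin q := ⟨0, by omega⟩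
  have hs : PowerSeries.HasSubst (X (Sum.inr j₀) : Coef F q) :=
    PowerSeries.HasSubst.of_constantCoeff_zero (by simp)
  let ψ : MvPowerSeries Unit F →ₐ[F] Fn F q := (emb F q).comp (PowerSeries.substAlgHom hs)
  have hψX : ψ (X ()) = par F q j₀ := by
    change emb F q (PowerSeries.substAlgHom hs PowerSeries.X) = _
    rw [PowerSeries.substAlgHom_X, emb_X_par]
  -- Sending `μ₁` back to the single variable and all other variables to zero is a left inverse of
  -- `ψ`.
  have hχ : HasSubst (Sum.elim (fun _ : Fin 3 => 0) (fun j : Fin q => if j = j₀ then X () else 0) :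
      Fin 3 ⊕ Fin q → MvPowerSeries Unit F) := by
    apply hasSubst_of_constantCoeff_zero
    rintro (i | j)
    · simp
    · simp [apply_ite constantCoeff]
  have hψ : Function.Injective ψ := by
    have : (substAlgHom hχ).comp ψ = AlgHom.id F _ := by
      symm
      refine algHom_ext_X (fun i => by simp) fun i => ?_
      cases i
      rw [AlgHom.comp_apply, hψX, par, substAlgHom_X]
      simp
    exact Function.LeftInverse.injective (g := substAlgHom hχ) fun a => AlgHom.congr_fun this a
  let p : Set ℕ → MvPowerSeries Unit F := fun A => PowerSeries.mk fun n => if n ∈ A then 1 else 0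
  have hp : Function.Injective p := by
    intro A B h
    ext n
    have := congrArg (PowerSeries.coeff n) h
    simp only [p, PowerSeries.coeff_mk] at this
    by_cases h1 : n ∈ A <;> by_cases h2 : n ∈ B <;> simp_all
  have hmem : ∀ A, ψ (p A) ∈ eulerFns F q := fun A => emb_mem _
  choose γ hγ hγ' using fun A => exists_symmetry hq β₁ βr hr (hmem A)
  refine not_group_fg_of_injective (fun A => ⟨γ A, hγ A⟩) fun A B h => hp (hψ ?_)
  have h1 : γ A = γ B := congrArg Subtype.val h
  have h2 := hγ' A
  rw [h1, hγ' B] at h2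
  have h3 := mul_left_cancel₀ (sv_ne_zero 1) h2
  exact (mul_left_cancel₀ (nf_ne_zero hq β₁ βr) (add_left_cancel h3)).symm

/-- The bracket of `g h E` with `g E` is `-g² E(h) E`, which the time part `g E(h)` compensates
exactly. -/
theorem nf_mul_mem_conormalSpace [CharZero F] (hr : 2 ≤ r) {h : Fn F q} (hh : h ∈ eulerFns F q) :
    (nf hq β₁ βr (sv F q 0) (rad F q) * h, 0,
      nf hq β₁ βr (sv F q 0) (rad F q) * eulerE F q h) ∈
        conormalSpace (nf hq β₁ βr (sv F q 0) (rad F q)) := by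
  set g := nf hq β₁ βr (sv F q 0) (rad F q) with hg
  have hg0 : constantCoeff g = 0 := constantCoeff_nf hq β₁ βr hr
  have hgm : g ∈ eulerFns F q := nf_mem hq β₁ βr
  refine ⟨⟨⟨mul_mem hgm hh, by simp [hg0]⟩, fun j => ⟨zero_mem _, map_zero _⟩,
    ⟨mul_mem hgm (eulerE_mem hh), by simp [hg0]⟩⟩, ?_⟩
  change act g _ = 0
  simp only [act, LinearMap.coe_mk, AddHom.coe_mk, Pi.zero_apply, zero_mul, Finset.sum_const_zero,
    Derivation.leibniz, smul_eq_mul]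
  ring

end Nf

/-- The coefficients of `x y^{2n}`. -/
def xyCoeff : Fn F q →ₗ[F] ℕ → F :=
  LinearMap.pi fun n =>
    coeff (Finsupp.single (Sum.inl 0) 1 + Finsupp.single (Sum.inl 1) (2 * n))

theorem xyCoeff_apply (k : Fn F q) (n : ℕ) : xyCoeff k n =
    coeff (Finsupp.single (Sum.inl 0) 1 + Finsupp.single (Sum.inl 1) (2 * n)) k := rfl

/-- The monomials `x y^(2n)` contain no parameter, so only the constant term of `c` contributes.
This turns spans over the parameter functions into spans over `F`. -/
theorem xyCoeff_mul [CharZero F] {c : Fn F q} (hc : c ∈ paramFns F q) (k : Fn F q) :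
    xyCoeff (c * k) = constantCoeff c • xyCoeff k := by
  classical
  ext n
  rw [Pi.smul_apply, xyCoeff_apply, xyCoeff_apply, coeff_mul, smul_eq_mul]
  refine (Finset.sum_eq_single (0, _) ?_ ?_).trans rfl
  · rintro ⟨a, b⟩ hab hne
    rw [Finset.HasAntidiagonal.mem_antidiagonal] at hab
    by_cases ha : ∃ i : Fin 3, a (Sum.inl i) ≠ 0
    · obtain ⟨i, hi⟩ := ha
      rw [coeff_eq_zero_of_pderiv_eq_zero (hc i) hi, zero_mul]
    · push Not at ha
      exfalso
      apply hne
      have ha0 : a = 0 := by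
        ext i
        rcases i with i | j
        · exact ha i
        · have := DFunLike.congr_fun hab (Sum.inr j)
          simp at this
          simp [this.1]
      simp only [ha0, zero_add] at hab
      rw [ha0]
      exact Prod.ext rfl hab
  · intro h
    exact absurd (Finset.HasAntidiagonal.mem_antidiagonal.mpr (zero_add _)) h

/-- Only the term `x` of `g` contains `x`, and `R^k` equals `y^(2k)` up to a multiple of `z`. -/
theorem xyCoeff_nf_mul [CharZero F] {r : ℕ} (hq : r + 1 ≤ q) (β₁ βr : F) (k : ℕ) :
    xyCoeff (nf hq β₁ βr (sv F q 0) (rad F q) * rad F q ^ k) = Pi.single k 1 := by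
  classical
  ext n
  obtain ⟨c, hc⟩ : ∃ c, rad F q ^ k = sv F q 1 ^ (2 * k) + sv F q 2 * c := by
    obtain ⟨c, hc⟩ := sub_dvd_pow_sub_pow (rad F q) (sv F q 1 ^ 2) k
    refine ⟨sv F q 2 * c, ?_⟩
    rw [pow_mul]
    rw [rad] at hc ⊢
    linear_combination hc
  have h1 : nf hq β₁ βr (sv F q 0) (rad F q) * rad F q ^ k = sv F q 0 * rad F q ^ k +
      (C β₁ * rad F q + nfTop F hq βr) * rad F q ^ k := by rw [nf_eq]; ring
  have h2 : pderiv F (Sum.inl 0 : Fin 3 ⊕ Fin q)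
      ((C β₁ * rad F q + nfTop F hq βr) * rad F q ^ k) = 0 := by
    simp [Derivation.leibniz, Derivation.leibniz_pow, pderiv_zero_rad, pderiv_zero_nfTop]
  rw [xyCoeff_apply, h1, map_add, coeff_eq_zero_of_pderiv_eq_zero h2 (by simp), add_zero,
    coeff_add_sv_mul, hc, map_add, coeff_sv_mul_of_eq_zero 2 c (by simp), add_zero, sv, coeff_X_pow,
    Pi.single_apply]
  congr 1
  rw [eq_iff_iff]
  constructor
  · intro h
    have := DFunLike.congr_fun h (Sum.inl 1)
    simp at this
    omega
  · rintro rfl; rfl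

/-- The space of infinitesimal symmetries is not finitely generated over the functions of the
parameters. -/
theorem not_fg_conormalSpace [CharZero F] {r : ℕ} (hq : r + 1 ≤ q) (β₁ βr : F) (hr : 2 ≤ r) :
    ¬ ∃ B : Finset (Gen F q),
      (conormalSpace (nf hq β₁ βr (sv F q 0) (rad F q)) : Set (Gen F q)) ⊆
          Submodule.span (paramFns F q) (B : Set (Gen F q)) := by
  classical
  rintro ⟨B, hB⟩
  -- A finite generating set would confine all coefficient sequences to this finite-dimensional
  -- space, which however would contain every unit vector.
  let V : Submodule F (ℕ → F) :=
    Submodule.span F ((B.image fun Y => xyCoeff Y.1 : Finset (ℕ → F)) : Set (ℕ → F))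
  have hV : ∀ Y ∈ Submodule.span (paramFns F q) (B : Set (Gen F q)), xyCoeff Y.1 ∈ V := by
    intro Y hY
    induction hY using Submodule.span_induction with
    | mem Y hY =>
      exact Submodule.subset_span (Finset.mem_coe.mpr (Finset.mem_image_of_mem _ hY))
    | zero => simp
    | add Y Z _ _ h1 h2 => rw [Prod.fst_add, map_add]; exact add_mem h1 h2
    | smul c Y _ h =>
      have : (c • Y).1 = (c : Fn F q) * Y.1 := rfl
      rw [this, xyCoeff_mul c.2]
      exact Submodule.smul_mem _ _ h
  have hsingle : ∀ k, (Pi.single k 1 : ℕ → F) ∈ V := fun k => by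
    rw [← xyCoeff_nf_mul hq β₁ βr k]
    exact hV _ (hB (nf_mul_mem_conormalSpace hq β₁ βr hr (pow_mem rad_mem k)))
  have hfin : FiniteDimensional F V := FiniteDimensional.span_finset F _
  have hli : LinearIndependent F fun k => (⟨Pi.single k 1, hsingle k⟩ : V) := by
    apply LinearIndependent.of_comp V.subtype
    exact Pi.linearIndependent_single_one ℕ F
  exact not_finite_iff_infinite.mpr inferInstance (hli.finite_of_isNoetherian (ι := ℕ))

end Symmetries

/-! ### Exponentials of derivations that raise the order -/

section Exponential

variable {F : Type*} [Field F] {σ : Type*}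

theorem iterate_map_add' (D : Derivation F (MvPowerSeries σ F) (MvPowerSeries σ F)) (n : ℕ)
    (a b : MvPowerSeries σ F) : D^[n] (a + b) = D^[n] a + D^[n] b := by
  induction n generalizing a b with
  | zero => rfl
  | succ n ih => simp only [Function.iterate_succ_apply, map_add, ih]

theorem iterate_map_smul' (D : Derivation F (MvPowerSeries σ F) (MvPowerSeries σ F)) (n : ℕ)
    (c : F) (a : MvPowerSeries σ F) : D^[n] (c • a) = c • D^[n] a := by
  induction n generalizing a with
  | zero => rfl
  | succ n ih => simp only [Function.iterate_succ_apply, Derivation.map_smul, ih]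

theorem iterate_mem_ordIdeal {w : σ → ℕ}
    {D : Derivation F (MvPowerSeries σ F) (MvPowerSeries σ F)}
    (hD : ∀ n k, k ∈ ordIdeal w n → D k ∈ ordIdeal w (n + 1)) (n : ℕ) (k : MvPowerSeries σ F) :
    D^[n] k ∈ ordIdeal w n := by
  induction n with
  | zero => exact mem_ordIdeal_zero _ _
  | succ n ih => rw [Function.iterate_succ_apply']; exact hD n _ ih

theorem iterate_mul (D : Derivation F (MvPowerSeries σ F) (MvPowerSeries σ F)) (n : ℕ)
    (a b : MvPowerSeries σ F) : D^[n] (a * b) =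
      ∑ ij ∈ Finset.HasAntidiagonal.antidiagonal n, n.choose ij.1 • (D^[ij.1] a * D^[ij.2] b) := by
  induction n with
  | zero => simp
  | succ n ih =>
    rw [Finset.sum_antidiagonal_choose_succ_nsmul (M := MvPowerSeries σ F)
      (fun i j => D^[i] a * D^[j] b) n]
    simp only [Function.iterate_succ_apply', ih, map_sum, map_nsmul, Derivation.leibniz, smul_add,
      Finset.sum_add_distrib, smul_eq_mul]
    congr 1
    refine Finset.sum_congr rfl fun ij hij => ?_
    rw [n.choose_symm_of_eq_add (Finset.HasAntidiagonal.mem_antidiagonal.mp hij).symm, mul_comm]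

theorem inv_factorial_smul_iterate_mul [CharZero F]
    (D : Derivation F (MvPowerSeries σ F) (MvPowerSeries σ F)) (n : ℕ) (a b : MvPowerSeries σ F) :
    (n.factorial : F)⁻¹ • D^[n] (a * b) =
      ∑ k ∈ Finset.range (n + 1), ((k.factorial : F)⁻¹ • D^[k] a) *
        (((n - k).factorial : F)⁻¹ • D^[n - k] b) := by
  rw [iterate_mul, Finset.Nat.sum_antidiagonal_eq_sum_range_succ
    (fun i j => n.choose i • (D^[i] a * D^[j] b)) n, Finset.smul_sum]
  refine Finset.sum_congr rfl fun k hk => ?_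
  have hk : k ≤ n := Nat.lt_succ_iff.mp (Finset.mem_range.mp hk)
  rw [smul_mul_smul_comm, ← Nat.cast_smul_eq_nsmul F, smul_smul, Nat.cast_choose F hk]
  congr 1
  have : (n.factorial : F) ≠ 0 := Nat.cast_ne_zero.mpr n.factorial_ne_zero
  field_simp

theorem smul_mem_ordIdeal {w : σ → ℕ} {n : ℕ} {a : MvPowerSeries σ F} (ha : a ∈ ordIdeal w n)
    (c : F) : c • a ∈ ordIdeal w n := by
  rw [smul_eq_C_mul]
  exact Ideal.mul_mem_left _ _ ha

/-- The exponential of a derivation that raises the order. -/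
theorem exists_exp [CharZero F] {w : σ → ℕ}
    {D : Derivation F (MvPowerSeries σ F) (MvPowerSeries σ F)}
    (hD : ∀ n k, k ∈ ordIdeal w n → D k ∈ ordIdeal w (n + 1)) :
    ∃ Ψ : MvPowerSeries σ F →ₐ[F] MvPowerSeries σ F, ∀ k n,
      Ψ k - ∑ i ∈ Finset.range n, (i.factorial : F)⁻¹ • D^[i] k ∈ ordIdeal w n := by
  have hmem : ∀ n k, (n.factorial : F)⁻¹ • D^[n] k ∈ ordIdeal w n := fun n k =>
    smul_mem_ordIdeal (iterate_mem_ordIdeal hD n k) _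
  have hlim : ∀ k, ∃ a, ∀ n,
      a - ∑ i ∈ Finset.range n, (i.factorial : F)⁻¹ • D^[i] k ∈ ordIdeal w n := fun k =>
    exists_limit (fun n => ∑ i ∈ Finset.range n, (i.factorial : F)⁻¹ • D^[i] k) fun n => by
      rw [Finset.sum_range_succ, add_sub_cancel_left]
      exact hmem n k
  choose ψ hψ using hlim
  have huniq : ∀ a b : MvPowerSeries σ F, (∀ n, a - b ∈ ordIdeal w n) → a = b := fun a b h =>
    sub_eq_zero.mp (eq_zero_of_mem_ordIdeal h)
  have hzero : ∀ k, D k = 0 → ψ k = k := by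
    intro k hk
    refine huniq _ _ fun n => ?_
    have h := hψ k (n + 1)
    rw [Finset.sum_range_succ', Finset.sum_eq_zero fun i _ => ?_] at h
    · exact ordIdeal_anti n.le_succ (by simpa using h)
    · rw [Function.iterate_succ_apply, hk]
      have := iterate_map_smul' D i 0 0
      rw [zero_smul, zero_smul] at this
      rw [this, smul_zero]
  have hmul : ∀ a b, ψ (a * b) = ψ a * ψ b := by
    intro a b
    refine huniq _ _ fun n => ?_
    set A := ∑ i ∈ Finset.range n, (i.factorial : F)⁻¹ • D^[i] a with hA
    set B := ∑ i ∈ Finset.range n, (i.factorial : F)⁻¹ • D^[i] b with hB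
    set P := ∑ i ∈ Finset.range n, (i.factorial : F)⁻¹ • D^[i] (a * b) with hP
    -- By the Leibniz rule the truncations differ only in products of terms with indices `i + j ≥
    -- n`.
    have key : P - A * B ∈ ordIdeal w n := by
      rw [hP, hA, hB, Finset.sum_mul_sum]
      simp only [inv_factorial_smul_iterate_mul]
      rw [Finset.sum_range_diag_flip n fun i j => ((i.factorial : F)⁻¹ • D^[i] a) *
        ((j.factorial : F)⁻¹ • D^[j] b), ← Finset.sum_sub_distrib]
      refine Ideal.sum_mem _ fun i _ => ?_
      rw [← neg_sub, neg_mem_iff, ← Finset.sum_Ico_eq_sub _ (Nat.sub_le n i)]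
      refine Ideal.sum_mem _ fun j hj => ?_
      rw [Finset.mem_Ico] at hj
      exact ordIdeal_anti (by omega) (mul_mem_ordIdeal (hmem i a) (hmem j b))
    have e : ψ (a * b) - ψ a * ψ b =
        (ψ (a * b) - P) + (P - A * B) - (ψ a - A) * B - ψ a * (ψ b - B) := by ring
    rw [e]
    exact sub_mem (sub_mem (add_mem (hψ _ n) key) (Ideal.mul_mem_right _ _ (hψ a n)))
      (Ideal.mul_mem_left _ _ (hψ b n))
  refine ⟨AlgHom.mk ⟨⟨⟨ψ, ?_⟩, hmul⟩, ?_, ?_⟩ ?_, hψ⟩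
  · exact hzero 1 D.map_one_eq_zero
  · exact hzero 0 (map_zero _)
  · intro a b
    refine huniq _ _ fun n => ?_
    have := sub_mem (sub_mem (hψ (a + b) n) (hψ a n)) (hψ b n)
    simp only [iterate_map_add', smul_add, Finset.sum_add_distrib] at this
    convert this using 1
    ring
  · intro c
    exact hzero _ (D.map_algebraMap c)

/-- If `D v = ε v` then `exp(D) v = v s`, where `s` depends on `D` and `ε` alone. -/
theorem exists_exp_eigen [CharZero F] {w : σ → ℕ}
    {D : Derivation F (MvPowerSeries σ F) (MvPowerSeries σ F)}
    (hD : ∀ n k, k ∈ ordIdeal w n → D k ∈ ordIdeal w (n + 1))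
    {Ψ : MvPowerSeries σ F →ₐ[F] MvPowerSeries σ F}
    (hΨ : ∀ k n, Ψ k - ∑ i ∈ Finset.range n, (i.factorial : F)⁻¹ • D^[i] k ∈ ordIdeal w n)
    {ε : MvPowerSeries σ F} (hε : ε ∈ ordIdeal w 1) :
    ∃ s : MvPowerSeries σ F, (∀ n, s - ∑ i ∈ Finset.range n,
        (i.factorial : F)⁻¹ • (fun a => ε * a + D a)^[i] 1 ∈ ordIdeal w n) ∧
      ∀ v, D v = ε * v → Ψ v = v * s := by
  set U : MvPowerSeries σ F → MvPowerSeries σ F := fun a => ε * a + D a with hU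
  have hmem : ∀ n, U^[n] 1 ∈ ordIdeal w n := by
    intro n
    induction n with
    | zero => exact mem_ordIdeal_zero _ _
    | succ n ih =>
      rw [Function.iterate_succ_apply']
      refine add_mem ?_ (hD n _ ih)
      rw [add_comm n 1]
      exact mul_mem_ordIdeal hε ih
  obtain ⟨s, hs⟩ := exists_limit (w := w)
    (fun n => ∑ i ∈ Finset.range n, (i.factorial : F)⁻¹ • U^[i] 1) fun n => by
      rw [Finset.sum_range_succ, add_sub_cancel_left]
      exact smul_mem_ordIdeal (hmem n) _
  refine ⟨s, hs, fun v hv => ?_⟩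
  -- Factoring `v` out of `D` leaves the operator `U = ε + D`, which no longer refers to `v`.
  have hit : ∀ n, D^[n] v = v * U^[n] 1 := by
    intro n
    induction n with
    | zero => simp
    | succ n ih =>
      rw [Function.iterate_succ_apply', ih, Function.iterate_succ_apply', Derivation.leibniz, hv]
      simp only [hU, smul_eq_mul]
      ring
  rw [← sub_eq_zero]
  refine eq_zero_of_mem_ordIdeal (w := w) fun n => ?_
  have h1 := hΨ v n
  have h2 := Ideal.mul_mem_left _ v (hs n)
  simp only [hit, ← mul_smul_comm, ← Finset.mul_sum] at h1
  have := sub_mem h1 h2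
  convert this using 1
  ring

theorem subst_sub_sum_mem_ordIdeal {a : MvPowerSeries σ F}
    (ha : PowerSeries.HasSubst a) {w : σ → ℕ} (haw : a ∈ ordIdeal w 1) (p : PowerSeries F) (n : ℕ) :
    PowerSeries.substAlgHom ha p - ∑ i ∈ Finset.range n, PowerSeries.coeff i p • a ^ i ∈
      ordIdeal w n := by
  have hX : PowerSeries.substAlgHom ha (PowerSeries.X : PowerSeries F) = a :=
    PowerSeries.substAlgHom_X ha
  have hC : ∀ c : F, PowerSeries.substAlgHom ha (PowerSeries.C c) = C c := fun c =>
    (PowerSeries.substAlgHom ha).commutes c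
  induction n generalizing p with
  | zero => exact mem_ordIdeal_zero _ _
  | succ n ih =>
    have hp := PowerSeries.eq_X_mul_shift_add_const p
    have h := mul_mem_ordIdeal haw (ih (PowerSeries.mk fun k => PowerSeries.coeff (k + 1) p))
    have e : PowerSeries.substAlgHom ha p = a * PowerSeries.substAlgHom ha
        (PowerSeries.mk fun k => PowerSeries.coeff (k + 1) p) + C (PowerSeries.constantCoeff p) := by
      have := congrArg (PowerSeries.substAlgHom ha) hp
      rwa [map_add, map_mul, hX, hC] at this
    rw [add_comm n 1]
    convert h using 1
    have hs : ∀ i, PowerSeries.coeff (i + 1) p • a ^ (i + 1) =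
        a * (PowerSeries.coeff i (PowerSeries.mk fun k => PowerSeries.coeff (k + 1) p) • a ^ i) := by
      intro i
      rw [PowerSeries.coeff_mk, pow_succ', mul_smul_comm]
    rw [e, add_comm 1 n, Finset.sum_range_succ', mul_sub, Finset.mul_sum,
      Finset.sum_congr rfl fun i _ => hs i]
    simp only [pow_zero, PowerSeries.coeff_zero_eq_constantCoeff_apply, smul_eq_C_mul, mul_one]
    ring

end Exponential

/-! ### Symmetries without time rescaling are determined on `x = y = z = 0` -/

section Rigidity

variable {F : Type*} [Field F] {q : ℕ}

/-! ### Restriction to `x = y = z = 0` -/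

variable (F q) in
/-- The restriction of a function to `x = y = z = 0`. -/
def atZero : Fn F q →ₐ[F] Fn F q :=
  (rename (R := F) (Function.Embedding.inr : Fin q ↪ Fin 3 ⊕ Fin q)).comp
    (killCompl (Function.Embedding.inr : Fin q ↪ Fin 3 ⊕ Fin q))

@[simp] theorem atZero_sv (i : Fin 3) : atZero F q (sv F q i) = 0 := by
  rw [atZero, AlgHom.comp_apply, sv, killCompl_X_eq_zero, map_zero]
  rintro ⟨j, hj⟩
  cases hj

@[simp] theorem atZero_par (j : Fin q) : atZero F q (par F q j) = par F q j := by
  have := killCompl_X (R := F) (e := (Function.Embedding.inr : Fin q ↪ Fin 3 ⊕ Fin q)) j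
  rw [atZero, AlgHom.comp_apply, par]
  change rename _ (killCompl _ (X (Function.Embedding.inr j))) = _
  rw [this, rename_X]
  rfl

@[simp] theorem atZero_rad : atZero F q (rad F q) = 0 := by simp [rad]

theorem constantCoeff_atZero_X (i : Fin 3 ⊕ Fin q) : constantCoeff (atZero F q (X i)) = 0 := by
  rcases i with i | j
  · exact (congrArg constantCoeff (atZero_sv i)).trans (map_zero _)
  · exact (congrArg constantCoeff (atZero_par j)).trans (constantCoeff_par j)

theorem constantCoeff_atZero (k : Fn F q) : constantCoeff (atZero F q k) = constantCoeff k :=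
  constantCoeff_algHom _ constantCoeff_atZero_X k

theorem atZero_mem (k : Fn F q) : atZero F q k ∈ paramFns F q := by
  intro i
  refine derivation_along_ext (atZero F q) constantCoeff_atZero_X
    ((pderiv F (Sum.inl i)).toLinearMap ∘ₗ (atZero F q).toLinearMap) 0
    (fun a b => ?_) (fun a b => by simp) (fun l => ?_) k
  · simp
  · rcases l with l | j
    · change pderiv F _ (atZero F q (sv F q l)) = 0
      rw [atZero_sv, map_zero]
    · change pderiv F _ (atZero F q (par F q j)) = 0
      rw [atZero_par, pderiv_par]

@[simp] theorem atZero_eulerE (k : Fn F q) : atZero F q (eulerE F q k) = 0 := by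
  simp [eulerE_apply]

theorem atZero_pderiv_eulerE (k : Fn F q) :
    atZero F q (pderiv F (Sum.inl 0) (eulerE F q k)) = atZero F q (pderiv F (Sum.inl 0) k) := by
  simp [eulerE_apply, Derivation.leibniz, pderiv_sv]

variable (q) in
/-- The weight `2` for `x`, `1` for `y, z` and `0` for the parameters. -/
def stateWt : Fin 3 ⊕ Fin q → ℕ := Sum.elim ![2, 1, 1] 0

theorem weight_stateWt (d : Fin 3 ⊕ Fin q →₀ ℕ) : Finsupp.weight (stateWt q) d =
    2 * d (Sum.inl 0) + d (Sum.inl 1) + d (Sum.inl 2) := by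
  rw [Finsupp.weight_apply, Finsupp.sum_fintype _ _ (by simp), Fintype.sum_sum_type,
    Fin.sum_univ_three]
  simp [stateWt]
  ring

theorem coeff_eulerE_eq_weight [CharZero F] (k : Fn F q) (d : Fin 3 ⊕ Fin q →₀ ℕ) :
    coeff d (eulerE F q k) = (Finsupp.weight (stateWt q) d : F) / 2 * coeff d k := by
  rw [coeff_eulerE, weight_stateWt]
  push_cast
  ring

/-- A monomial of state weight zero involves the parameters only, so its coefficient survives the
restriction. -/
theorem mem_ordIdeal_of_atZero_eq_zero {k : Fn F q} (h : atZero F q k = 0) :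
    k ∈ ordIdeal (stateWt q) 1 := by
  have h1 : killCompl (Function.Embedding.inr : Fin q ↪ Fin 3 ⊕ Fin q) k = 0 :=
    rename_injective _ (h.trans (map_zero _).symm)
  intro d hd
  rw [weight_stateWt] at hd
  have h2 := congrArg (coeff (d.comapDomain Sum.inr Sum.inr_injective.injOn)) h1
  rw [coeff_killCompl, map_zero] at h2
  suffices hd' : (d.comapDomain Sum.inr Sum.inr_injective.injOn).embDomain
      (Function.Embedding.inr : Fin q ↪ Fin 3 ⊕ Fin q) = d by rwa [hd'] at h2
  ext i
  rcases i with i | j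
  · rw [Finsupp.embDomain_of_notMem_range _ _ _ (by rintro ⟨j, hj⟩; cases hj)]
    fin_cases i
    · change 0 = d (Sum.inl 0); omega
    · change 0 = d (Sum.inl 1); omega
    · change 0 = d (Sum.inl 2); omega
  · have := Finsupp.embDomain_apply_self (Function.Embedding.inr : Fin q ↪ Fin 3 ⊕ Fin q)
      (d.comapDomain Sum.inr Sum.inr_injective.injOn) j
    rw [Function.Embedding.inr_apply] at this
    rw [this]
    rfl

theorem atZero_atZero (k : Fn F q) : atZero F q (atZero F q k) = atZero F q k := by
  simp only [atZero, AlgHom.comp_apply, killCompl_rename_app]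

theorem atZero_of_mem [CharZero F] {c : Fn F q} (hc : c ∈ paramFns F q) : atZero F q c = c := by
  have h1 : c - atZero F q c ∈ ordIdeal (stateWt q) 1 := by
    apply mem_ordIdeal_of_atZero_eq_zero
    rw [map_sub, atZero_atZero, sub_self]
  have h2 : c - atZero F q c ∈ paramFns F q := sub_mem hc (atZero_mem c)
  symm
  rw [← sub_eq_zero]
  ext d
  by_cases hd : ∃ i : Fin 3, d (Sum.inl i) ≠ 0
  · obtain ⟨i, hi⟩ := hd
    exact coeff_eq_zero_of_pderiv_eq_zero (h2 i) hi
  · push Not at hd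
    exact h1 d (by rw [weight_stateWt]; simp [hd])

/-! ### The equation of a symmetry -/

section Nf

variable {r : ℕ} (hq : r + 1 ≤ q) (β₁ βr : F)

/-- The first parameter. -/
def par₀ (F : Type*) [Field F] {q r : ℕ} (hq : r + 1 ≤ q) : Fn F q :=
  par F q (Fin.castLE hq 0)

/-- Separates `μ₁ + x`, the only part that survives modulo `R`. -/
theorem nf_expand (hr : 2 ≤ r) (x R : Fn F q) : nf hq β₁ βr x R = par₀ F hq + x + R * (C β₁ +
    ∑ k : Fin r, R ^ (k : ℕ) * par F q (Fin.castLE hq k.succ) + C βr * R ^ (r - 1)) := by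
  obtain ⟨s, rfl⟩ : ∃ s, r = s + 1 := ⟨r - 1, by omega⟩
  rw [nf, Fin.sum_univ_succ, mul_add, mul_add, Finset.mul_sum, par₀]
  simp only [Fin.val_zero, pow_zero, one_mul, Fin.val_succ, pow_succ', mul_assoc,
    Nat.add_one_sub_one]
  ring

theorem exists_nf_eq_add (hr : 2 ≤ r) (R : Fn F q) : ∃ m, ∀ x,
    nf hq β₁ βr x R = par₀ F hq + x + R * m :=
  ⟨_, fun x => nf_expand hq β₁ βr hr x R⟩

/-- The equation satisfied by `σ = τ²` when the state change given by `τ` leaves `g E` invariant. -/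
def IsSymmetryFactor (σ : Fn F q) : Prop :=
  nf hq β₁ βr (sv F q 0 * σ) (rad F q * σ) * σ =
    nf hq β₁ βr (sv F q 0) (rad F q) * (σ + eulerE F q σ)

variable {hq β₁ βr}

/-- Obtained by differentiating the symmetry equation in `x` and restricting: the left side gives
`μ₁ σ_x + σ²`, the right side `2 μ₁ σ_x + σ`, because `∂_x Eσ` restricts to `σ_x`. -/
theorem IsSymmetryFactor.atZero_eq (hr : 2 ≤ r) {σ : Fn F q} (h : IsSymmetryFactor hq β₁ βr σ) :
    atZero F q σ * (atZero F q σ - 1) = par₀ F hq * atZero F q (pderiv F (Sum.inl 0) σ) := by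
  obtain ⟨m, hm⟩ := exists_nf_eq_add hq β₁ βr hr (rad F q)
  obtain ⟨m', hm'⟩ := exists_nf_eq_add hq β₁ βr hr (rad F q * σ)
  rw [IsSymmetryFactor, hm, hm'] at h
  have h2 := congrArg (fun k => atZero F q (pderiv F (Sum.inl 0) k)) h
  simp only [Derivation.leibniz, map_add, map_mul, smul_eq_mul, pderiv_zero_rad, atZero_sv,
    atZero_rad, pderiv_sv, atZero_pderiv_eulerE, atZero_eulerE, par₀, atZero_par, pderiv_par,
    map_zero, if_true, map_one] at h2
  rw [par₀]
  linear_combination h2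

/-- In `g(xω, Rω) ω` every term except `μ₁ ω` carries a factor `x` or `R`, and `σ - σ'` divides all
differences of powers. -/
theorem exists_nf_mul_sub_nf_mul (hr : 2 ≤ r) (σ σ' : Fn F q) :
    ∃ b ∈ ordIdeal (stateWt q) 1,
      nf hq β₁ βr (sv F q 0 * σ) (rad F q * σ) * σ -
        nf hq β₁ βr (sv F q 0 * σ') (rad F q * σ') * σ' = (par₀ F hq + b) * (σ - σ') := by
  have hx : sv F q 0 ∈ ordIdeal (stateWt q) 1 :=
    ordIdeal_anti one_le_two (X_mem_ordIdeal (stateWt q) (Sum.inl 0))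
  have hy : sv F q 1 ∈ ordIdeal (stateWt q) 1 := X_mem_ordIdeal (stateWt q) (Sum.inl 1)
  have hz : sv F q 2 ∈ ordIdeal (stateWt q) 1 := X_mem_ordIdeal (stateWt q) (Sum.inl 2)
  have hR : rad F q ∈ ordIdeal (stateWt q) 1 := by
    rw [rad, sq, sq]
    exact add_mem (Ideal.mul_mem_left _ _ hy) (Ideal.mul_mem_left _ _ hz)
  choose t ht using fun n => sub_dvd_pow_sub_pow σ σ' n
  refine ⟨sv F q 0 * t 2 + rad F q * (C β₁ * t 2 + ∑ k : Fin r, rad F q ^ (k : ℕ) *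
    par F q (Fin.castLE hq k.succ) * t (k + 2) + C βr * rad F q ^ (r - 1) * t (r + 1)),
    add_mem (Ideal.mul_mem_right _ _ hx) (Ideal.mul_mem_right _ _ hR), ?_⟩
  have key : ∀ ω, nf hq β₁ βr (sv F q 0 * ω) (rad F q * ω) * ω = par₀ F hq * ω +
      sv F q 0 * ω ^ 2 + rad F q * (C β₁ * ω ^ 2 + ∑ k : Fin r, rad F q ^ (k : ℕ) *
        par F q (Fin.castLE hq k.succ) * ω ^ ((k : ℕ) + 2) +
        C βr * rad F q ^ (r - 1) * ω ^ (r + 1)) := by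
    intro ω
    obtain ⟨s, rfl⟩ : ∃ s, r = s + 1 := ⟨r - 1, by omega⟩
    have e : ∑ k : Fin (s + 1), rad F q ^ (k : ℕ) *
        par F q (Fin.castLE hq k.succ) * ω ^ ((k : ℕ) + 2) = ω ^ 2 * ∑ k : Fin (s + 1),
          (rad F q * ω) ^ (k : ℕ) * par F q (Fin.castLE hq k.succ) := by
      rw [Finset.mul_sum]
      exact Finset.sum_congr rfl fun k _ => by ring
    rw [nf_expand hq β₁ βr hr, e, Nat.add_one_sub_one]
    ring
  have e : ∑ k : Fin r, rad F q ^ (k : ℕ) * par F q (Fin.castLE hq k.succ) * σ ^ ((k : ℕ) + 2) -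
      ∑ k : Fin r, rad F q ^ (k : ℕ) * par F q (Fin.castLE hq k.succ) * σ' ^ ((k : ℕ) + 2) =
      (σ - σ') * ∑ k : Fin r, rad F q ^ (k : ℕ) *
        par F q (Fin.castLE hq k.succ) * t (k + 2) := by
    rw [Finset.mul_sum, ← Finset.sum_sub_distrib]
    refine Finset.sum_congr rfl fun k _ => ?_
    linear_combination rad F q ^ (k : ℕ) * par F q (Fin.castLE hq k.succ) * ht (k + 2)
  rw [key, key]
  linear_combination (sv F q 0 + rad F q * C β₁) * ht 2 + rad F q * e +
    rad F q * C βr * rad F q ^ (r - 1) * ht (r + 1)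

/-- Parameters have state weight zero, so dividing by one loses no order. -/
theorem mem_ordIdeal_of_par_mul {n : ℕ} {j : Fin q} {k : Fn F q}
    (h : par F q j * k ∈ ordIdeal (stateWt q) n) : k ∈ ordIdeal (stateWt q) n := by
  intro d hd
  have h1 := h (Finsupp.single (Sum.inr j) 1 + d) (by
    rw [map_add, Finsupp.weight_single]
    simpa [stateWt] using hd)
  rwa [par, X, coeff_add_monomial_mul, one_mul] at h1

/-- A symmetry factor is determined by its restriction to `x = y = z = 0`. -/
theorem IsSymmetryFactor.ext [CharZero F] (hr : 2 ≤ r) {σ σ' : Fn F q}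
    (h : IsSymmetryFactor hq β₁ βr σ) (h' : IsSymmetryFactor hq β₁ βr σ')
    (h0 : atZero F q σ = atZero F q σ') : σ = σ' := by
  obtain ⟨b, hb, hbσ⟩ := exists_nf_mul_sub_nf_mul (hq := hq) (β₁ := β₁) (βr := βr) hr σ σ'
  set δ := σ - σ' with hδ
  have hg : nf hq β₁ βr (sv F q 0) (rad F q) - par₀ F hq ∈ ordIdeal (stateWt q) 1 := by
    apply mem_ordIdeal_of_atZero_eq_zero
    obtain ⟨m, hm⟩ := exists_nf_eq_add hq β₁ βr hr (rad F q)
    rw [hm]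
    simp
  -- In the difference of the two equations the terms `μ₁ δ` cancel; what remains on the right
  -- raises the state weight.
  have heq : par₀ F hq * eulerE F q δ = b * δ -
      (nf hq β₁ βr (sv F q 0) (rad F q) - par₀ F hq) * (δ + eulerE F q δ) := by
    rw [IsSymmetryFactor] at h h'
    have : eulerE F q δ = eulerE F q σ - eulerE F q σ' := map_sub _ _ _
    rw [h, h'] at hbσ
    rw [this]
    linear_combination hbσ - nf hq β₁ βr (sv F q 0) (rad F q) * hδ
  have key : ∀ n, δ ∈ ordIdeal (stateWt q) (n + 1) := by
    intro n
    induction n with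
    | zero =>
      apply mem_ordIdeal_of_atZero_eq_zero
      rw [hδ, map_sub, h0, sub_self]
    | succ n ih =>
      have hE : eulerE F q δ ∈ ordIdeal (stateWt q) (n + 1 + 1) := by
        apply mem_ordIdeal_of_par_mul (j := Fin.castLE hq 0)
        change par₀ F hq * _ ∈ _
        rw [heq, add_comm _ 1]
        exact sub_mem (mul_mem_ordIdeal hb ih)
          (mul_mem_ordIdeal hg (add_mem ih (eulerE_mem_ordIdeal ih)))
      intro d hd
      -- In weight exactly `n + 1` the field `E` multiplies coefficients by `(n + 1)/2`, which is
      -- nonzero.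
      rcases Nat.lt_or_ge (Finsupp.weight (stateWt q) d) (n + 1) with h1 | h1
      · exact ih d h1
      · have h2 := hE d hd
        rw [coeff_eulerE_eq_weight] at h2
        refine (mul_eq_zero.mp h2).resolve_left (div_ne_zero ?_ two_ne_zero)
        exact Nat.cast_ne_zero.mpr (by omega)
  exact sub_eq_zero.mp (eq_zero_of_mem_ordIdeal fun n => ordIdeal_anti n.le_succ (key n))

end Nf

/-! ### Logarithms -/

variable (F) in
/-- The series `exp(t) - 1`. -/
def expSubOne : PowerSeries F := PowerSeries.mk fun n => if n = 0 then 0 else (n.factorial : F)⁻¹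

/-- A function `1 + m κ` of the parameters with `m(0) = 0` is `exp(c m)`. -/
theorem exists_exp_eq [CharZero F] {m κ : Fn F q} (hm : m ∈ paramFns F q) (hm0 : constantCoeff m = 0)
    (hmne : m ≠ 0) (hκ : 1 + m * κ ∈ paramFns F q) :
    ∃ c ∈ paramFns F q, ∀ n, 1 + m * κ -
      ∑ i ∈ Finset.range n, (i.factorial : F)⁻¹ • (c * m) ^ i ∈ ordIdeal (fun _ => 1) n := by
  have hP0 : PowerSeries.constantCoeff (expSubOne F) = 0 := by
    rw [← PowerSeries.coeff_zero_eq_constantCoeff_apply, expSubOne, PowerSeries.coeff_mk, if_pos rfl]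
  have hP1 : PowerSeries.coeff 1 (expSubOne F) = 1 := by
    simp [expSubOne]
  let _ : Invertible (PowerSeries.coeff 1 (expSubOne F)) := by rw [hP1]; exact invertibleOne
  -- `Q` is the series of `log(1 + t)`. Writing `Q = t Q'` gives `log(1 + m κ) = m κ Q'(m κ)`, which
  -- is divisible by `m` and determines `c`.
  set Q := PowerSeries.substInv (expSubOne F) with hQ
  have hQ0 : PowerSeries.constantCoeff Q = 0 := PowerSeries.constantCoeff_substInv _
  obtain ⟨Q', hQ'⟩ := PowerSeries.X_dvd_iff.mpr hQ0
  have hmκ0 : constantCoeff (m * κ) = 0 := by rw [map_mul, hm0, zero_mul]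
  have hs : PowerSeries.HasSubst (m * κ) := PowerSeries.HasSubst.of_constantCoeff_zero hmκ0
  set c := κ * PowerSeries.substAlgHom hs Q' with hc
  have hcm : c * m = PowerSeries.substAlgHom hs Q := by
    rw [hQ', map_mul, PowerSeries.substAlgHom_X, hc]; ring
  -- Differentiating `1 + m κ` leaves `m ∂κ = 0`, and `m` is not a zero divisor.
  have hκ' : κ ∈ paramFns F q := by
    intro i
    have h1 : pderiv F (Sum.inl i : Fin 3 ⊕ Fin q) (1 + m * κ) = 0 := hκ i
    have h2 : pderiv F (Sum.inl i : Fin 3 ⊕ Fin q) m = 0 := hm i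
    rw [map_add, Derivation.map_one_eq_zero, Derivation.leibniz, h2, smul_zero, zero_add, add_zero,
      smul_eq_mul] at h1
    exact (mul_eq_zero.mp h1).resolve_left hmne
  have hcm0 : constantCoeff (c * m) = 0 := by rw [map_mul, hm0, mul_zero]
  have hs' : PowerSeries.HasSubst (c * m) := PowerSeries.HasSubst.of_constantCoeff_zero hcm0
  have hexp : PowerSeries.substAlgHom hs' (expSubOne F) = m * κ := by
    have h1 : PowerSeries.HasSubst Q := PowerSeries.HasSubst.of_constantCoeff_zero' hQ0
    have h2 := PowerSeries.subst_comp_subst_apply h1 hs (expSubOne F)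
    rw [hQ, PowerSeries.subst_substInv_right _ hP0, ← hQ, PowerSeries.subst_X hs,
      ← PowerSeries.coe_substAlgHom hs, ← hcm] at h2
    rw [PowerSeries.coe_substAlgHom hs', ← h2]
  refine ⟨c, mul_mem hκ' fun i => ?_, fun n => ?_⟩
  · rw [derivation_subst hs hmκ0]
    have : pderiv F (Sum.inl i : Fin 3 ⊕ Fin q) (m * κ) = 0 := mul_mem hm hκ' i
    rw [this, zero_mul]
  · cases n with
    | zero => exact mem_ordIdeal_zero _ _
    | succ n =>
      have h1 := subst_sub_sum_mem_ordIdeal hs' (mem_ordIdeal_one_iff.mpr hcm0) (expSubOne F) (n + 1)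
      rw [hexp] at h1
      have h2 : ∑ i ∈ Finset.range (n + 1), (i.factorial : F)⁻¹ • (c * m) ^ i =
          1 + ∑ i ∈ Finset.range (n + 1), PowerSeries.coeff i (expSubOne F) • (c * m) ^ i := by
        rw [Finset.sum_range_succ', Finset.sum_range_succ']
        simp [expSubOne, add_comm]
      rw [h2, add_sub_add_left_eq_sub]
      exact h1

end Rigidity

/-! ### Identification of the invariant state changes with the flow of `c(μ) g E` -/

section TimeOne

variable {F : Type*} [Field F] {q : ℕ}

theorem algHom_mem_ordIdeal {σ τ : Type*} [Finite σ]
    (Φ : MvPowerSeries σ F →ₐ[F] MvPowerSeries τ F)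
    (h0 : ∀ i, constantCoeff (Φ (X i)) = 0) {n : ℕ} {a : MvPowerSeries σ F}
    (ha : a ∈ ordIdeal (fun _ => 1) n) : Φ a ∈ ordIdeal (fun _ => 1) n := by
  cases nonempty_fintype σ
  induction n generalizing a with
  | zero => exact mem_ordIdeal_zero _ _
  | succ n ih =>
    obtain ⟨b, hb, hb'⟩ := exists_eq_sum_X_mul a
    have h := mem_ordIdeal_one_iff.mp (ordIdeal_anti (Nat.le_add_left 1 n) ha)
    rw [h, map_zero, zero_add] at hb
    rw [hb, map_sum, add_comm]
    refine Ideal.sum_mem _ fun i _ => ?_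
    rw [map_mul]
    exact mul_mem_ordIdeal (mem_ordIdeal_one_iff.mpr (h0 i)) (ih (hb' n ha i))

/-- `E` vanishes on restriction, so each step is multiplication by `c m`; the factor of the flow
therefore restricts to `exp(c m)`. -/
theorem atZero_iterate {c g m : Fn F q} (hc : atZero F q c = c) (hg : atZero F q g = m) (i : ℕ) :
    atZero F q ((fun a => c * g * a + ((c * g) • eulerE F q) a)^[i] 1) = (c * m) ^ i := by
  induction i with
  | zero => simp
  | succ i ih =>
    rw [Function.iterate_succ_apply', pow_succ']
    generalize (fun a => c * g * a + ((c * g) • eulerE F q) a)^[i] 1 = b at ih ⊢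
    simp only [Derivation.smul_apply, smul_eq_mul, map_add, map_mul, atZero_eulerE, mul_zero,
      add_zero, hc, hg, ih]

variable {r : ℕ} {hq : r + 1 ≤ q} {β₁ βr : F}

/-- Because `E c = 0`, the fields `c g E` and `g E` commute; hence the flow of `c g E` preserves `g
E`. -/
theorem iterate_smul_eulerE_comm {c g : Fn F q} (hc : eulerE F q c = 0) (n : ℕ) (k : Fn F q) :
    ((c * g) • eulerE F q)^[n] (g * eulerE F q k) =
      g * eulerE F q (((c * g) • eulerE F q)^[n] k) := by
  induction n generalizing k with
  | zero => rfl
  | succ n ih =>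
    rw [Function.iterate_succ_apply, Function.iterate_succ_apply, ← ih]
    congr 1
    simp only [Derivation.smul_apply, smul_eq_mul, Derivation.leibniz, hc]
    ring

/-- A permissible state change that leaves `g E` invariant is the time-one map of `c(μ) g E`. -/
theorem exists_isTimeOneMap [CharZero F] (hr : 2 ≤ r) (Φ : Fn F q ≃ₐ[F] Fn F q)
    (hΦ : IsStateChange Φ)
    (hS : Sends (SemidirectProduct.inr Φ)
      (nf hq β₁ βr (sv F q 0) (rad F q) • eulerE F q)
      (nf hq β₁ βr (sv F q 0) (rad F q) • eulerE F q)) :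
    ∃ c ∈ paramFns F q,
      IsTimeOneMap ((c * nf hq β₁ βr (sv F q 0) (rad F q)) • eulerE F q) Φ := by
  obtain ⟨hp, τ, -, hτ0, h0, h1, h2⟩ := hΦ
  rw [sends_state_iff hτ0 hp h0 h1 h2] at hS
  set g := nf hq β₁ βr (sv F q 0) (rad F q) with hg
  have hg0 : g ∈ ordIdeal (fun _ => 1) 1 :=
    mem_ordIdeal_one_iff.mpr (constantCoeff_nf hq β₁ βr hr)
  have hΦg : Φ g = nf hq β₁ βr (sv F q 0 * τ ^ 2) (rad F q * τ ^ 2) := by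
    have := nf_map hq β₁ βr Φ.toAlgHom hp (sv F q 0) (rad F q)
    have hR : Φ (rad F q) = rad F q * τ ^ 2 := map_rad_of_state (Φ := Φ.toAlgHom) h1 h2
    rw [← hR, ← h0]
    exact this
  have hσ : IsSymmetryFactor hq β₁ βr (τ ^ 2) := by
    rw [IsSymmetryFactor, ← hΦg, Derivation.leibniz_pow]
    simp only [nsmul_eq_mul, smul_eq_mul, Nat.add_one_sub_one, pow_one, Nat.cast_ofNat]
    linear_combination -τ * hS
  have hZ := hσ.atZero_eq hr
  have hZ0 : constantCoeff (atZero F q (τ ^ 2)) ≠ 0 := by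
    rw [constantCoeff_atZero]; simp [hτ0]
  set m : Fn F q := par₀ F hq with hm
  -- The restricted equation `Z (Z - 1) = μ₁ σ_x` is divided by the unit `Z`, giving `Z = 1 + μ₁ κ`.
  set κ := atZero F q (pderiv F (Sum.inl 0) (τ ^ 2)) * (atZero F q (τ ^ 2))⁻¹ with hκ
  have hZκ : 1 + m * κ = atZero F q (τ ^ 2) := by
    have := MvPowerSeries.mul_inv_cancel _ hZ0
    rw [hκ]
    linear_combination -(atZero F q (τ ^ 2))⁻¹ * hZ + (atZero F q (τ ^ 2) - 1) * this
  obtain ⟨c, hc, hexp⟩ := exists_exp_eq (m := m) (κ := κ) (par_mem_paramFns _)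
    (constantCoeff_par _) (fun h => by
      have := congrArg (coeff (Finsupp.single (Sum.inr (Fin.castLE hq 0)) 1)) h
      simp [hm, par₀, par] at this) (by rw [hZκ]; exact atZero_mem _)
  have hcE : eulerE F q c = 0 := eulerE_of_mem_paramFns hc
  refine ⟨c, hc, ?_⟩
  set D : VF F q := (c * g) • eulerE F q with hDdef
  have hDk : ∀ k, D k = c * g * eulerE F q k := fun k => rfl
  have hcg : c * g ∈ ordIdeal (fun _ => 1) 1 := Ideal.mul_mem_left _ _ hg0
  have hD : ∀ n k, k ∈ ordIdeal (fun _ => 1) n → D k ∈ ordIdeal (fun _ => 1) (n + 1) := by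
    intro n k hk
    rw [hDk, add_comm]
    exact mul_mem_ordIdeal hcg (eulerE_mem_ordIdeal hk)
  obtain ⟨Ψ, hΨ⟩ := exists_exp hD
  -- `x` and `R` are eigenfunctions of `c g E` with factor `c g`, and `y`, `z` with half of it; the
  -- flow thus has the shape of a state change.
  obtain ⟨σ', hσ', hσ'v⟩ := exists_exp_eigen hD hΨ hcg
  obtain ⟨τ', hτ', hτ'v⟩ := exists_exp_eigen hD hΨ
    (Ideal.mul_mem_left _ (C (1 / 2 : F)) hcg)
  have hΨx : Ψ (sv F q 0) = sv F q 0 * σ' := hσ'v _ (by rw [hDk, eulerE_sv_zero])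
  have hΨR : Ψ (rad F q) = rad F q * σ' := hσ'v _ (by rw [hDk, eulerE_rad])
  have hΨy : Ψ (sv F q 1) = sv F q 1 * τ' := hτ'v _ (by rw [hDk, eulerE_sv_one]; ring)
  have hΨz : Ψ (sv F q 2) = sv F q 2 * τ' := hτ'v _ (by rw [hDk, eulerE_sv_two]; ring)
  have hconst : ∀ k, D k = 0 → Ψ k = k := by
    intro k hk
    obtain ⟨s, hs, hsv⟩ := exists_exp_eigen hD hΨ (zero_mem _)
    have e1 := hsv 1 (by rw [D.map_one_eq_zero, zero_mul])
    rw [map_one, one_mul] at e1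
    rw [hsv k (by rw [hk, zero_mul]), ← e1, mul_one]
  have hΨp : ∀ j, Ψ (par F q j) = par F q j := fun j => hconst _ (by rw [hDk, eulerE_par, mul_zero])
  -- `y²` has the same eigenfactor as `x`; comparison with the square of the image of `y` yields `σ'
  -- = τ'²`.
  have hy2 : Ψ (sv F q 1 ^ 2) = sv F q 1 ^ 2 * σ' := by
    refine hσ'v _ ?_
    rw [hDk, Derivation.leibniz_pow, eulerE_sv_one]
    simp only [nsmul_eq_mul, smul_eq_mul, Nat.add_one_sub_one, pow_one, Nat.cast_ofNat]
    linear_combination c * g * sv F q 1 ^ 2 * two_mul_C_half (F := F) (q := q)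
  have hστ : σ' = τ' ^ 2 := by
    refine mul_left_cancel₀ (pow_ne_zero 2 (sv_ne_zero 1)) ?_
    rw [← hy2, map_pow, hΨy]; ring
  have hΨg : Ψ g = nf hq β₁ βr (sv F q 0 * σ') (rad F q * σ') := by
    rw [hg, nf_map hq β₁ βr Ψ hΨp, hΨx, hΨR]
  have hcomm : ∀ k, Ψ (g * eulerE F q k) = g * eulerE F q (Ψ k) := by
    intro k
    rw [← sub_eq_zero]
    refine eq_zero_of_mem_ordIdeal (w := fun _ => 1) fun n => ?_
    have e1 := hΨ (g * eulerE F q k) n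
    have e2 := Ideal.mul_mem_left _ g (eulerE_mem_ordIdeal (hΨ k n))
    have e3 : ∑ i ∈ Finset.range n, (i.factorial : F)⁻¹ • D^[i] (g * eulerE F q k) =
        g * eulerE F q (∑ i ∈ Finset.range n, (i.factorial : F)⁻¹ • D^[i] k) := by
      rw [map_sum, Finset.mul_sum]
      refine Finset.sum_congr rfl fun i _ => ?_
      rw [hDdef, iterate_smul_eulerE_comm hcE, Derivation.map_smul, mul_smul_comm]
    rw [e3] at e1
    rw [map_sub, mul_sub] at e2
    convert sub_mem e1 e2 using 1
    ring
  have hσ'S : IsSymmetryFactor hq β₁ βr σ' := by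
    rw [IsSymmetryFactor, ← hΨg, ← hg]
    have e := hcomm (sv F q 0)
    rw [eulerE_sv_zero, map_mul, hΨx, Derivation.leibniz, eulerE_sv_zero] at e
    refine mul_left_cancel₀ (sv_ne_zero 0) ?_
    simp only [smul_eq_mul] at e
    linear_combination e
  have hgZ : atZero F q g = m := by
    obtain ⟨m', hm'⟩ := exists_nf_eq_add hq β₁ βr hr (rad F q)
    rw [hg, hm']
    simp [hm, par₀]
  have hZσ' : atZero F q σ' = atZero F q (τ ^ 2) := by
    rw [← hZκ, ← sub_eq_zero]
    refine eq_zero_of_mem_ordIdeal (w := fun _ => 1) fun n => ?_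
    have e1 := algHom_mem_ordIdeal (atZero F q) constantCoeff_atZero_X (hσ' n)
    rw [map_sub, map_sum, Finset.sum_congr rfl fun i _ => by
      rw [map_smul, hDdef, atZero_iterate (atZero_of_mem hc) hgZ]] at e1
    convert sub_mem e1 (hexp n) using 1
    ring
  have hσσ' : τ' ^ 2 = τ ^ 2 := by
    rw [← hστ]
    exact hσ'S.ext hr hσ hZσ'
  have hτ'0 : constantCoeff τ' = 1 := by
    have e := mem_ordIdeal_one_iff.mp (hτ' 1)
    simpa [sub_eq_zero] using e
  -- Equal squares leave a sign, which the constant terms `1` decide.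
  have hττ : τ' = τ := by
    have e : (τ' - τ) * (τ' + τ) = 0 := by linear_combination hσσ'
    refine sub_eq_zero.mp ((mul_eq_zero.mp e).resolve_right fun e' => ?_)
    have := congrArg constantCoeff e'
    rw [map_add, hτ'0, hτ0, map_zero, one_add_one_eq_two] at this
    exact two_ne_zero this
  have hΦΨ : Φ.toAlgHom = Ψ := by
    refine algHom_ext_X (fun i => constantCoeff_algEquiv_X Φ i) ?_
    refine eq_on_X ?_ ?_ ?_ fun j => ?_
    · exact h0.trans (by rw [← hσσ', ← hστ]; exact hΨx.symm)
    · exact h1.trans (by rw [← hττ]; exact hΨy.symm)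
    · exact h2.trans (by rw [← hττ]; exact hΨz.symm)
    · exact (hp j).trans (hΨp j).symm
  intro k d
  have e := hΨ k (d.degree + 1) d (by rw [Finsupp.degree_eq_weight_one]; exact Nat.lt_succ_self _)
  rw [map_sub, sub_eq_zero, ← hΦΨ, map_sum] at e
  refine e.trans (Finset.sum_congr rfl fun i _ => ?_)
  rw [coeff_smul]

end TimeOne

/-! ### Splitting series in `R` and the parameters by powers of `R` -/

section Unfolding

variable {F : Type*} [Field F] {ι : Type*}

/-- Division by `R ^ m` (where `R` is the variable `none`), without the remainder. -/
def shift (F ι : Type*) [Field F] (m : ℕ) :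
    MvPowerSeries (Option ι) F →ₗ[F] MvPowerSeries (Option ι) F :=
  LinearMap.pi fun d => coeff (d + Finsupp.single none m)

/-- The coefficient of `R ^ k`, without its constant term. -/
def paramPart (F ι : Type*) [Field F] (k : ℕ) :
    MvPowerSeries (Option ι) F →ₗ[F] MvPowerSeries (Option ι) F :=
  LinearMap.pi fun d =>
    open Classical in if d none = 0 ∧ d ≠ 0 then coeff (d + Finsupp.single none k) else 0

theorem coeff_shift (m : ℕ) (h : MvPowerSeries (Option ι) F) (d : Option ι →₀ ℕ) :
    coeff d (shift F ι m h) = coeff (d + Finsupp.single none m) h := rfl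

open Classical in
theorem coeff_paramPart (k : ℕ) (h : MvPowerSeries (Option ι) F) (d : Option ι →₀ ℕ) :
    coeff d (paramPart F ι k h) =
      if d none = 0 ∧ d ≠ 0 then coeff (d + Finsupp.single none k) h else 0 := by
  change (ite _ _ _ : MvPowerSeries (Option ι) F →ₗ[F] F) h = _
  split_ifs <;> rfl

theorem coeff_X_none_pow_mul (m : ℕ) (h : MvPowerSeries (Option ι) F) (d : Option ι →₀ ℕ) :
    coeff d (X none ^ m * h) = if m ≤ d none then coeff (d - Finsupp.single none m) h else 0 := by
  rw [X_pow_eq, coeff_monomial_mul, one_mul]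
  simp only [Finsupp.single_le_iff]

theorem shift_X_pow_mul (m : ℕ) (h : MvPowerSeries (Option ι) F) :
    shift F ι m (X none ^ m * h) = h := by
  ext d
  rw [coeff_shift, coeff_X_none_pow_mul, if_pos (by simp), add_tsub_cancel_right]

theorem shift_mem_ordIdeal {w : Option ι → ℕ} (hw : w none = 1) {n : ℕ} (m : ℕ)
    {h : MvPowerSeries (Option ι) F} (hh : h ∈ ordIdeal w n) :
    shift F ι m h ∈ ordIdeal w (n - m) := fun d hd => by
  rw [coeff_shift]
  apply hh
  rw [map_add, Finsupp.weight_single, hw]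
  simp only [smul_eq_mul, mul_one]
  omega

theorem paramPart_mem_ordIdeal {w : Option ι → ℕ} {N : ℕ} (hw : ∀ i, w (some i) = N) (k : ℕ)
    (h : MvPowerSeries (Option ι) F) : paramPart F ι k h ∈ ordIdeal w N := fun d hd => by
  rw [coeff_paramPart, if_neg]
  rintro ⟨h0, h1⟩
  obtain ⟨i, hi⟩ := Finsupp.ne_iff.mp h1
  cases i with
  | none => exact hi h0
  | some i =>
    have h2 : Finsupp.single (some i) 1 ≤ d :=
      Finsupp.single_le_iff.mpr (Nat.one_le_iff_ne_zero.mpr hi)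
    obtain ⟨e, rfl⟩ := exists_add_of_le h2
    rw [map_add, Finsupp.weight_single, hw, smul_eq_mul, one_mul] at hd
    omega

theorem coeff_X_none_pow_mul_paramPart (k : ℕ) (h : MvPowerSeries (Option ι) F)
    (d : Option ι →₀ ℕ) : coeff d (X none ^ k * paramPart F ι k h) = open Classical in
      if k = d none ∧ d ≠ Finsupp.single none k then coeff d h else 0 := by
  classical
  rw [coeff_X_none_pow_mul]
  by_cases hk : k ≤ d none
  · obtain ⟨e, rfl⟩ := exists_add_of_le (Finsupp.single_le_iff.mpr hk)
    rw [if_pos hk, add_tsub_cancel_left, coeff_paramPart, add_comm]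
    refine if_congr ?_ rfl rfl
    simp
  · rw [if_neg hk, if_neg]
    rintro ⟨h1, -⟩
    exact hk h1.le

theorem X_none_pow_mul_paramPart_mem_ordIdeal {w : Option ι → ℕ} {n : ℕ} (k : ℕ)
    {h : MvPowerSeries (Option ι) F} (hh : h ∈ ordIdeal w n) :
    X none ^ k * paramPart F ι k h ∈ ordIdeal w n := fun d hd => by
  rw [coeff_X_none_pow_mul_paramPart]
  split_ifs
  · exact hh d hd
  · rfl

/-- The sum reassembles the terms of `h` of degree at most `r` in `R` that contain a parameter.
Together with the terms of degree at least `r + 2`, which encode `s`, these do not overlap, so one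
series carries all the unknowns. -/
theorem coeff_sum_paramPart (r : ℕ) (h : MvPowerSeries (Option ι) F) (d : Option ι →₀ ℕ) :
    coeff d (∑ k ∈ Finset.range (r + 1), X none ^ k * paramPart F ι k h) = open Classical in
      if d none ≤ r ∧ d ≠ Finsupp.single none (d none) then coeff d h else 0 := by
  classical
  rw [map_sum]
  simp only [coeff_X_none_pow_mul_paramPart]
  split_ifs with hd
  · rw [Finset.sum_eq_single (d none), if_pos ⟨rfl, hd.2⟩]
    · intro k _ hk
      rw [if_neg fun h => hk h.1]
    · intro hk
      exact absurd (Finset.mem_range.mpr (Nat.lt_succ_of_le hd.1)) hk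
  · refine Finset.sum_eq_zero fun k hk => ?_
    rw [if_neg]
    rintro ⟨rfl, h2⟩
    exact hd ⟨Nat.le_of_lt_succ (Finset.mem_range.mp hk), h2⟩

theorem shift_sum_paramPart (r : ℕ) {m : ℕ} (hm : r < m) (h : MvPowerSeries (Option ι) F) :
    shift F ι m (∑ k ∈ Finset.range (r + 1), X none ^ k * paramPart F ι k h) = 0 := by
  ext d
  rw [coeff_shift, coeff_sum_paramPart, if_neg, map_zero]
  rintro ⟨h1, -⟩
  simp at h1
  omega

theorem shift_shift (m n : ℕ) (h : MvPowerSeries (Option ι) F) :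
    shift F ι m (shift F ι n h) = shift F ι (m + n) h := by
  ext d
  simp only [coeff_shift, add_assoc, ← Finsupp.single_add]

end Unfolding

/-! ### Solving the unfolding equation -/

section Unfolding

variable {F : Type*} [Field F] {ι : Type*}

/-- Near `1` the difference quotient of the `m`-th power is its derivative `m` up to an element of
`I`. -/
theorem exists_pow_sub_pow {A : Type*} [CommRing A] (I : Ideal A) {a b : A} (ha : a - 1 ∈ I)
    (hb : b - 1 ∈ I) (m : ℕ) : ∃ g, a ^ m - b ^ m = (a - b) * g ∧ g - m ∈ I := by
  induction m with
  | zero => exact ⟨0, by simp, by simp⟩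
  | succ m ih =>
    obtain ⟨g, hg, hgm⟩ := ih
    have hbm : b ^ m - 1 ∈ I := by
      obtain ⟨c, hc⟩ := sub_one_dvd_pow_sub_one b m
      rw [hc]
      exact I.mul_mem_right _ hb
    refine ⟨a * g + b ^ m, by rw [pow_succ, pow_succ]; linear_combination a * hg, ?_⟩
    convert add_mem (add_mem (I.mul_mem_right g ha) hgm) hbm using 1
    push_cast
    ring

variable {w : Option ι → ℕ} {r : ℕ}

/-- The defect of the equation
`φ τ² = β₁ R τ² + β_r (R τ²) ^ r + ∑_{k ≤ r} π_k (R τ²) ^ k`, where `τ = 1 + R s`. -/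
def defect (r : ℕ) (b₁ br : F) (φ s : MvPowerSeries (Option ι) F)
    (p : ℕ → MvPowerSeries (Option ι) F) : MvPowerSeries (Option ι) F :=
  φ * (1 + X none * s) ^ 2 - (C b₁ * X none * (1 + X none * s) ^ 2
    + C br * X none ^ r * (1 + X none * s) ^ (2 * r)
    + ∑ k ∈ Finset.range (r + 1), X none ^ k * p k * (1 + X none * s) ^ (2 * k))

/-- Linearization of the defect. The `β₁` terms cancel, while `φ τ²` contributes `2 β_r` and `β_r (R
τ²)^r` contributes `2 r β_r` to the coefficient of `R^(r+1) (s - s')`. The error is of higher order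
(`A`) or divisible by `R^(r+1)`, where a further factor `R` will be gained. -/
theorem exists_defect_sub (hw : w none = 1) {b₁ br : F} {φ ψ χ : MvPowerSeries (Option ι) F}
    (hφ : φ = C b₁ * X none + C br * X none ^ r + X none ^ (r + 1) * ψ + χ)
    (hχ : χ ∈ ordIdeal w (r + 2)) {n : ℕ} {s s' : MvPowerSeries (Option ι) F}
    {p p' : ℕ → MvPowerSeries (Option ι) F} (hs : s - s' ∈ ordIdeal w (n - (r + 2)))
    (hp : ∀ k, X none ^ k * (p k - p' k) ∈ ordIdeal w n) (hp' : ∀ k, p' k ∈ ordIdeal w (r + 2)) :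
    ∃ A B, A ∈ ordIdeal w (n + 1) ∧ X none ^ (r + 1) * B ∈ ordIdeal w n ∧
      defect r b₁ br φ s p - defect r b₁ br φ s' p' =
        A + X none ^ (r + 1) * B - ∑ k ∈ Finset.range (r + 1), X none ^ k * (p k - p' k)
          - C (2 * (r - 1) * br) * (X none ^ (r + 1) * (s - s')) := by
  have hX : (X none : MvPowerSeries (Option ι) F) ∈ ordIdeal w 1 := hw ▸ X_mem_ordIdeal w none
  set τ := 1 + X none * s with hτ
  set τ' := 1 + X none * s' with hτ'
  have hτ1 : τ - 1 ∈ ordIdeal w 1 := by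
    rw [hτ, add_sub_cancel_left]; exact Ideal.mul_mem_right _ _ hX
  have hτ'1 : τ' - 1 ∈ ordIdeal w 1 := by
    rw [hτ', add_sub_cancel_left]; exact Ideal.mul_mem_right _ _ hX
  have hδ : τ - τ' = X none * (s - s') := by rw [hτ, hτ']; ring
  have hδm : τ - τ' ∈ ordIdeal w (1 + (n - (r + 2))) := hδ ▸ mul_mem_ordIdeal hX hs
  choose G hG hGm using exists_pow_sub_pow (ordIdeal w 1 : Ideal (MvPowerSeries (Option ι) F)) hτ1 hτ'1
  have hpow : ∀ m, τ ^ m - 1 ∈ ordIdeal w 1 := fun m => by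
    obtain ⟨c, hc⟩ := sub_one_dvd_pow_sub_one τ m
    rw [hc]
    exact Ideal.mul_mem_right _ _ hτ1
  have hXr : (X none : MvPowerSeries (Option ι) F) ^ (r + 1) ∈ ordIdeal w (r + 1) := by
    simpa using pow_mem_ordIdeal hX (r + 1)
  -- `χ` and `p'` have weight at least `r + 2`, which makes up for the loss of order in `s - s'`.
  -- The terms with `ψ`, and the `β_r` terms beyond the linear one, only reach order `n` and go to
  -- `B`.
  refine ⟨χ * ((τ - τ') * (τ + τ')) - ∑ k ∈ Finset.range (r + 1),
      (X none ^ k * (p k - p' k) * (τ ^ (2 * k) - 1) + p' k * ((τ - τ') * G (2 * k)) * X none ^ k),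
    ψ * ((τ - τ') * (τ + τ')) +
      C br * ((s - s') * ((τ - 1) + (τ' - 1) - (G (2 * r) - ((2 * r : ℕ) : MvPowerSeries _ F)))),
    ?_, ?_, ?_⟩
  · refine sub_mem ?_ (Ideal.sum_mem _ fun k _ => add_mem ?_ ?_)
    · refine ordIdeal_anti ?_ (mul_mem_ordIdeal hχ (Ideal.mul_mem_right _ _ hδm))
      omega
    · exact mul_mem_ordIdeal (hp k) (hpow _)
    · refine Ideal.mul_mem_right _ _ (ordIdeal_anti ?_
        (mul_mem_ordIdeal (hp' k) (Ideal.mul_mem_right _ _ hδm)))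
      omega
  · rw [mul_add]
    refine add_mem ?_ ?_
    · refine ordIdeal_anti ?_
        (mul_mem_ordIdeal hXr (Ideal.mul_mem_left _ ψ (Ideal.mul_mem_right _ _ hδm)))
      omega
    · refine ordIdeal_anti ?_ (mul_mem_ordIdeal hXr (Ideal.mul_mem_left _ (C br)
        (mul_mem_ordIdeal hs (sub_mem (add_mem hτ1 hτ'1) (hGm (2 * r))))))
      omega
  · have hsum : ∑ k ∈ Finset.range (r + 1), X none ^ k * p k * τ ^ (2 * k)
        - ∑ k ∈ Finset.range (r + 1), X none ^ k * p' k * τ' ^ (2 * k) =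
        ∑ k ∈ Finset.range (r + 1), (X none ^ k * (p k - p' k) * (τ ^ (2 * k) - 1)
          + p' k * ((τ - τ') * G (2 * k)) * X none ^ k)
        + ∑ k ∈ Finset.range (r + 1), X none ^ k * (p k - p' k) := by
      rw [← Finset.sum_sub_distrib, ← Finset.sum_add_distrib]
      refine Finset.sum_congr rfl fun k _ => ?_
      linear_combination X none ^ k * p' k * hG (2 * k)
    have hr := hG (2 * r)
    have hC : (C (2 * (r - 1) * br) : MvPowerSeries (Option ι) F) =
        (((2 * r : ℕ) : MvPowerSeries _ F) - 2) * C br := by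
      simp only [map_mul, map_sub, map_one, map_natCast, map_ofNat]
      push_cast
      ring
    rw [defect, defect, ← hτ, ← hτ', hC]
    have e : ((1 : ℕ) : MvPowerSeries (Option ι) F) = 1 := Nat.cast_one
    linear_combination -hsum - C br * X none ^ r * hr + (τ ^ 2 - τ' ^ 2) * hφ
      + C br * X none ^ r * (τ + τ' - G (2 * r)) * hδ

/-- The versal unfolding: a family `φ(R, μ)` with `φ(R, 0) = β₁ R + β_r R ^ r + ⋯` is equivalent
to a family of polynomials in `R` of degree `r`. -/
theorem exists_defect_eq_zero [CharZero F] (hr : 2 ≤ r) (hw : w none = 1)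
    (hw' : ∀ i, w (some i) = r + 2) {b₁ br : F} (hbr : br ≠ 0)
    {φ ψ χ : MvPowerSeries (Option ι) F}
    (hφ : φ = C b₁ * X none + C br * X none ^ r + X none ^ (r + 1) * ψ + χ)
    (hχ : χ ∈ ordIdeal w (r + 2)) :
    ∃ h, defect r b₁ br φ (shift F ι (r + 2) h) (fun k => paramPart F ι k h) = 0 := by
  set l : F := 2 * (r - 1) * br with hl
  have hl0 : l ≠ 0 := by
    have : (r : F) ≠ 1 := by
      intro h
      have : r = 1 := by exact_mod_cast h
      omega
    exact mul_ne_zero (mul_ne_zero two_ne_zero (sub_ne_zero.mpr this)) hbr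
  have hll : (C l⁻¹ * C l : MvPowerSeries (Option ι) F) = 1 := by
    rw [← map_mul, inv_mul_cancel₀ hl0, map_one]
  have hX : (X none : MvPowerSeries (Option ι) F) ∈ ordIdeal w 1 := hw ▸ X_mem_ordIdeal w none
  have hXm : ∀ m, (X none : MvPowerSeries (Option ι) F) ^ m ∈ ordIdeal w m := fun m => by
    simpa using pow_mem_ordIdeal hX m
  let D : MvPowerSeries (Option ι) F → MvPowerSeries (Option ι) F := fun h =>
    defect r b₁ br φ (shift F ι (r + 2) h) (fun k => paramPart F ι k h)
  -- A Newton step with fixed linear part: the defect of degree at most `r` in `R` is added to the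
  -- `π_k`. The rest, divided by `l R^(r+1)`, is added to `s`, which sits at `R^(r+2)` in `h`; this
  -- extra `R` makes `T` contract.
  let T : MvPowerSeries (Option ι) F → MvPowerSeries (Option ι) F := fun h =>
    ∑ k ∈ Finset.range (r + 1), X none ^ k * paramPart F ι k h
      + X none ^ (r + 2) * shift F ι (r + 2) h
      + (D h - X none ^ (r + 1) * shift F ι (r + 1) (D h))
      + C l⁻¹ * (X none ^ (r + 2) * shift F ι (r + 1) (D h))
  obtain ⟨h, hT, -⟩ := exists_fixedPoint (w := w) T (by
    intro n a b hab
    obtain ⟨A, B, hA, hB, hAB⟩ := exists_defect_sub hw hφ hχ (n := n)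
      (s := shift F ι (r + 2) a) (s' := shift F ι (r + 2) b)
      (p := fun k => paramPart F ι k a) (p' := fun k => paramPart F ι k b)
      (by rw [← map_sub]; exact shift_mem_ordIdeal hw _ hab)
      (fun k => by rw [← map_sub]; exact X_none_pow_mul_paramPart_mem_ordIdeal k hab)
      (fun k => paramPart_mem_ordIdeal hw' k b)
    change D a - D b = _ at hAB
    rw [← hl] at hAB
    simp only [← map_sub] at hAB
    have hsh : shift F ι (r + 1) (D a) - shift F ι (r + 1) (D b) =
        shift F ι (r + 1) A + B - C l * shift F ι (r + 2) (a - b) := by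
      rw [← map_sub, hAB, map_sub, map_sub, map_add, shift_X_pow_mul,
        shift_sum_paramPart r (Nat.lt_succ_self r), sub_zero, ← smul_eq_C_mul, map_smul,
        shift_X_pow_mul, smul_eq_C_mul]
    have hsA : X none ^ (r + 1) * shift F ι (r + 1) A ∈ ordIdeal w (n + 1) := by
      refine ordIdeal_anti ?_ (mul_mem_ordIdeal (hXm (r + 1)) (shift_mem_ordIdeal hw (r + 1) hA))
      omega
    have hXB : X none * (X none ^ (r + 1) * B) ∈ ordIdeal w (n + 1) := by
      rw [add_comm]; exact mul_mem_ordIdeal hX hB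
    have e : T a - T b = A - X none ^ (r + 1) * shift F ι (r + 1) A
        + C l⁻¹ * (X none * (X none ^ (r + 1) * shift F ι (r + 1) A)
          + X none * (X none ^ (r + 1) * B)) := by
      have e1 : ∑ k ∈ Finset.range (r + 1), X none ^ k * paramPart F ι k a
          - ∑ k ∈ Finset.range (r + 1), X none ^ k * paramPart F ι k b
          = ∑ k ∈ Finset.range (r + 1), X none ^ k * paramPart F ι k (a - b) := by
        rw [← Finset.sum_sub_distrib]
        exact Finset.sum_congr rfl fun k _ => by rw [map_sub]; ring
      have e2 := map_sub (shift F ι (r + 2)) a b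
      simp only [T]
      linear_combination e1 + hAB - X none ^ (r + 1) * hsh
        + C l⁻¹ * X none ^ (r + 2) * hsh - X none ^ (r + 2) * e2
        - X none ^ (r + 2) * shift F ι (r + 2) (a - b) * hll
    rw [e]
    exact add_mem (sub_mem hA hsA)
      (Ideal.mul_mem_left _ _ (add_mem (Ideal.mul_mem_left _ _ hsA) hXB)))
  refine ⟨h, ?_⟩
  change D h = 0
  -- The part of the fixed point equation divisible by `R^(r+2)` says that the correction to `s`
  -- vanishes.
  have hD0 : shift F ι (r + 1) (D h) = 0 := by
    have e := congrArg (shift F ι (r + 2)) hT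
    simp only [T] at e
    have e1 : ∀ a, shift F ι (r + 2) a = shift F ι 1 (shift F ι (r + 1) a) := fun a => by
      rw [shift_shift, add_comm 1, add_assoc]
    rw [map_add, map_add, map_add, shift_sum_paramPart r (by omega), shift_X_pow_mul, map_sub,
      e1 (_ * _), shift_X_pow_mul, e1 (D h), sub_self, ← smul_eq_C_mul, map_smul,
      shift_X_pow_mul] at e
    have e2 : l⁻¹ • shift F ι (r + 1) (D h) = 0 := by linear_combination e
    exact (smul_eq_zero.mp e2).resolve_left (inv_ne_zero hl0)
  have hs1 : ∀ m, (1 + X none * shift F ι (r + 2) h) ^ m - 1 ∈ ordIdeal w 1 := fun m => by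
    obtain ⟨c, hc⟩ := sub_one_dvd_pow_sub_one (1 + X none * shift F ι (r + 2) h) m
    rw [hc, add_sub_cancel_left]
    exact Ideal.mul_mem_right _ _ (Ideal.mul_mem_right _ _ hX)
  -- Pure powers `R^k`, `k ≤ r`, cannot be corrected by the `π_k`, which have no constant term; they
  -- are absent from the defect because `φ` has the prescribed terms `β₁ R + β_r R^r`.
  have hDr : D h ∈ ordIdeal w (r + 1) := by
    set τ := 1 + X none * shift F ι (r + 2) h with hτ
    have e : D h = C br * (X none ^ r * ((τ ^ 2 - 1) - (τ ^ (2 * r) - 1)))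
        + X none ^ (r + 1) * (ψ * τ ^ 2) + χ * τ ^ 2
        - ∑ k ∈ Finset.range (r + 1), paramPart F ι k h * (X none ^ k * τ ^ (2 * k)) := by
      have e2 : ∑ k ∈ Finset.range (r + 1), paramPart F ι k h * (X none ^ k * τ ^ (2 * k)) =
          ∑ k ∈ Finset.range (r + 1), X none ^ k * paramPart F ι k h * τ ^ (2 * k) :=
        Finset.sum_congr rfl fun k _ => by ring
      rw [e2]
      simp only [D, defect]
      rw [← hτ]
      linear_combination τ ^ 2 * hφ
    rw [e]
    refine sub_mem (add_mem (add_mem ?_ ?_) ?_) (Ideal.sum_mem _ fun k _ => ?_)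
    · exact Ideal.mul_mem_left _ _ (mul_mem_ordIdeal (hXm r) (sub_mem (hs1 _) (hs1 _)))
    · exact Ideal.mul_mem_right _ _ (hXm _)
    · exact Ideal.mul_mem_right _ _ (ordIdeal_anti (Nat.le_succ _) hχ)
    · exact Ideal.mul_mem_right _ _ (ordIdeal_anti (Nat.le_succ _) (paramPart_mem_ordIdeal hw' k h))
  simp only [T, hD0, mul_zero, sub_zero, add_zero] at hT
  ext d
  rw [map_zero]
  -- Degree above `r` in `R` is covered by `hD0`, pure powers by `hDr`, and the remaining monomials
  -- by the fixed point equation itself.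
  rcases lt_or_ge r (d none) with hd | hd
  · have e := congrArg (coeff (d - Finsupp.single none (r + 1))) hD0
    rwa [coeff_shift, tsub_add_cancel_of_le (Finsupp.single_le_iff.mpr hd), map_zero] at e
  · by_cases hd' : d = Finsupp.single none (d none)
    · apply hDr
      rw [hd', Finsupp.weight_single, hw, smul_eq_mul, mul_one]
      omega
    · have e := congrArg (coeff d) hT
      rw [map_add, map_add, coeff_sum_paramPart, if_pos ⟨hd, hd'⟩, coeff_X_none_pow_mul,
        if_neg (by omega), add_zero] at e
      linear_combination e

end Unfolding

/-! ### The rank condition -/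

section LinearPart

variable {F : Type*} [Field F] {ι : Type*}

/-- Every term of `p` already contains a parameter, so to first order in `μ` only the parameter-free
part of `g` counts. -/
theorem coeff_mul_of_radial_free {p : MvPowerSeries (Option ι) F}
    (hp : ∀ a, coeff a p ≠ 0 → a none = 0 ∧ a ≠ 0) (g : MvPowerSeries (Option ι) F) (i : ℕ)
    (j : ι) : coeff (Finsupp.single none i + Finsupp.single (some j) 1) (p * g) =
      coeff (Finsupp.single (some j) 1) p * coeff (Finsupp.single none i) g := by
  classical
  rw [coeff_mul, Finset.sum_eq_single (Finsupp.single (some j) 1, Finsupp.single none i)]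
  · rintro ⟨a, b⟩ hab hne
    rw [Finset.HasAntidiagonal.mem_antidiagonal] at hab
    by_cases ha : coeff a p = 0
    · rw [ha, zero_mul]
    · exfalso
      obtain ⟨h0, h1⟩ := hp a ha
      have hab' : a + b = Finsupp.single none i + Finsupp.single (some j) 1 := hab
      have h2 : ∀ x, a x + b x = _ := fun x => DFunLike.congr_fun hab' x
      have ha' : a = Finsupp.single (some j) 1 := by
        have h3 : ∀ x, x ≠ some j → a x = 0 := by
          intro x hx
          cases x with
          | none => exact h0
          | some x =>
            have := h2 (some x)
            simp [hx.symm] at this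
            exact this.1
        have h4 : a (some j) ≠ 0 := by
          intro h4
          refine h1 (Finsupp.ext fun x => ?_)
          by_cases hx : x = some j
          · rw [hx, h4]; rfl
          · exact h3 x hx
        have h5 := h2 (some j)
        simp at h5
        ext x
        by_cases hx : x = some j
        · rw [hx, Finsupp.single_eq_same]; omega
        · rw [h3 x hx, Finsupp.single_eq_of_ne hx]
      refine hne ?_
      rw [ha', add_comm] at hab'
      rw [ha', add_right_cancel hab']
  · intro h
    exact absurd (Finset.HasAntidiagonal.mem_antidiagonal.mpr (add_comm _ _)) h

theorem radial_free_paramPart (k : ℕ) (h : MvPowerSeries (Option ι) F) (a : Option ι →₀ ℕ)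
    (ha : coeff a (paramPart F ι k h) ≠ 0) : a none = 0 ∧ a ≠ 0 := by
  classical
  rw [coeff_paramPart] at ha
  exact (ite_ne_right_iff.mp ha).1

/-- The linear part in the parameters is that of the unfolding, up to a linear map. -/
theorem exists_mul_linearPart {r : ℕ} (hr : 1 ≤ r) {b₁ br : F} {φ s h : MvPowerSeries (Option ι) F}
    (hD : defect r b₁ br φ s (fun k => paramPart F ι k h) = 0) :
    ∃ N : Matrix (Fin (r + 1)) (Fin (r + 1)) F,
      (Matrix.of fun (i : Fin (r + 1)) (j : ι) =>
        coeff (Finsupp.single none (i : ℕ) + Finsupp.single (some j) 1) φ) =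
      N * Matrix.of fun (k : Fin (r + 1)) (j : ι) =>
        coeff (Finsupp.single (some j) 1) (paramPart F ι (k : ℕ) h) := by
  classical
  rw [defect, sub_eq_zero] at hD
  set τ := 1 + X none * s with hτ
  obtain ⟨υ, hυ⟩ : ∃ υ, τ ^ 2 * υ = 1 :=
    ⟨(τ ^ 2)⁻¹, MvPowerSeries.mul_inv_cancel _ (by simp [hτ])⟩
  obtain ⟨c, hc⟩ := sub_one_dvd_pow_sub_one τ (2 * (r - 1))
  have hτr : τ ^ (2 * r) = τ ^ 2 * (1 + X none * (s * c)) := by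
    have e : τ ^ (2 * r) = τ ^ 2 * τ ^ (2 * (r - 1)) := by
      rw [← pow_add]; congr 1; omega
    rw [e]
    linear_combination τ ^ 2 * hc + τ ^ 2 * c * hτ
  -- The unfolding equation divided by `τ²`. In degree at most `r` in `R`, only the sum over the
  -- `π_k` contributes terms linear in the parameters.
  have hφ : φ = C b₁ * X none + C br * X none ^ r + X none ^ (r + 1) * (C br * s * c)
      + ∑ k : Fin (r + 1), paramPart F ι k h * (X none ^ (k : ℕ) * τ ^ (2 * (k : ℕ)) * υ) := by
    have e : ∑ k : Fin (r + 1), paramPart F ι k h * (X none ^ (k : ℕ) * τ ^ (2 * (k : ℕ)) * υ) =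
        (∑ k ∈ Finset.range (r + 1), X none ^ k * paramPart F ι k h * τ ^ (2 * k)) * υ := by
      rw [Finset.sum_range, Finset.sum_mul]
      exact Finset.sum_congr rfl fun k _ => by ring
    rw [e]
    linear_combination υ * hD + C br * X none ^ r * υ * hτr
      + (-φ + C b₁ * X none + C br * X none ^ r * (1 + X none * (s * c))) * hυ
  refine ⟨Matrix.of fun i k => coeff (Finsupp.single none (i : ℕ))
    (X none ^ (k : ℕ) * τ ^ (2 * (k : ℕ)) * υ), ?_⟩
  ext i j
  have hi := i.2
  have hne : ∀ m, (Finsupp.single none (i : ℕ) + Finsupp.single (some j) 1 : Option ι →₀ ℕ) ≠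
      Finsupp.single none m := fun m hm => by
    have := DFunLike.congr_fun hm (some j)
    simp at this
  rw [Matrix.mul_apply, Matrix.of_apply]
  nth_rw 1 [hφ]
  rw [map_add, map_add, map_add, coeff_C_mul, coeff_C_mul, coeff_X, coeff_X_pow, if_neg (hne _),
    if_neg (hne _), coeff_X_none_pow_mul, if_neg (by simp; omega), map_sum]
  simp only [mul_zero, zero_add, Matrix.of_apply]
  refine Finset.sum_congr rfl fun k _ => ?_
  rw [coeff_mul_of_radial_free (radial_free_paramPart _ _), mul_comm]

/-- A matrix with independent rows is the upper part of an invertible matrix. -/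
theorem exists_completion {m q : ℕ} (hq : m ≤ q) (L : Matrix (Fin m) (Fin q) F)
    (hL : L.rank = m) : ∃ M M' : Matrix (Fin q) (Fin q) F, M * M' = 1 ∧ M' * M = 1 ∧
      ∀ k j, M (Fin.castLE hq k) j = L k j := by
  have hli : LinearIndependent F L.row := by
    rw [linearIndependent_iff_card_eq_finrank_span, Fintype.card_fin, Set.finrank,
      ← Matrix.rank_eq_finrank_span_row, hL]
  obtain ⟨n, rfl⟩ := Nat.exists_eq_add_of_le hq
  let b := Module.Basis.sumExtend hli
  have hb : ∀ k, b (Sum.inl k) = L.row k := fun k => by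
    simp [b, Module.Basis.sumExtend]
    rfl
  have hfin : Finite (Fin m ⊕ Module.Basis.sumExtendIndex hli) := Module.Finite.finite_basis b
  have hfin' : Finite (Module.Basis.sumExtendIndex hli) :=
    Finite.of_injective _ (Sum.inr_injective (α := Fin m))
  have hcard : Nat.card (Module.Basis.sumExtendIndex hli) = n := by
    have h := Module.finrank_eq_nat_card_basis b
    rw [Module.finrank_fin_fun, Nat.card_sum, Nat.card_fin] at h
    omega
  let e := (Equiv.sumCongr (Equiv.refl (Fin m)) (Finite.equivFinOfCardEq hcard)).trans
    finSumFinEquiv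
  let M : Matrix (Fin (m + n)) (Fin (m + n)) F := Matrix.of (b.reindex e)
  have hM : IsUnit M := by
    rw [← Matrix.linearIndependent_rows_iff_isUnit]
    exact (b.reindex e).linearIndependent
  obtain ⟨u, hu⟩ := hM
  refine ⟨M, (u⁻¹ : (Matrix (Fin (m + n)) (Fin (m + n)) F)ˣ), by rw [← hu]; simp,
    by rw [← hu]; simp, fun k j => ?_⟩
  have he : e.symm (Fin.castLE hq k) = Sum.inl k := by
    rw [Equiv.symm_apply_eq]
    simp [e]
    rfl
  change b.reindex e (Fin.castLE hq k) j = _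
  rw [Module.Basis.reindex_apply, he, hb]
  rfl

end LinearPart

/-! ### Parameter changes with prescribed leading components -/

section ParamChange

variable {F : Type*} [Field F] {q : ℕ}

theorem rename_killCompl {σ τ : Type*} (e : σ ↪ τ) {p : MvPowerSeries τ F}
    (hp : ∀ d, coeff d p ≠ 0 → ∀ i ∉ Set.range e, d i = 0) : rename e (killCompl e p) = p := by
  ext d
  by_cases hd : d ∈ Set.range (Finsupp.embDomain e)
  · obtain ⟨x, rfl⟩ := hd
    rw [coeff_embDomain_rename, coeff_killCompl]
  · have h1 : coeff d p = 0 := by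
      by_contra h
      refine hd ((Finsupp.mem_range_embDomain_iff e d).mpr fun i hi => ?_)
      by_contra h2
      exact (Finsupp.mem_support_iff.mp hi) (hp d h i h2)
    rw [h1]
    refine coeff_rename_eq_zero _ _ fun ⟨x, hx⟩ => hd ⟨x, ?_⟩
    rw [Finsupp.embDomain_eq_mapDomain, hx]

theorem exists_param_subst (P : Fin q → Fn F q) (hP : ∀ j, constantCoeff (P j) = 0) :
    ∃ Φ : Fn F q →ₐ[F] Fn F q, (∀ i, Φ (sv F q i) = sv F q i) ∧ ∀ j, Φ (par F q j) = P j := by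
  have hb : HasSubst (Sum.elim (sv F q) P) := by
    apply hasSubst_of_constantCoeff_zero
    rintro (i | j)
    · exact constantCoeff_sv i
    · exact hP j
  exact ⟨substAlgHom hb, fun i => substAlgHom_X hb (Sum.inl i), fun j => substAlgHom_X hb (Sum.inr j)⟩

/-- A substitution of parameter functions for the parameters is a change of parameters if its
linear part is invertible. -/
theorem exists_paramChange (P : Fin q → Fn F q) (hP : ∀ j, P j ∈ paramFns F q)
    (M M' : Matrix (Fin q) (Fin q) F) (hMM' : M * M' = 1) (hM'M : M' * M = 1)
    (h : ∀ j, P j - ∑ l, C (M j l) * par F q l ∈ ordIdeal (fun _ => 1) 2) :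
    ∃ Ψ : Fn F q ≃ₐ[F] Fn F q, IsParamChange Ψ ∧ ∀ j, Ψ (par F q j) = P j := by
  have hlin : ∀ (N : Matrix (Fin q) (Fin q) F) j,
      constantCoeff (∑ l, C (N j l) * par F q l) = 0 := fun N j => by
    simp [constantCoeff_par]
  have hP0 : ∀ j, constantCoeff (P j) = 0 := fun j => by
    have := mem_ordIdeal_one_iff.mp (ordIdeal_anti one_le_two (h j))
    rwa [map_sub, hlin, sub_zero] at this
  obtain ⟨Φ, hΦs, hΦp⟩ := exists_param_subst P hP0
  obtain ⟨Λ, hΛs, hΛp⟩ := exists_param_subst (fun j => ∑ l, C (M j l) * par F q l) (hlin M)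
  obtain ⟨Λ', hΛs', hΛp'⟩ := exists_param_subst (fun j => ∑ l, C (M' j l) * par F q l) (hlin M')
  have hC : ∀ (Θ : Fn F q →ₐ[F] Fn F q) (c : F), Θ (C c) = C c := fun Θ c => Θ.commutes c
  have hcomb : ∀ (N N' : Matrix (Fin q) (Fin q) F) (j : Fin q) (p : Fin q → Fn F q),
      ∑ l, C (N j l) * ∑ i, C (N' l i) * p i = ∑ i, C ((N * N') j i) * p i := by
    intro N N' j p
    simp only [Finset.mul_sum, Matrix.mul_apply, map_sum, map_mul, Finset.sum_mul]
    rw [Finset.sum_comm]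
    exact Finset.sum_congr rfl fun _ _ => Finset.sum_congr rfl fun _ _ => by ring
  have hone : ∀ (j : Fin q) (p : Fin q → Fn F q),
      ∑ i, C ((1 : Matrix (Fin q) (Fin q) F) j i) * p i = p j := by
    intro j p
    rw [Finset.sum_eq_single j]
    · simp
    · intro i _ hi
      rw [Matrix.one_apply_ne hi.symm, map_zero, zero_mul]
    · simp
  have hid : Λ'.comp Λ = AlgHom.id F (Fn F q) := by
    refine (algHom_ext_X (fun i => by simp) fun i => ?_).symm
    rcases i with i | j
    · change sv F q i = Λ' (Λ (sv F q i))
      rw [hΛs, hΛs']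
    · change par F q j = Λ' (Λ (par F q j))
      rw [hΛp, map_sum]
      simp only [map_mul, hC, hΛp', hcomb, hMM', hone]
  -- Composition with the inverse linear substitution makes `Φ` tangent to the identity, hence
  -- bijective.
  have hnear : ∀ i, (Φ.comp Λ') (X i) - X i ∈ ordIdeal (fun _ => 1) 2 := by
    rintro (i | j)
    · change Φ (Λ' (sv F q i)) - sv F q i ∈ _
      rw [hΛs', hΦs, sub_self]
      exact zero_mem _
    · change Φ (Λ' (par F q j)) - par F q j ∈ _
      have e : Φ (Λ' (par F q j)) - par F q j =
          ∑ l, C (M' j l) * (P l - ∑ i, C (M l i) * par F q i) := by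
        rw [hΛp', map_sum]
        simp only [map_mul, hC, hΦp, mul_sub, Finset.sum_sub_distrib, hcomb, hM'M, hone]
      rw [e]
      exact Ideal.sum_mem _ fun l _ => Ideal.mul_mem_left _ _ (h l)
  have hbij := bijective_of_near_identity _ hnear
  have hinj : Function.Injective Λ := fun a b hab => by
    have h1 := DFunLike.congr_fun hid a
    have h2 := DFunLike.congr_fun hid b
    simp only [AlgHom.comp_apply, AlgHom.id_apply] at h1 h2
    rw [← h1, ← h2, hab]
  have hΦ : Function.Bijective Φ := by
    constructor
    · intro a b hab
      refine hinj (hbij.1 ?_)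
      have h1 : ∀ a, (Φ.comp Λ') (Λ a) = Φ a := fun a =>
        congrArg Φ (DFunLike.congr_fun hid a)
      rw [h1, h1, hab]
    · exact fun b => (hbij.2 b).imp' Λ' fun _ h => h
  exact ⟨AlgEquiv.ofBijective Φ hΦ, ⟨hΦs, fun j => by
    change Φ (par F q j) ∈ _
    rw [hΦp]; exact hP j⟩, hΦp⟩

/-- The variables `R` (as `none`) and `μ_j` among `x`, `R`, `μ_j`. -/
def radVars (q : ℕ) : Option (Fin q) ↪ Fin 2 ⊕ Fin q :=
  ⟨fun i => i.elim (Sum.inl 1) Sum.inr, by rintro (_ | i) (_ | j) <;> simp⟩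

/-- The functions of `R` (the variable `none`) and the parameters, among all functions. -/
def radEmb (F : Type*) [Field F] (q : ℕ) : MvPowerSeries (Option (Fin q)) F →ₐ[F] Fn F q :=
  (emb F q).comp (rename (radVars q))

theorem radEmb_X_none : radEmb F q (X none) = rad F q :=
  (congrArg (emb F q) (rename_X (radVars q) none)).trans emb_X_R

theorem radEmb_X_some (j : Fin q) : radEmb F q (X (some j)) = par F q j :=
  (congrArg (emb F q) (rename_X (radVars q) (some j))).trans (emb_X_par j)

theorem radEmb_mem (a : MvPowerSeries (Option (Fin q)) F) : radEmb F q a ∈ eulerFns F q :=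
  emb_mem _

theorem constantCoeff_radEmb_X (i : Option (Fin q)) : constantCoeff (radEmb F q (X i)) = 0 := by
  cases i with
  | none => rw [radEmb_X_none, constantCoeff_rad]
  | some j => rw [radEmb_X_some, constantCoeff_par]

theorem exists_rename_some {p : MvPowerSeries (Option (Fin q)) F}
    (hp : ∀ a, coeff a p ≠ 0 → a none = 0 ∧ a ≠ 0) :
    ∃ p' : MvPowerSeries (Fin q) F, p = rename (Function.Embedding.some : Fin q ↪ _) p' := by
  refine ⟨killCompl _ p, (rename_killCompl _ fun d hd i hi => ?_).symm⟩
  cases i with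
  | none => exact (hp d hd).1
  | some i => exact absurd ⟨i, rfl⟩ hi

theorem radEmb_mem_paramFns {p : MvPowerSeries (Option (Fin q)) F}
    (hp : ∀ a, coeff a p ≠ 0 → a none = 0 ∧ a ≠ 0) : radEmb F q p ∈ paramFns F q := fun i => by
  obtain ⟨p', rfl⟩ := exists_rename_some hp
  have hX : ∀ j, radEmb F q (rename (Function.Embedding.some : Fin q ↪ _) (X j)) = par F q j :=
    fun j => by rw [rename_X]; exact radEmb_X_some j
  refine derivation_along_ext ((radEmb F q).comp (rename (Function.Embedding.some : Fin q ↪ _)))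
    (fun j => ?_) ((pderiv F (Sum.inl i : Fin 3 ⊕ Fin q)).toLinearMap ∘ₗ
      ((radEmb F q).comp (rename (Function.Embedding.some : Fin q ↪ _))).toLinearMap) 0
    (fun a b => ?_) (fun a b => ?_) (fun j => ?_) p'
  · exact (congrArg constantCoeff (hX j)).trans (constantCoeff_par j)
  · simp
  · simp
  · exact (congrArg _ (hX j)).trans (pderiv_par i j)

theorem map_radEmb_of_state {Φ : Fn F q →ₐ[F] Fn F q} (hΦ : ∀ j, Φ (par F q j) = par F q j)
    {p : MvPowerSeries (Option (Fin q)) F} (hp : ∀ a, coeff a p ≠ 0 → a none = 0 ∧ a ≠ 0) :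
    Φ (radEmb F q p) = radEmb F q p := by
  obtain ⟨p', rfl⟩ := exists_rename_some hp
  have hX : ∀ j, radEmb F q (rename (Function.Embedding.some : Fin q ↪ _) (X j)) = par F q j :=
    fun j => by rw [rename_X]; exact radEmb_X_some j
  refine (DFunLike.congr_fun (algHom_ext_X
    (Φ := (radEmb F q).comp (rename (Function.Embedding.some : Fin q ↪ _)))
    (Ψ := Φ.comp ((radEmb F q).comp (rename (Function.Embedding.some : Fin q ↪ _))))
    (fun j => ?_) (fun j => ?_)) p').symm
  · exact (congrArg constantCoeff (hX j)).trans (constantCoeff_par j)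
  · exact (hX j).trans ((hΦ j).symm.trans (congrArg Φ (hX j).symm))

theorem radEmb_sub_linearPart {p : MvPowerSeries (Option (Fin q)) F}
    (hp : ∀ a, coeff a p ≠ 0 → a none = 0 ∧ a ≠ 0) :
    radEmb F q p - ∑ l, C (coeff (Finsupp.single (some l) 1) p) * par F q l ∈
      ordIdeal (fun _ => 1) 2 := by
  classical
  have hC : ∀ c : F, radEmb F q (C c) = C c := fun c => (radEmb F q).commutes c
  have e : radEmb F q p - ∑ l, C (coeff (Finsupp.single (some l) 1) p) * par F q l =
      radEmb F q (p - ∑ l, C (coeff (Finsupp.single (some l) 1) p) * X (some l)) := by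
    rw [map_sub, map_sum]
    simp only [map_mul, hC, radEmb_X_some]
  rw [e]
  refine algHom_mem_ordIdeal _ constantCoeff_radEmb_X fun d hd => ?_
  rw [map_sub, map_sum]
  simp only [coeff_C_mul, coeff_X]
  have hd' : d.degree < 2 := by rwa [Finsupp.degree_eq_weight_one]
  by_cases h0 : ∃ i, d i ≠ 0
  · obtain ⟨i, hi⟩ := h0
    obtain ⟨e, rfl⟩ := exists_add_of_le
      (Finsupp.single_le_iff.mpr (Nat.one_le_iff_ne_zero.mpr hi))
    have he : e = 0 := by
      rw [map_add, Finsupp.degree_single] at hd'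
      exact (Finsupp.degree_eq_zero_iff e).mp (by omega)
    rw [he, add_zero]
    cases i with
    | none =>
      have : coeff (Finsupp.single none 1) p = 0 := by
        by_contra h
        simpa using (hp _ h).1
      rw [this, zero_sub, neg_eq_zero]
      refine Finset.sum_eq_zero fun l _ => ?_
      rw [if_neg, mul_zero]
      intro h
      have := DFunLike.congr_fun h none
      simp at this
    | some j =>
      rw [Finset.sum_eq_single j]
      · simp
      · intro l _ hl
        rw [if_neg, mul_zero]
        intro h
        have := DFunLike.congr_fun h (some l)
        simp [hl.symm] at this
      · simp
  · push Not at h0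
    have : d = 0 := Finsupp.ext h0
    have h1 : coeff (0 : Option (Fin q) →₀ ℕ) p = 0 := by
      by_contra h
      exact (hp 0 h).2 rfl
    rw [this, h1, zero_sub, neg_eq_zero]
    refine Finset.sum_eq_zero fun l _ => ?_
    rw [if_neg, mul_zero]
    intro h
    have := DFunLike.congr_fun h (some l)
    simp at this

end ParamChange

/-! ### From the second level form to the simplest normal form -/

section Simplest

variable {F : Type*} [Field F] {ι : Type*} {q r : ℕ}

/-- In a second level form `x` occurs only as the linear term, so `f - x` is a series in `R` and the
parameters. -/
theorem IsSecondLevel.exists_radEmb {f : Coef F q} (hf : IsSecondLevel f) :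
    ∃ φ : MvPowerSeries (Option (Fin q)) F, emb F q f = sv F q 0 + radEmb F q φ ∧
      ∀ d, coeff d φ = coeff (Finsupp.embDomain (radVars q) d) f := by
  classical
  have hsup : ∀ d, coeff d (f - X (Sum.inl 0)) ≠ 0 → ∀ i ∉ Set.range (radVars q), d i = 0 := by
    intro d hd i hi
    have hi0 : i = Sum.inl 0 := by
      rcases i with i | j
      · fin_cases i
        · rfl
        · exact absurd ⟨none, rfl⟩ hi
      · exact absurd ⟨some j, rfl⟩ hi
    rw [hi0]
    rw [map_sub, coeff_X] at hd
    split_ifs at hd with h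
    · rw [h, hf.2.1, sub_self] at hd
      exact absurd rfl hd
    · rw [sub_zero] at hd
      exact (hf.2.2 d hd).resolve_right h
  refine ⟨killCompl (radVars q) (f - X (Sum.inl 0)), ?_, fun d => ?_⟩
  · rw [radEmb, AlgHom.comp_apply, rename_killCompl _ hsup, map_sub, emb_X_x]
    ring
  · rw [coeff_killCompl, map_sub, coeff_X, if_neg, sub_zero]
    intro h
    have h1 := DFunLike.congr_fun h (Sum.inl 0)
    rw [Finsupp.embDomain_of_notMem_range] at h1
    · simp at h1
    · rintro ⟨_ | i, hi⟩
      · exact absurd (Sum.inl_injective hi) (by simp)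
      · exact Sum.inr_ne_inl hi

/-- With parameters of weight `r + 2`, monomials of smaller weight are pure powers of `R`; below
`R^(r+1)` the definition of the index leaves only `R` and `R^r`. -/
theorem exists_eq_radial_expansion (φ : MvPowerSeries (Option ι) F) {w : Option ι → ℕ}
    (hr : 2 ≤ r) (hw : w none = 1) (hw' : ∀ i, w (some i) = r + 2) {b₁ br : F}
    (h0 : coeff 0 φ = 0) (h1 : coeff (Finsupp.single none 1) φ = b₁)
    (hk : ∀ k, 1 < k → k < r → coeff (Finsupp.single none k) φ = 0)
    (hr' : coeff (Finsupp.single none r) φ = br) :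
    ∃ ψ χ, φ = C b₁ * X none + C br * X none ^ r + X none ^ (r + 1) * ψ + χ ∧
      χ ∈ ordIdeal w (r + 2) := by
  classical
  refine ⟨shift F ι (r + 1) φ, _, (add_sub_cancel _ φ).symm, fun d hd => ?_⟩
  have hd' : d = Finsupp.single none (d none) := by
    ext i
    cases i with
    | none => simp
    | some i =>
      rw [Finsupp.single_eq_of_ne (by simp)]
      by_contra hi
      obtain ⟨e, rfl⟩ := exists_add_of_le
        (Finsupp.single_le_iff.mpr (Nat.one_le_iff_ne_zero.mpr hi))
      rw [map_add, Finsupp.weight_single, hw', smul_eq_mul, one_mul] at hd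
      omega
  generalize d none = k at hd'
  subst hd'
  rw [Finsupp.weight_single, hw, smul_eq_mul, mul_one] at hd
  rw [map_sub, map_add, map_add, coeff_C_mul, coeff_C_mul, coeff_X, coeff_X_pow,
    coeff_X_none_pow_mul, coeff_shift]
  simp only [Finsupp.single_eq_same, (Finsupp.single_injective _).eq_iff]
  rcases lt_or_ge k (r + 1) with hkr | hkr
  · rw [if_neg (by omega : ¬ r + 1 ≤ k)]
    rcases Nat.lt_or_ge k 2 with h | h
    · interval_cases k
      · rw [if_neg (by omega), if_neg (by omega), Finsupp.single_zero, h0]; ring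
      · rw [if_pos rfl, if_neg (by omega), h1]; ring
    · rw [if_neg (by omega)]
      by_cases h2 : k = r
      · rw [if_pos h2, h2, hr']; ring
      · rw [if_neg h2, hk k (by omega) (by omega)]; ring
  · rw [if_neg (by omega), if_neg (by omega), if_pos hkr,
      tsub_add_cancel_of_le (Finsupp.single_le_single.mpr hkr)]
    ring

/-- A non-degenerate second level form is equivalent to the simplest normal form. -/
theorem IsSecondLevel.exists_sends [CharZero F] {f : Coef F q} (hf : IsSecondLevel f)
    (hr : IsLeast {k : ℕ | 1 < k ∧ coeff (Finsupp.single (Sum.inl 1) k) f ≠ 0} r)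
    (hrank : (coeffMatrix r f).rank = r + 1) (hq : r + 1 ≤ q) :
    ∃ β₁ βr : F, βr ≠ 0 ∧ ∃ γ ∈ permissible F q,
      Sends γ (nf hq β₁ βr (sv F q 0) (rad F q) • eulerE F q) (emb F q f • eulerE F q) := by
  have hr2 : 2 ≤ r := hr.1.1
  obtain ⟨φ, hφ, hcoeff⟩ := hf.exists_radEmb
  have hsingle : ∀ k, coeff (Finsupp.single none k) φ = coeff (Finsupp.single (Sum.inl 1) k) f :=
    fun k => by rw [hcoeff, Finsupp.embDomain_single]; rfl
  obtain ⟨ψ, χ, hφe, hχ⟩ := exists_eq_radial_expansion (r := r) φ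
    (w := fun i => i.elim 1 fun _ => r + 2) hr2 rfl (fun _ => rfl)
    (by rw [hcoeff, Finsupp.embDomain_zero]; exact hf.1) rfl
    (fun k hk hkr => by
      rw [hsingle]
      by_contra h
      exact absurd (hr.2 ⟨hk, h⟩) (by omega)) rfl
  set β₁ := coeff (Finsupp.single none 1) φ
  set βr := coeff (Finsupp.single none r) φ with hβr
  have hβr0 : βr ≠ 0 := by rw [hβr, hsingle]; exact hr.1.2
  obtain ⟨h, hD⟩ := exists_defect_eq_zero hr2 rfl (fun _ => rfl) hβr0 hφe hχ
  refine ⟨β₁, βr, hβr0, ?_⟩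
  -- the change of the parameters
  obtain ⟨N, hN⟩ := exists_mul_linearPart (by omega) hD
  set L : Matrix (Fin (r + 1)) (Fin q) F := Matrix.of fun k j =>
    coeff (Finsupp.single (some j) 1) (paramPart F (Fin q) (k : ℕ) h) with hL
  -- The non-degeneracy matrix factors as `N * L`, and a product has rank at most that of `L`.
  have hLrank : L.rank = r + 1 := by
    refine le_antisymm ((Matrix.rank_le_height L)) ?_
    have e : coeffMatrix r f = N * L := by
      rw [← hN]
      ext i j
      rw [coeffMatrix, Matrix.of_apply, Matrix.of_apply, hcoeff, Finsupp.embDomain_add,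
        Finsupp.embDomain_single, Finsupp.embDomain_single]
      rfl
    calc r + 1 = (N * L).rank := by rw [← e, hrank]
      _ ≤ L.rank := Matrix.rank_mul_le_right N L
  obtain ⟨M, M', hMM', hM'M, hM⟩ := exists_completion hq L hLrank
  have hfree := fun k => radial_free_paramPart (F := F) (ι := Fin q) k h
  -- The first `r + 1` parameters become `π_0, …, π_r`; the others become linear forms completing
  -- their linear parts to an invertible matrix.
  obtain ⟨Ψ, hΨ, hΨp⟩ := exists_paramChange
    (fun j => if hj : (j : ℕ) < r + 1 then radEmb F q (paramPart F (Fin q) j h)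
      else ∑ l, C (M j l) * par F q l)
    (fun j => by
      split_ifs
      · exact radEmb_mem_paramFns (hfree _)
      · exact sum_mem fun l _ =>
          mul_mem ((paramFns F q).algebraMap_mem (M j l)) (par_mem_paramFns l))
    M M' hMM' hM'M (fun j => by
      split_ifs with hj
      · have := radEmb_sub_linearPart (hfree j)
        convert this using 5 with l
        exact hM ⟨j, hj⟩ l
      · rw [sub_self]
        exact zero_mem _)
  have hΨC : ∀ c : F, Ψ (C c) = C c := fun c => Ψ.commutes c
  have hΨR : Ψ (rad F q) = rad F q := by simp only [rad, map_add, map_pow, hΨ.1]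
  have hΨk : ∀ k : Fin (r + 1), Ψ (par F q (Fin.castLE hq k)) =
      radEmb F q (paramPart F (Fin q) k h) := fun k => by
    rw [hΨp, dif_pos (show ((Fin.castLE hq k : Fin q) : ℕ) < r + 1 from k.2)]
    rfl
  -- the change of the state variables
  set t := 1 + X none * shift F (Fin q) (r + 2) h with ht
  set τ := radEmb F q t with hτ
  have hτm : τ ∈ eulerFns F q := radEmb_mem _
  have hτ0 : constantCoeff τ = 1 := by
    rw [hτ, ht, map_add, map_one, map_mul, radEmb_X_none, map_add, map_mul, constantCoeff_rad,
      zero_mul, map_one, add_zero]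
  obtain ⟨Φ, hΦp, hΦ0, hΦ1, hΦ2⟩ := exists_state_change τ hτ0
  have hΦC : ∀ c : F, Φ (C c) = C c := fun c => Φ.commutes c
  have hΦR : Φ (rad F q) = rad F q * τ ^ 2 := map_rad_of_state (Φ := Φ.toAlgHom) hΦ1 hΦ2
  have hΦk : ∀ k, Φ (radEmb F q (paramPart F (Fin q) k h)) =
      radEmb F q (paramPart F (Fin q) k h) := fun k =>
    map_radEmb_of_state (Φ := Φ.toAlgHom) hΦp (hfree k)
  -- The terms `x τ²` agree on both sides; what is left is the unfolding equation.
  have hg : Φ (Ψ (nf hq β₁ βr (sv F q 0) (rad F q))) = τ ^ 2 * emb F q f := by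
    have e := congrArg (radEmb F q) hD
    have hrC : ∀ c : F, radEmb F q (C c) = C c := fun c => (radEmb F q).commutes c
    rw [defect, ← ht, Finset.sum_range] at e
    simp only [map_sub, map_add, map_mul, map_pow, map_sum, ← hτ, radEmb_X_none, hrC,
      map_zero] at e
    simp only [nf, map_add, map_mul, map_pow, map_sum, hΨC, hΨR, hΨk, hΨ.1, hΦC, hΦR, hΦk, hΦ0]
    rw [hφ]
    have e2 : ∑ k : Fin (r + 1), (rad F q * τ ^ 2) ^ (k : ℕ) *
        radEmb F q (paramPart F (Fin q) k h) = ∑ k : Fin (r + 1), rad F q ^ (k : ℕ) *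
        radEmb F q (paramPart F (Fin q) k h) * τ ^ (2 * (k : ℕ)) :=
      Finset.sum_congr rfl fun k _ => by rw [mul_pow, ← pow_mul]; ring
    rw [e2, mul_pow, ← pow_mul]
    linear_combination -e
  -- the time rescaling
  have hem : τ + 2 * eulerE F q τ ∈ eulerFns F q :=
    add_mem hτm (mul_mem (ofNat_mem _ 2) (eulerE_mem hτm))
  have he0 : constantCoeff (τ + 2 * eulerE F q τ) = 1 := by simp [constantCoeff_eulerE, hτ0]
  obtain ⟨v, hv, hev⟩ := exists_inv_of_mem_eulerFns hem (by rw [he0]; exact one_ne_zero)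
  obtain ⟨i, hi, hτi⟩ := exists_inv_of_mem_eulerFns hτm (by rw [hτ0]; exact one_ne_zero)
  -- The state change produces the coefficient `τ³ f / (τ + 2 Eτ)`; its unit factor is removed by
  -- the time rescaling.
  have hu : (τ + 2 * eulerE F q τ) * i ^ 3 * (v * τ ^ 3) = 1 := by
    linear_combination (τ * i) ^ 3 * hev + ((τ * i) ^ 2 + τ * i + 1) * hτi
  let u : (Fn F q)ˣ := ⟨_, _, hu, by rw [mul_comm]; exact hu⟩
  have hum : (u : Fn F q) ∈ eulerFns F q := mul_mem hem (pow_mem hi 3)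
  have s1 := sends_param hΨ (nf hq β₁ βr (sv F q 0) (rad F q))
  have s2 := (sends_state_iff hτ0 hΦp hΦ0 hΦ1 hΦ2 (Ψ (nf hq β₁ βr (sv F q 0) (rad F q)))
    (v * τ ^ 3 * emb F q f)).mpr (by
      rw [hg]
      linear_combination τ ^ 3 * emb F q f * hev)
  have s3 := sends_inl u (v * τ ^ 3 * emb F q f)
  have e3 : (u : Fn F q) * (v * τ ^ 3 * emb F q f) = emb F q f := by
    change (τ + 2 * eulerE F q τ) * i ^ 3 * _ = _
    linear_combination emb F q f * hu
  rw [e3] at s3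
  refine ⟨_, mul_mem (Subgroup.subset_closure ?_)
    (mul_mem (Subgroup.subset_closure ?_) (Subgroup.subset_closure ?_)), (s1.mul s2).mul s3⟩
  · exact Or.inl (Or.inl ⟨u, hum, rfl⟩)
  · exact Or.inl (Or.inr ⟨Φ, ⟨hΦp, τ, hτm, hτ0, hΦ0, hΦ1, hΦ2⟩, rfl⟩)
  · exact Or.inr ⟨Ψ, hΨ, rfl⟩

end Simplest
end
end HopfZero

/-! ### Assembly of the four claims -/

theorem mainTheorem3 {F : Type*} [Field F] [CharZero F] {q : ℕ} (r : ℕ)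
    (f : Coef F q) (hf0 : MvPowerSeries.constantCoeff f = 0)
    (hf1 : MvPowerSeries.coeff (Finsupp.single (Sum.inl 0) 1) f ≠ 0)
    (hf : IsNondegenerate f r) :
    ∃ (hq : r + 1 ≤ q) (β₁ βr : F), 2 ≤ r ∧ βr ≠ 0 ∧
      let g : Fn F q := nf hq β₁ βr (sv F q 0) (rad F q)
      let gPolar : Fn F q := nf hq β₁ βr (sv F q 0) (sv F q 1 ^ 2)
      Transformable (rot F q + emb F q f • eulerE F q) (rot F q + g • eulerE F q) ∧
      IsPolarForm (rot F q + g • eulerE F q)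
        (polarField (sv F q 0 * gPolar)
          (MvPowerSeries.C (1 / 2 : F) * sv F q 1 * gPolar) 1) ∧
      (∀ α : Fin q → ℕ,
        (∀ k : Fin (r + 1), α (Fin.castLE hq k) = 2 * (r - (k : ℕ))) →
        ∀ s : NormalFormStyle F α, InLevel s g (2 * r + 1) ∧ InInfiniteLevel s g) ∧
      ¬ (symmetryGroup (g • eulerE F q)).FG ∧
      (¬ ∃ B : Finset (Gen F q), (B : Set (Gen F q)) ⊆ conormalSpace g ∧
        (conormalSpace g : Set (Gen F q)) ⊆
          Submodule.span (paramFns F q) (B : Set (Gen F q))) ∧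
      (∀ Φ : Fn F q ≃ₐ[F] Fn F q, IsStateChange Φ →
        Sends (SemidirectProduct.inr Φ) (g • eulerE F q) (g • eulerE F q) →
        ∃ c ∈ paramFns F q, IsTimeOneMap ((c * g) • eulerE F q) Φ) := by
  obtain ⟨f₂, hf₂, ⟨γ, hγ, hγf⟩, hr, hrank⟩ := hf
  have hq : r + 1 ≤ q := hrank ▸ Matrix.rank_le_width _
  have hr2 : 2 ≤ r := hr.1.1
  obtain ⟨β₁, βr, hβr, δ, hδ, hδf⟩ := hf₂.exists_sends hr hrank hq
  refine ⟨hq, β₁, βr, hr2, hβr, ?_, isPolarForm_nf hq β₁ βr, fun α hα s =>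
    ⟨inLevel_nf hq β₁ βr hr2 hα s, inInfiniteLevel_nf hq β₁ βr hr2 hα s⟩,
    not_fg_symmetryGroup hq β₁ βr hr2, fun ⟨B, _, hB⟩ =>
      not_fg_conormalSpace hq β₁ βr hr2 ⟨B, hB⟩, exists_isTimeOneMap hr2⟩
  -- `g` is itself a function of `x`, `R`, `μ`, so the inverse rotation restores `Θ`. The
  -- transformation of `IsSecondLevel.exists_sends` leads away from the normal form and is inverted
  -- here.
  obtain ⟨a, ha⟩ := nf_mem hq β₁ βr
  have hg := corotating_add (F := F) (q := q) a
  change emb F q a = _ at ha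
  rw [ha] at hg
  exact ⟨_, _, corotating_add f, ⟨δ⁻¹ * γ, mul_mem (inv_mem hδ) hγ, hγf.mul hδf.inv⟩, hg⟩
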